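/- Let $M$ be a complex manifold of complex dimension $n$ (not necessarily compact) with complex structure $J$, and let $g$ be a smooth $J$-invariant Riemannian metric on $M$, extended $\mathbb C$-bilinearly to $h$ on $T_{\mathbb C}M$. In local holomorphic coordinates $\{z^i\}$ write $h_{i\bar j}=h(\partial_{z^i},\partial_{\bar z^j})$, let $h^{k\bar\ell}$ be defined by $h^{k\bar\ell}h_{p\bar\ell}=\delta_{kp}$, and let $\Gamma_{ij}^k=h^{k\bar\ell}\frac{\partial h_{j\bar\ell}}{\partial z^i}$ be the Christoffel symbols of the Chern connection $\nabla^{\mathrm{Ch}}$ of $(T^{1,0}M,h)$ (repeated indices are summed). Let $\mathcal A_{g,J}$ be the set of smooth affine connections $\nabla$ on $T_{\mathbb R}M$ with $\nabla g=0$ and $\nabla J=0$. For a smooth section $\theta=\theta_{ij}^k\,dz^i\otimes dz^j\otimes\frac{\partial}{\partial z^k}$ of $\Omega^{1,0}(\mathrm{End}\,T^{1,0}M)$, write $\nabla=\nabla^\theta$ if $\nabla\in\mathcal A_{g,J}$ and the complexification of $\nabla$ satisfies $\nabla_{\partial_{z^i}}\partial_{z^j}=(\Gamma_{ij}^k+\theta_{ij}^k)\,\partial_{z^k}$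 in all local holomorphic coordinates. Let $\hat\nabla^\theta$ be the connection induced by $\nabla^\theta$ on $T^{1,0}M$, and let $R^\theta$, $\mathfrak R^\theta$, $\Theta$ be the curvature tensors of the complexified $\nabla^\theta$, of $\hat\nabla^\theta$ and of $\nabla^{\mathrm{Ch}}$, with the convention $R(X,Y,Z,W)=h(\nabla_X\nabla_YZ-\nabla_Y\nabla_XZ-\nabla_{[X,Y]}Z,W)$ and components $R_{i\bar jk\bar\ell}=R(\partial_{z^i},\partial_{\bar z^j},\partial_{z^k},\partial_{\bar z^\ell})$, $R_{ijk\bar\ell}=R(\partial_{z^i},\partial_{z^j},\partial_{z^k},\partial_{\bar z^\ell})$. Put $\mathfrak{Ric}^{(1)}(\theta)=\sqrt{-1}\,h^{k\bar\ell}\mathfrak R^\theta_{i\bar jk\bar\ell}\,dz^i\wedge d\bar z^j$, $\Theta^{(1)}=\sqrt{-1}\,h^{k\bar\ell}\Theta_{i\bar jk\bar\ell}\,dz^i\wedge d\bar z^j$ and $\theta_1=\theta_{ik}^k\,dz^i$. Then for every $\nabla^\theta\in\mathcal A_{g,J}$ the following hold. (1) In all local holomorphic coordinates, $$R^\theta_{i\bar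 jk\bar\ell}=\mathfrak R^\theta_{i\bar jk\bar\ell}=\Theta_{i\bar jk\bar\ell}-\Big(h_{k\bar p}\frac{\partial\overline{\theta_{j\ell}^p}}{\partial z^i}+h_{p\bar\ell}\frac{\partial\theta_{ik}^p}{\partial\bar z^j}\Big)+\Big(\theta_{ik}^p\,\overline{\theta_{j\ell}^q}\,h_{p\bar q}-h^{m\bar r}\theta_{im}^p\,\overline{\theta_{jr}^q}\,h_{p\bar\ell}h_{k\bar q}\Big),$$ $$R^\theta_{ijk\bar\ell}=\mathfrak R^\theta_{ijk\bar\ell}=\Big(\frac{\partial\theta_{jk}^m}{\partial z^i}-\frac{\partial\theta_{ik}^m}{\partial z^j}+\Gamma_{jk}^s\theta_{is}^m-\Gamma_{js}^m\theta_{ik}^s+\Gamma_{is}^m\theta_{jk}^s-\Gamma_{ik}^s\theta_{js}^m\Big)h_{m\bar\ell}+\Big(\theta_{ip}^m\theta_{jk}^p-\theta_{ik}^p\theta_{jp}^m\Big)h_{m\bar\ell}.$$ (2) The expressions defining $\mathfrak{Ric}^{(1)}(\theta)$ and $\Theta^{(1)}$ do not depend on the holomorphic coordinates, and $$\mathfrak{Ric}^{(1)}(\theta)=\Theta^{(1)}-\sqrt{-1}\,\big(\partial\bar\theta_1-\bar\partial\theta_1\big).$$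 (3) $\mathfrak{Ric}^{(1)}(\theta)$ and $\Theta^{(1)}$ are smooth real $\partial\bar\partial$-closed $(1,1)$-forms, and $[\mathfrak{Ric}^{(1)}(\theta)]=[\Theta^{(1)}]$ in the real Aeppli cohomology $H^{1,1}_{\mathrm A}(M,\mathbb R)$, the space of smooth real $\partial\bar\partial$-closed $(1,1)$-forms modulo the forms of this kind that lie in $\partial\Omega^{0,1}(M)+\bar\partial\Omega^{1,0}(M)$. -/

import Mathlib

open scoped Manifold ContDiff ComplexConjugate

noncomputable section

namespace HermitianConn

/-! ## Complex manifolds and the underlying real manifold -/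

/-- The model space `ℂⁿ`. -/
abbrev CSpace (n : ℕ) := EuclideanSpace ℂ (Fin n)

/-- A complex manifold (holomorphic atlas) is a real-analytic, hence smooth, manifold of real
dimension `2n`, with the same charts. -/
instance instRealManifold {n : ℕ} {M : Type*} [TopologicalSpace M] [ChartedSpace (CSpace n) M]
    [IsManifold 𝓘(ℂ, CSpace n) ω M] : IsManifold 𝓘(ℝ, CSpace n) ω M := by
  apply isManifold_of_contDiffOn
  intro e e' he he'
  have h := (contDiffGroupoid ω 𝓘(ℂ, CSpace n)).compatible he he'
  rw [contDiffGroupoid, mem_groupoid_of_pregroupoid] at h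
  have h1 : ContDiffOn ℂ ω _ _ := h.1
  exact h1.restrict_scalars ℝ

variable {n : ℕ} {M : Type*} [TopologicalSpace M] [ChartedSpace (CSpace n) M]

/-- The real tangent space `T_ℝ M` at `x`. As always in Mathlib, its underlying space is the model
space `ℂⁿ`, through the preferred (holomorphic) chart at `x`. -/
abbrev RT (n : ℕ) {M : Type*} [TopologicalSpace M] [ChartedSpace (CSpace n) M] (x : M) :=
  TangentSpace 𝓘(ℝ, CSpace n) x

/-- The holomorphic tangent space at `x`, as a complex vector space; it is `(T_ℝ M, J)`, identified
with `T^{1,0}M` through `v ↦ (v - √-1 J v) / 2`. -/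
abbrev HT (n : ℕ) {M : Type*} [TopologicalSpace M] [ChartedSpace (CSpace n) M] (x : M) :=
  TangentSpace 𝓘(ℂ, CSpace n) x

/-- The complex structure `J ∈ End(T_ℝ M)` of the complex manifold. -/
def J (x : M) : RT n x →L[ℝ] RT n x :=
  (Complex.I • ContinuousLinearMap.id ℝ (CSpace n) : CSpace n →L[ℝ] CSpace n)

/-- Local holomorphic coordinates `z = (z¹, …, zⁿ)` on `φ.source`: a chart of the maximal
holomorphic atlas. -/
def IsHolChart (φ : OpenPartialHomeomorph M (CSpace n)) : Prop :=
  φ ∈ IsManifold.maximalAtlas 𝓘(ℂ, CSpace n) ω M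

/-- A `J`-invariant smooth Riemannian metric, i.e. `(M, g, J)` is a Hermitian manifold. -/
structure HermitianMetric (n : ℕ) (M : Type*) [TopologicalSpace M] [ChartedSpace (CSpace n) M]
    [IsManifold 𝓘(ℂ, CSpace n) ω M] where
  /-- the Riemannian metric `g` -/
  metric : Bundle.ContMDiffRiemannianMetric 𝓘(ℝ, CSpace n) ∞ (CSpace n) (fun x : M ↦ RT n x)
  /-- `g(JX, JY) = g(X, Y)` -/
  invariant : ∀ (x : M) (u v : RT n x),
    metric.inner x (J x u) (J x v) = metric.inner x u v

/-! ## The complexified tangent bundle -/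

/-- The complexified tangent space `T_ℂ M = T_ℝ M ⊗ ℂ` at `x`; the pair `(u, v)` is
`u + √-1 v`. -/
abbrev CT (n : ℕ) {M : Type*} [TopologicalSpace M] [ChartedSpace (CSpace n) M] (x : M) :=
  RT n x × RT n x

/-- Complex scalar multiplication on `T_ℂ M`. -/
def csmul {x : M} (a : ℂ) (Z : CT n x) : CT n x :=
  (a.re • Z.1 - a.im • Z.2, a.re • Z.2 + a.im • Z.1)

/-- The projection `T_ℂ M → T^{1,0} M`, `Z ↦ (Z - √-1 J Z) / 2`. -/
def proj10 {x : M} (Z : CT n x) : CT n x :=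
  csmul (1 / 2) (Z - csmul Complex.I (J x Z.1, J x Z.2))

/-- Sections of `T_ℂ M`. -/
abbrev CField (n : ℕ) (M : Type*) [TopologicalSpace M] [ChartedSpace (CSpace n) M] :=
  ∀ x : M, CT n x

/-- The differential of a complex function at `x`, a real-linear map `T_ℝ M → ℂ`. -/
def dfun (f : M → ℂ) (x : M) : CSpace n →L[ℝ] ℂ := mfderiv 𝓘(ℝ, CSpace n) 𝓘(ℝ, ℂ) f x

/-- The derivative `Z f` of a complex function along a complex tangent vector (`ℂ`-linear
extension of the derivative along real vectors). -/
def dirDeriv {x : M} (Z : CT n x) (f : M → ℂ) : ℂ :=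
  dfun f x Z.1 + Complex.I * dfun f x Z.2

/-- The Lie bracket of complex vector fields (`ℂ`-bilinear extension). -/
def cbracket (X Y : CField n M) : CField n M := fun x ↦
  (VectorField.mlieBracket 𝓘(ℝ, CSpace n) (fun y ↦ (X y).1) (fun y ↦ (Y y).1) x -
      VectorField.mlieBracket 𝓘(ℝ, CSpace n) (fun y ↦ (X y).2) (fun y ↦ (Y y).2) x,
    VectorField.mlieBracket 𝓘(ℝ, CSpace n) (fun y ↦ (X y).1) (fun y ↦ (Y y).2) x +
      VectorField.mlieBracket 𝓘(ℝ, CSpace n) (fun y ↦ (X y).2) (fun y ↦ (Y y).1) x)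

/-- The curvature expression `D_X D_Y Z - D_Y D_X Z - D_{[X,Y]} Z` of an operator `D` acting on
sections `Z` along complex vector fields. -/
def curv (D : CField n M → CField n M → CField n M) (X Y Z : CField n M) : CField n M :=
  D X (D Y Z) - D Y (D X Z) - D (cbracket X Y) Z

/-! ## Local holomorphic coordinates -/

section Coordinates

variable (φ : OpenPartialHomeomorph M (CSpace n))

/-- The differential of the coordinates at `x`, read as a real-linear map `T_ℝ M → ℂⁿ`. -/
def dcoord (x : M) : CSpace n →L[ℝ] CSpace n :=
  mfderiv 𝓘(ℝ, CSpace n) 𝓘(ℝ, CSpace n) φ x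

/-- The real coordinate vector field in the constant direction `v ∈ ℂⁿ` (only meaningful on
`φ.source`); `v = e_i` gives `∂/∂xⁱ` and `v = √-1 e_i` gives `∂/∂yⁱ`, where `zⁱ = xⁱ + √-1 yⁱ`. -/
def realCoordField (v : CSpace n) : ∀ x : M, RT n x :=
  VectorField.mpullback 𝓘(ℝ, CSpace n) 𝓘(ℝ, CSpace n) φ (fun _ ↦ v)

/-- `∂/∂zⁱ = (∂/∂xⁱ - √-1 ∂/∂yⁱ) / 2`. -/
def dz (i : Fin n) : CField n M := fun x ↦
  ((1 / 2 : ℝ) • realCoordField φ (EuclideanSpace.single i 1) x,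
    -((1 / 2 : ℝ) • realCoordField φ (EuclideanSpace.single i Complex.I) x))

/-- `∂/∂z̄ⁱ = (∂/∂xⁱ + √-1 ∂/∂yⁱ) / 2`. -/
def dzbar (i : Fin n) : CField n M := fun x ↦
  ((1 / 2 : ℝ) • realCoordField φ (EuclideanSpace.single i 1) x,
    (1 / 2 : ℝ) • realCoordField φ (EuclideanSpace.single i Complex.I) x)

/-- The value `dzᵏ(Z)` of the coordinate one-form on a complex tangent vector. -/
def dzForm (k : Fin n) {x : M} (Z : CT n x) : ℂ :=
  dcoord φ x Z.1 k + Complex.I * dcoord φ x Z.2 k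

end Coordinates

section Hermitian

variable [IsManifold 𝓘(ℂ, CSpace n) ω M] (g : HermitianMetric n M)

/-- The `ℂ`-bilinear extension of `g` to `T_ℂ M`. -/
def hC {x : M} (Z W : CT n x) : ℂ :=
  ((g.metric.inner x Z.1 W.1 - g.metric.inner x Z.2 W.2 : ℝ) : ℂ) +
    Complex.I * ((g.metric.inner x Z.1 W.2 + g.metric.inner x Z.2 W.1 : ℝ) : ℂ)

variable (φ : OpenPartialHomeomorph M (CSpace n))

/-- The matrix `h_{i j̄} = h(∂/∂zⁱ, ∂/∂z̄ʲ)`. -/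
def hLow (x : M) : Matrix (Fin n) (Fin n) ℂ :=
  Matrix.of fun i j ↦ hC g (dz φ i x) (dzbar φ j x)

/-- The entries `h^{k l̄}`, normalized by `∑_l h^{k l̄} h_{p l̄} = δ_{kp}`. -/
def hUp (x : M) (k l : Fin n) : ℂ := (hLow g φ x)⁻¹ l k

/-- The Christoffel symbols `Γ_{ij}^k = h^{k l̄} ∂h_{j l̄}/∂zⁱ` of the Chern connection. -/
def Gam (i j k : Fin n) (x : M) : ℂ :=
  ∑ l, hUp g φ x k l * dirDeriv (dz φ i x) (fun y ↦ hLow g φ y j l)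

/-- The Chern connection on `T^{1,0}M` in the coordinates `φ`:
`∇_X Z = (X(Zᵏ) + Γ_{ij}^k Xⁱ Zʲ) ∂/∂zᵏ` for `Z = Zᵏ ∂/∂zᵏ`, where `Xⁱ = dzⁱ(X)`; thus
`∇_{∂/∂zⁱ} ∂/∂zʲ = Γ_{ij}^k ∂/∂zᵏ` and `∇_{∂/∂z̄ⁱ} ∂/∂zʲ = 0`. -/
def chern (X Z : CField n M) : CField n M := fun x ↦
  ∑ k, csmul (dirDeriv (X x) (fun y ↦ dzForm φ k (Z y)) +
    ∑ i, ∑ j, Gam g φ i j k x * dzForm φ i (X x) * dzForm φ j (Z x)) (dz φ k x)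

/-- The components `Θ_{i j̄ k l̄}` of the Chern curvature. -/
def chernCurv (i j k l : Fin n) (x : M) : ℂ :=
  hC g (curv (chern g φ) (dz φ i) (dzbar φ j) (dz φ k) x) (dzbar φ l x)

/-! ## The space of real connections compatible with the metric and the complex structure -/

/-- Affine connections on the real tangent bundle `T_ℝ M`. -/
abbrev AffineConn (n : ℕ) (M : Type*) [TopologicalSpace M] [ChartedSpace (CSpace n) M]
    [IsManifold 𝓘(ℂ, CSpace n) ω M] :=
  CovariantDerivative 𝓘(ℝ, CSpace n) (CSpace n) (fun x : M ↦ RT n x)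

/-- A vector field differentiable at `x`. -/
def FieldDiffAt (s : ∀ x : M, RT n x) (x : M) : Prop :=
  MDifferentiableAt 𝓘(ℝ, CSpace n) (𝓘(ℝ, CSpace n).prod 𝓘(ℝ, CSpace n))
    (fun y ↦ (⟨y, s y⟩ : TangentBundle 𝓘(ℝ, CSpace n) M)) x

/-- The space `𝒜_{g,J}`: smooth affine connections on `T_ℝ M` with `∇g = 0` and `∇J = 0`.
Mathlib writes `cov s x v` for `(∇_v s)(x)`. -/
structure MemAgJ (cov : AffineConn n M) : Prop where
  smooth : CovariantDerivative.ContMDiffCovariantDerivative cov ∞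
  metric : ∀ (x : M) (s t : ∀ y : M, RT n y), FieldDiffAt s x → FieldDiffAt t x →
    ∀ v : RT n x,
      (mfderiv 𝓘(ℝ, CSpace n) 𝓘(ℝ, ℝ) (fun y ↦ g.metric.inner y (s y) (t y)) x :
          CSpace n →L[ℝ] ℝ) v =
        g.metric.inner x (cov s x v) (t x) + g.metric.inner x (s x) (cov t x v)
  complex : ∀ (x : M) (s : ∀ y : M, RT n y), FieldDiffAt s x → ∀ v : RT n x,
    cov (fun y ↦ J y (s y)) x v = J x (cov s x v)

variable (cov : AffineConn n M)

/-- The `ℂ`-linear extension of a connection to `T_ℂ M`. -/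
def complexify (X Z : CField n M) : CField n M := fun x ↦
  (cov (fun y ↦ (Z y).1) x (X x).1 - cov (fun y ↦ (Z y).2) x (X x).2,
    cov (fun y ↦ (Z y).2) x (X x).1 + cov (fun y ↦ (Z y).1) x (X x).2)

/-- The connection `∇̂ = ρ(∇)` induced on `T^{1,0}M`; to be applied to sections `Z` of
`T^{1,0}M`. -/
def restrict10 (X Z : CField n M) : CField n M := fun x ↦ proj10 (complexify cov X Z x)

/-- The components `R_{i j̄ k l̄}` of the complexified curvature of `∇`. -/
def R_bar (i j k l : Fin n) (x : M) : ℂ :=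
  hC g (curv (complexify cov) (dz φ i) (dzbar φ j) (dz φ k) x) (dzbar φ l x)

/-- The components `R_{i j k l̄}` of the complexified curvature of `∇`. -/
def R_hol (i j k l : Fin n) (x : M) : ℂ :=
  hC g (curv (complexify cov) (dz φ i) (dz φ j) (dz φ k) x) (dzbar φ l x)

/-- The components `ℜ_{i j̄ k l̄}` of the curvature of `∇̂` on `T^{1,0}M`. -/
def RR_bar (i j k l : Fin n) (x : M) : ℂ :=
  hC g (curv (restrict10 cov) (dz φ i) (dzbar φ j) (dz φ k) x) (dzbar φ l x)

/-- The components `ℜ_{i j k l̄}` of the curvature of `∇̂` on `T^{1,0}M`. -/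
def RR_hol (i j k l : Fin n) (x : M) : ℂ :=
  hC g (curv (restrict10 cov) (dz φ i) (dz φ j) (dz φ k) x) (dzbar φ l x)

end Hermitian

/-! ## The form `θ` -/

/-- The components `θ_{ij}^k` of `θ = θ_{ij}^k dzⁱ ⊗ dzʲ ⊗ ∂/∂zᵏ`; here `θ x u v` stands for
`θ(u)(v)`. -/
def endComp (θ : ∀ x : M, HT n x →L[ℂ] HT n x →L[ℂ] HT n x)
    (φ : OpenPartialHomeomorph M (CSpace n)) (i j k : Fin n) (x : M) : ℂ :=
  dcoord φ x
    (θ x (realCoordField φ (EuclideanSpace.single i 1) x)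
      (realCoordField φ (EuclideanSpace.single j 1) x)) k

/-- Smooth sections of `Ω^{1,0}(End T^{1,0}M)`. -/
structure EndForm (n : ℕ) (M : Type*) [TopologicalSpace M] [ChartedSpace (CSpace n) M] where
  /-- the value at each point, complex linear in both arguments -/
  toFun : ∀ x : M, HT n x →L[ℂ] HT n x →L[ℂ] HT n x
  smooth : ∀ φ : OpenPartialHomeomorph M (CSpace n), IsHolChart φ → ∀ i j k : Fin n,
    ContMDiffOn 𝓘(ℝ, CSpace n) 𝓘(ℝ, ℂ) ∞ (endComp toFun φ i j k) φ.source

/-- The components `θ_{ij}^k`. -/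
abbrev EndForm.comp (θ : EndForm n M) (φ : OpenPartialHomeomorph M (CSpace n)) (i j k : Fin n) :
    M → ℂ :=
  endComp θ.toFun φ i j k

/-- `∇ = ∇^θ`: the `(1,0)`-part of the difference of `∇` and the Chern connection on `T^{1,0}M`
is `θ`, i.e. `∇_{∂/∂zⁱ} ∂/∂zʲ = (Γ_{ij}^k + θ_{ij}^k) ∂/∂zᵏ` in all holomorphic coordinates. For
`∇ ∈ 𝒜_{g,J}` the remaining part of `∇` is then fixed by `∇g = 0` and `∇J = 0`. -/
def IsNabla [IsManifold 𝓘(ℂ, CSpace n) ω M] (g : HermitianMetric n M) (cov : AffineConn n M)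
    (θ : EndForm n M) : Prop :=
  ∀ φ : OpenPartialHomeomorph M (CSpace n), IsHolChart φ → ∀ x ∈ φ.source, ∀ i j : Fin n,
    complexify cov (dz φ i) (dz φ j) x =
      ∑ k, csmul (Gam g φ i j k x + θ.comp φ i j k x) (dz φ k x)

/-! ## Complex differential forms -/

/-- Complex-valued `k`-forms (the real tangent space at each point has underlying space `ℂⁿ`). -/
abbrev CForm (n : ℕ) (M : Type*) (k : ℕ) := M → (CSpace n) [⋀^Fin k]→L[ℝ] ℂ

/-- The expression of a form in the coordinates `φ` (meaningful on `φ.target`): its pullback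
under `φ⁻¹`. -/
def inChart {k : ℕ} (φ : OpenPartialHomeomorph M (CSpace n)) (η : CForm n M k) :
    CSpace n → (CSpace n) [⋀^Fin k]→L[ℝ] ℂ := fun y ↦
  (η (φ.symm y)).compContinuousLinearMap
    (mfderiv 𝓘(ℝ, CSpace n) 𝓘(ℝ, CSpace n) φ.symm y : CSpace n →L[ℝ] CSpace n)

/-- Smooth forms. -/
def SmoothForm {k : ℕ} (η : CForm n M k) : Prop :=
  ∀ φ : OpenPartialHomeomorph M (CSpace n), IsHolChart φ →
    ContDiffOn ℝ ∞ (inChart φ η) φ.target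

/-- `η` is of type `(p,q)`, i.e. `η(c v₁, …, c v_k) = c^p c̄^q η(v₁, …, v_k)` for `c ∈ ℂ`, where
`c = a + √-1 b` acts on `T_ℝ M` as `a + b J`. -/
def IsType {k : ℕ} (p q : ℕ) (η : CForm n M k) : Prop :=
  ∀ (x : M) (c : ℂ) (v : Fin k → CSpace n),
    η x (fun a ↦ c • v a) = c ^ p * conj c ^ q * η x v

/-- The complex conjugate form. -/
def conjForm {k : ℕ} (η : CForm n M k) : CForm n M k := fun x ↦
  (Complex.conjCLE : ℂ →L[ℝ] ℂ).compContinuousAlternatingMap (η x)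

/-- On an open subset of `ℂⁿ`: `∂η = ∑ dzⁱ ∧ ∂η/∂zⁱ`, that is, the exterior derivative with the
derivative `Dη` replaced by its complex linear part `v ↦ (Dη(v) - √-1 Dη(√-1 v)) / 2`. -/
def delLoc {k : ℕ} (η : CSpace n → (CSpace n) [⋀^Fin k]→L[ℝ] ℂ) (y : CSpace n) :
    (CSpace n) [⋀^Fin (k + 1)]→L[ℝ] ℂ :=
  ContinuousAlternatingMap.alternatizeUncurryFin
    ((1 / 2 : ℂ) • (fderiv ℝ η y - Complex.I •
      (fderiv ℝ η y).comp (Complex.I • ContinuousLinearMap.id ℝ (CSpace n))))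

/-- On an open subset of `ℂⁿ`: `∂̄η = ∑ dz̄ⁱ ∧ ∂η/∂z̄ⁱ`, that is, the exterior derivative with the
derivative `Dη` replaced by its antilinear part `v ↦ (Dη(v) + √-1 Dη(√-1 v)) / 2`. -/
def delbarLoc {k : ℕ} (η : CSpace n → (CSpace n) [⋀^Fin k]→L[ℝ] ℂ) (y : CSpace n) :
    (CSpace n) [⋀^Fin (k + 1)]→L[ℝ] ℂ :=
  ContinuousAlternatingMap.alternatizeUncurryFin
    ((1 / 2 : ℂ) • (fderiv ℝ η y + Complex.I •
      (fderiv ℝ η y).comp (Complex.I • ContinuousLinearMap.id ℝ (CSpace n))))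

/-- The operator `∂` on forms on `M`, computed at `x` in the preferred chart at `x`. -/
def del {k : ℕ} (η : CForm n M k) : CForm n M (k + 1) := fun x ↦
  (delLoc (inChart (chartAt (CSpace n) x) η)
    (chartAt (CSpace n) x x)).compContinuousLinearMap (dcoord (chartAt (CSpace n) x) x)

/-- The operator `∂̄` on forms on `M`, computed at `x` in the preferred chart at `x`. -/
def delbar {k : ℕ} (η : CForm n M k) : CForm n M (k + 1) := fun x ↦
  (delbarLoc (inChart (chartAt (CSpace n) x) η)
    (chartAt (CSpace n) x x)).compContinuousLinearMap (dcoord (chartAt (CSpace n) x) x)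

/-- The form `dzⁱ` at `x`. -/
def dzAt (φ : OpenPartialHomeomorph M (CSpace n)) (i : Fin n) (x : M) : CSpace n →L[ℝ] ℂ :=
  ((EuclideanSpace.proj i : CSpace n →L[ℂ] ℂ).restrictScalars ℝ).comp (dcoord φ x)

/-- The wedge product of two one-forms at a point: `(a ∧ b)(u, v) = a(u) b(v) - a(v) b(u)`. -/
def wedge (a b : CSpace n →L[ℝ] ℂ) : (CSpace n) [⋀^Fin 2]→L[ℝ] ℂ :=
  ContinuousAlternatingMap.alternatizeUncurryFin
    (a.smulRight (ContinuousAlternatingMap.ofSubsingleton ℝ (CSpace n) ℂ (0 : Fin 1) b))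

/-- `√-1 ∑ (h^{k l̄} K_{i j̄ k l̄}) dzⁱ ∧ dz̄ʲ` at `x` in the coordinates `φ`. -/
def ricciLoc [IsManifold 𝓘(ℂ, CSpace n) ω M] (g : HermitianMetric n M)
    (φ : OpenPartialHomeomorph M (CSpace n)) (K : Fin n → Fin n → Fin n → Fin n → M → ℂ) (x : M) :
    (CSpace n) [⋀^Fin 2]→L[ℝ] ℂ :=
  Complex.I • ∑ i, ∑ j, (∑ k, ∑ l, hUp g φ x k l * K i j k l x) •
    wedge (dzAt φ i x) ((Complex.conjCLE : ℂ →L[ℝ] ℂ).comp (dzAt φ j x))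

/-- The first Ricci form `ℜic⁽¹⁾ = √-1 h^{k l̄} ℜ_{i j̄ k l̄} dzⁱ ∧ dz̄ʲ` of `∇̂` (computed at `x` in
the preferred chart at `x`). -/
def ricci1 [IsManifold 𝓘(ℂ, CSpace n) ω M] (g : HermitianMetric n M) (cov : AffineConn n M) :
    CForm n M 2 := fun x ↦
  ricciLoc g (chartAt (CSpace n) x) (RR_bar g (chartAt (CSpace n) x) cov) x

/-- The first Chern-Ricci form `Θ⁽¹⁾ = √-1 h^{k l̄} Θ_{i j̄ k l̄} dzⁱ ∧ dz̄ʲ` (computed at `x` in the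
preferred chart at `x`). -/
def chernRicci1 [IsManifold 𝓘(ℂ, CSpace n) ω M] (g : HermitianMetric n M) : CForm n M 2 := fun x ↦
  ricciLoc g (chartAt (CSpace n) x) (chernCurv g (chartAt (CSpace n) x)) x

/-- The `(1,0)`-form `θ₁ = θ_{ik}^k dzⁱ`, i.e. `θ₁(v) = tr_ℂ θ(v)`. -/
def trForm (θ : EndForm n M) : CForm n M 1 := fun x ↦
  ContinuousAlternatingMap.ofSubsingleton ℝ (CSpace n) ℂ (0 : Fin 1)
    (LinearMap.toContinuousLinearMap
      { toFun := fun v : CSpace n ↦ LinearMap.trace ℂ (HT n x) (θ.toFun x v).toLinearMap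
        map_add' := fun u v ↦
          (congrArg (fun L : HT n x →L[ℂ] HT n x ↦ LinearMap.trace ℂ (HT n x) L.toLinearMap)
            ((θ.toFun x).map_add u v)).trans (map_add (LinearMap.trace ℂ (HT n x)) _ _)
        map_smul' := fun r v ↦
          (congrArg (fun L : HT n x →L[ℂ] HT n x ↦ LinearMap.trace ℂ (HT n x) L.toLinearMap)
            ((θ.toFun x).map_smul (r : ℂ) v)).trans
              (map_smul (LinearMap.trace ℂ (HT n x)) (r : ℂ) _) })

/-! ## Real Aeppli cohomology in degree `(1,1)` -/

/-- Smooth real `(1,1)`-forms `η` with `∂∂̄η = 0`. -/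
structure IsAeppliCocycle (η : CForm n M 2) : Prop where
  smooth : SmoothForm η
  type11 : IsType 1 1 η
  real : conjForm η = η
  closed : del (delbar η) = 0

/-- `η ∈ im ∂ + im ∂̄`, i.e. `η = ∂β + ∂̄α` with smooth `β ∈ Ω^{0,1}(M)`, `α ∈ Ω^{1,0}(M)`. -/
def IsAeppliExact (η : CForm n M 2) : Prop :=
  ∃ β α : CForm n M 1, SmoothForm β ∧ IsType 0 1 β ∧ SmoothForm α ∧ IsType 1 0 α ∧
    η = del β + delbar α

section Aeppli

variable {k : ℕ}

theorem inChart_add (φ : OpenPartialHomeomorph M (CSpace n)) (η ζ : CForm n M k) :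
    inChart φ (η + ζ) = inChart φ η + inChart φ ζ := by
  funext y; ext v; rfl

theorem inChart_neg (φ : OpenPartialHomeomorph M (CSpace n)) (η : CForm n M k) :
    inChart φ (-η) = -inChart φ η := by
  funext y; ext v; rfl

theorem inChart_zero (φ : OpenPartialHomeomorph M (CSpace n)) :
    inChart φ (0 : CForm n M k) = 0 := by
  funext y; ext v; rfl

theorem SmoothForm.add {η ζ : CForm n M k} (hη : SmoothForm η) (hζ : SmoothForm ζ) :
    SmoothForm (η + ζ) := fun φ hφ ↦ by
  rw [inChart_add]; exact (hη φ hφ).add (hζ φ hφ)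

theorem SmoothForm.neg {η : CForm n M k} (hη : SmoothForm η) : SmoothForm (-η) :=
  fun φ hφ ↦ by
    rw [inChart_neg]; exact (hη φ hφ).neg

theorem SmoothForm.zero : SmoothForm (0 : CForm n M k) := fun φ _ ↦ by
  rw [inChart_zero]; exact contDiffOn_const

theorem SmoothForm.differentiableAt [IsManifold 𝓘(ℂ, CSpace n) ω M] {η : CForm n M k}
    (hη : SmoothForm η) (x : M) :
    DifferentiableAt ℝ (inChart (chartAt (CSpace n) x) η) (chartAt (CSpace n) x x) :=
  ((hη _ (IsManifold.chart_mem_maximalAtlas x)).contDiffAt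
    ((chartAt (CSpace n) x).open_target.mem_nhds
      ((chartAt (CSpace n) x).map_source (mem_chart_source _ x)))).differentiableAt (by simp)

theorem IsType.add {M : Type*} {p q : ℕ} {η ζ : CForm n M k} (hη : IsType p q η) (hζ : IsType p q ζ) :
    IsType p q (η + ζ) := fun x c v ↦ by
  have h1 := hη x c v
  have h2 := hζ x c v
  simp only [Pi.add_apply, ContinuousAlternatingMap.add_apply, h1, h2]; ring

theorem IsType.neg {M : Type*} {p q : ℕ} {η : CForm n M k} (hη : IsType p q η) : IsType p q (-η) :=
  fun x c v ↦ by
    have h1 := hη x c v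
    simp only [Pi.neg_apply, ContinuousAlternatingMap.neg_apply, h1]; ring

theorem IsType.zero {M : Type*} {p q : ℕ} : IsType p q (0 : CForm n M k) := fun x c v ↦ by
  simp

theorem alternatize_add (f f' : CSpace n →L[ℝ] (CSpace n) [⋀^Fin k]→L[ℝ] ℂ) :
    ContinuousAlternatingMap.alternatizeUncurryFin (f + f') =
      ContinuousAlternatingMap.alternatizeUncurryFin f +
        ContinuousAlternatingMap.alternatizeUncurryFin f' :=
  ContinuousAlternatingMap.alternatizeUncurryFin_add f f'

theorem del_add [IsManifold 𝓘(ℂ, CSpace n) ω M] {η ζ : CForm n M k} (hη : SmoothForm η)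
    (hζ : SmoothForm ζ) : del (η + ζ) = del η + del ζ := by
  funext x
  have h : delLoc (inChart (chartAt (CSpace n) x) η + inChart (chartAt (CSpace n) x) ζ)
      (chartAt (CSpace n) x x) = delLoc (inChart (chartAt (CSpace n) x) η)
      (chartAt (CSpace n) x x) + delLoc (inChart (chartAt (CSpace n) x) ζ)
      (chartAt (CSpace n) x x) := by
    unfold delLoc
    rw [fderiv_add (hη.differentiableAt x) (hζ.differentiableAt x), ← alternatize_add]
    congr 1
    rw [ContinuousLinearMap.add_comp]
    module
  unfold del
  rw [inChart_add, h]
  ext v; rfl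

theorem delbar_add [IsManifold 𝓘(ℂ, CSpace n) ω M] {η ζ : CForm n M k} (hη : SmoothForm η)
    (hζ : SmoothForm ζ) : delbar (η + ζ) = delbar η + delbar ζ := by
  funext x
  have h : delbarLoc (inChart (chartAt (CSpace n) x) η + inChart (chartAt (CSpace n) x) ζ)
      (chartAt (CSpace n) x x) = delbarLoc (inChart (chartAt (CSpace n) x) η)
      (chartAt (CSpace n) x x) + delbarLoc (inChart (chartAt (CSpace n) x) ζ)
      (chartAt (CSpace n) x x) := by
    unfold delbarLoc
    rw [fderiv_add (hη.differentiableAt x) (hζ.differentiableAt x), ← alternatize_add]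
    congr 1
    rw [ContinuousLinearMap.add_comp]
    module
  unfold delbar
  rw [inChart_add, h]
  ext v; rfl

theorem del_zero [IsManifold 𝓘(ℂ, CSpace n) ω M] : del (0 : CForm n M k) = 0 := by
  have h := del_add (SmoothForm.zero (n := n) (M := M) (k := k)) SmoothForm.zero
  rw [add_zero] at h
  exact left_eq_add.mp h

theorem delbar_zero [IsManifold 𝓘(ℂ, CSpace n) ω M] : delbar (0 : CForm n M k) = 0 := by
  have h := delbar_add (SmoothForm.zero (n := n) (M := M) (k := k)) SmoothForm.zero
  rw [add_zero] at h
  exact left_eq_add.mp h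

theorem del_neg [IsManifold 𝓘(ℂ, CSpace n) ω M] {η : CForm n M k} (hη : SmoothForm η) :
    del (-η) = -del η := by
  have h := del_add hη hη.neg
  rw [add_neg_cancel, del_zero] at h
  exact (neg_eq_of_add_eq_zero_right h.symm).symm

theorem delbar_neg [IsManifold 𝓘(ℂ, CSpace n) ω M] {η : CForm n M k} (hη : SmoothForm η) :
    delbar (-η) = -delbar η := by
  have h := delbar_add hη hη.neg
  rw [add_neg_cancel, delbar_zero] at h
  exact (neg_eq_of_add_eq_zero_right h.symm).symm

/-- Two cocycles are cohomologous if their difference lies in `im ∂ + im ∂̄`. -/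
def aeppliSetoid (n : ℕ) (M : Type*) [TopologicalSpace M] [ChartedSpace (CSpace n) M]
    [IsManifold 𝓘(ℂ, CSpace n) ω M] : Setoid {η : CForm n M 2 // IsAeppliCocycle η} where
  r η ζ := IsAeppliExact (η.1 - ζ.1)
  iseqv :=
    { refl := fun η ↦ ⟨0, 0, .zero, .zero, .zero, .zero, by
        rw [sub_self, del_zero, delbar_zero, add_zero]⟩
      symm := by
        rintro η ζ ⟨β, α, hβ, hβ', hα, hα', h⟩
        refine ⟨-β, -α, hβ.neg, hβ'.neg, hα.neg, hα'.neg, ?_⟩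
        rw [del_neg hβ, delbar_neg hα, ← neg_sub, h, neg_add]
      trans := by
        rintro η ζ ξ ⟨β, α, hβ, hβ', hα, hα', h⟩ ⟨β', α', kβ, kβ', kα, kα', h'⟩
        refine ⟨β + β', α + α', hβ.add kβ, hβ'.add kβ', hα.add kα, hα'.add kα', ?_⟩
        rw [del_add hβ kβ, delbar_add hα kα, ← sub_add_sub_cancel _ ζ.1, h, h']
        abel }

/-- The real Aeppli cohomology `H^{1,1}_A(M, ℝ)`: smooth real `(1,1)`-forms with `∂∂̄η = 0` modulo
those in `im ∂ + im ∂̄`. -/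
def AeppliH11 (n : ℕ) (M : Type*) [TopologicalSpace M] [ChartedSpace (CSpace n) M]
    [IsManifold 𝓘(ℂ, CSpace n) ω M] := Quotient (aeppliSetoid n M)

/-- The Aeppli class `[η]`. -/
def aeppliClass [IsManifold 𝓘(ℂ, CSpace n) ω M] (η : CForm n M 2) (h : IsAeppliCocycle η) :
    AeppliH11 n M := Quotient.mk (aeppliSetoid n M) ⟨η, h⟩

end Aeppli

end HermitianConn

end

open HermitianConn

noncomputable section

set_option linter.unusedSectionVars false

namespace HermitianConn

/-! ### Linear algebra of the complexified tangent space, and holomorphic charts as real charts -/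

section

variable {n : ℕ} {M : Type*} [TopologicalSpace M] [ChartedSpace (CSpace n) M]

/-! Everything is computed in the frame `∂/∂zᵏ` of `T^{1,0}M`. Since `∇J = 0`, the complexified
connection preserves `T^{1,0}M` (`isHolVec_complexify`), so the projection defining the induced
connection does nothing there and both connections have the same coefficients. Along `∂/∂zⁱ` these
are `Γ + θ` by definition. Along `∂/∂z̄ʲ` they are forced by `∇g = 0`: differentiating `h_{k l̄}`,
the Chern part already accounts for the whole derivative, so the coefficient must be minus the
adjoint of `θ_j` with respect to `h` (`complexify_dzbar_dz`).

Coordinate fields commute, so the curvature is the usual matrix expression in these coefficients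
(`curv_frame`). Identities are compared after lowering an index with the invertible matrix `h`,
where `Γ` turns into `∂h` (`sum_Gam_mul_hLow`). In type `(1,1)` the products of `Γ` with `θ̄` cancel
the terms in which a derivative falls on `h` (`RR_bar_formula`). In type `(2,0)` the pure `Γ` terms
vanish, because they reduce to the symmetry of the second derivatives of `h` (`Gam_flat`,
`RR_hol_formula`).

Under the trace `h^{k l̄}` the two quadratic terms in `θ` are equal and cancel, which leaves only
derivatives of `θ_{ik}^k` (`RR_bar_trace`). The Chern part has trace `-∂Γ_{ik}^k/∂z̄ʲ`. A change of
coordinates alters `Γ_{ik}^k dzⁱ` by a holomorphic form, namely `∂ log det` of the Jacobian, so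
`Θ⁽¹⁾` is globally defined (`dirDeriv_traceGam_change`); being locally `√-1 ∂̄` of this form, it is
`∂̄`-closed (`delbar_chernRicci1`).

For the cohomological part, `∂` and `∂̄` are shown to be natural under holomorphic maps and to
satisfy `∂² = ∂̄² = ∂∂̄ + ∂̄∂ = 0` (`typeDeriv_pullback`, `typeDeriv_anticomm`). The formula
`ricciLoc_RR_bar` then holds in every chart with a chart-free right side; it exhibits the difference
of the two Ricci forms as `∂β + ∂̄α` with `β = -√-1 θ̄₁` and `α = √-1 θ₁`. -/

/-- The complex vector space structure of `T_ℂ M`. -/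
instance instModuleCT (x : M) : Module ℂ (CT n x) where
  smul := csmul
  one_smul Z := by
    change csmul 1 Z = Z
    simp [csmul]
  mul_smul a b Z := by
    change csmul (a * b) Z = csmul a (csmul b Z)
    simp only [csmul, Complex.mul_re, Complex.mul_im]
    ext1 <;> dsimp only <;> module
  smul_zero a := by
    change csmul a 0 = 0
    simp [csmul]
  smul_add a Z W := by
    change csmul a (Z + W) = csmul a Z + csmul a W
    simp only [csmul, Prod.fst_add, Prod.snd_add]
    ext1 <;> simp only [Prod.fst_add, Prod.snd_add] <;> module
  add_smul a b Z := by
    change csmul (a + b) Z = csmul a Z + csmul b Z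
    simp only [csmul, Complex.add_re, Complex.add_im]
    ext1 <;> simp only [Prod.fst_add, Prod.snd_add] <;> module
  zero_smul Z := by
    change csmul 0 Z = 0
    simp [csmul]

theorem csmul_eq_smul {x : M} (a : ℂ) (Z : CT n x) : csmul a Z = a • Z := rfl

theorem smul_fst {x : M} (a : ℂ) (Z : CT n x) : (a • Z).1 = a.re • Z.1 - a.im • Z.2 := rfl

theorem smul_snd {x : M} (a : ℂ) (Z : CT n x) : (a • Z).2 = a.re • Z.2 + a.im • Z.1 := rfl

theorem real_map_smul (L : CSpace n →L[ℝ] ℂ) (c : ℝ) (u : CSpace n) :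
    L (c • u) = c * L u := by
  rw [L.map_smul, Complex.real_smul]

/-- Complex extension of a real-linear map `T_ℝ M → ℂ` to a complex linear map on `T_ℂ M`. -/
def extC {x : M} (L : CSpace n →L[ℝ] ℂ) : CT n x →ₗ[ℂ] ℂ where
  toFun Z := L Z.1 + Complex.I * L Z.2
  map_add' Z W := by
    have h1 : L (Z.1 + W.1 : RT n x) = L Z.1 + L W.1 := map_add L Z.1 W.1
    have h2 : L (Z.2 + W.2 : RT n x) = L Z.2 + L W.2 := map_add L Z.2 W.2
    simp only [Prod.fst_add, Prod.snd_add]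
    rw [h1, h2]; ring
  map_smul' a Z := by
    have h1 : L (a.re • Z.1 - a.im • Z.2 : RT n x) = a.re * L Z.1 - a.im * L Z.2 := by
      exact (map_sub L (a.re • Z.1 : CSpace n) (a.im • Z.2 : CSpace n)).trans
        (congrArg₂ (· - ·) (real_map_smul L a.re Z.1) (real_map_smul L a.im Z.2))
    have h2 : L (a.re • Z.2 + a.im • Z.1 : RT n x) = a.re * L Z.2 + a.im * L Z.1 := by
      exact (map_add L (a.re • Z.2 : CSpace n) (a.im • Z.1 : CSpace n)).trans
        (congrArg₂ (· + ·) (real_map_smul L a.re Z.2) (real_map_smul L a.im Z.1))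
    simp only [smul_fst, smul_snd, RingHom.id_apply, smul_eq_mul]
    rw [h1, h2]
    linear_combination (L Z.1 + Complex.I * L Z.2) * Complex.re_add_im a -
      a.im * L Z.2 * Complex.I_sq

theorem dirDeriv_eq_extC {x : M} (Z : CT n x) (f : M → ℂ) :
    dirDeriv Z f = extC (dfun f x) Z := rfl

theorem dzForm_eq_extC {x : M} (φ : OpenPartialHomeomorph M (CSpace n)) (k : Fin n) (Z : CT n x) :
    dzForm φ k Z = extC (dzAt φ k x) Z := rfl

section Metric

variable [IsManifold 𝓘(ℂ, CSpace n) ω M] (g : HermitianMetric n M)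

/-- The `ℂ`-bilinear extension of the metric as a bilinear map. -/
def hCBilin (x : M) : CT n x →ₗ[ℂ] CT n x →ₗ[ℂ] ℂ :=
  LinearMap.mk₂ ℂ (fun Z W ↦ hC g Z W)
    (fun Z Z' W ↦ by
      simp only [hC, Prod.fst_add, Prod.snd_add, map_add, add_apply]
      push_cast; ring)
    (fun a Z W ↦ by
      simp only [hC, smul_fst, smul_snd, map_add, map_sub, map_smul, add_apply,
        sub_apply, smul_apply, smul_eq_mul]
      push_cast
      generalize ((g.metric.inner x Z.1 W.1 : ℝ) : ℂ) = p
      generalize ((g.metric.inner x Z.2 W.1 : ℝ) : ℂ) = q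
      generalize ((g.metric.inner x Z.1 W.2 : ℝ) : ℂ) = r
      generalize ((g.metric.inner x Z.2 W.2 : ℝ) : ℂ) = s
      linear_combination (p - s + Complex.I * (r + q)) * Complex.re_add_im a -
        a.im * (r + q) * Complex.I_sq)
    (fun Z W W' ↦ by
      simp only [hC, Prod.fst_add, Prod.snd_add, map_add]
      push_cast; ring)
    (fun a Z W ↦ by
      simp only [hC, smul_fst, smul_snd, map_add, map_sub, map_smul, smul_eq_mul]
      push_cast
      generalize ((g.metric.inner x Z.1 W.1 : ℝ) : ℂ) = p
      generalize ((g.metric.inner x Z.2 W.1 : ℝ) : ℂ) = q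
      generalize ((g.metric.inner x Z.1 W.2 : ℝ) : ℂ) = r
      generalize ((g.metric.inner x Z.2 W.2 : ℝ) : ℂ) = s
      linear_combination (p - s + Complex.I * (r + q)) * Complex.re_add_im a -
        a.im * (r + q) * Complex.I_sq)

theorem hC_eq {x : M} (Z W : CT n x) : hC g Z W = hCBilin g x Z W := rfl

end Metric

/-! ### Holomorphic charts as charts of the real manifold -/

section Charts

variable [IsManifold 𝓘(ℂ, CSpace n) ω M]
variable {φ ψ : OpenPartialHomeomorph M (CSpace n)}

instance instRealManifoldSmooth : IsManifold 𝓘(ℝ, CSpace n) ∞ M :=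
  IsManifold.of_le (n := ω) (by simp)

/-- Membership in a maximal atlas only concerns transition maps, and a complex analytic map is real
smooth after restriction of scalars. This makes the theory of real manifolds available for every
holomorphic chart. -/
theorem IsHolChart.mem_real (hφ : IsHolChart φ) :
    φ ∈ IsManifold.maximalAtlas 𝓘(ℝ, CSpace n) ∞ M := by
  have key : ∀ e : OpenPartialHomeomorph (CSpace n) (CSpace n),
      e ∈ contDiffGroupoid ω 𝓘(ℂ, CSpace n) → e ∈ contDiffGroupoid ∞ 𝓘(ℝ, CSpace n) := by
    intro e he
    rw [contDiffGroupoid, mem_groupoid_of_pregroupoid] at he ⊢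
    have h1 : ContDiffOn ℂ ω _ _ := he.1
    have h2 : ContDiffOn ℂ ω _ _ := he.2
    exact ⟨(h1.restrict_scalars ℝ).of_le (by simp), (h2.restrict_scalars ℝ).of_le (by simp)⟩
  rw [IsHolChart, IsManifold.mem_maximalAtlas_iff] at hφ
  rw [IsManifold.mem_maximalAtlas_iff]
  exact fun e he ↦ ⟨key _ (hφ e he).1, key _ (hφ e he).2⟩

theorem isHolChart_chartAt (x : M) : IsHolChart (chartAt (CSpace n) x) :=
  IsManifold.chart_mem_maximalAtlas x

theorem IsHolChart.contMDiffOn (hφ : IsHolChart φ) :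
    ContMDiffOn 𝓘(ℝ, CSpace n) 𝓘(ℝ, CSpace n) ∞ φ φ.source :=
  contMDiffOn_of_mem_maximalAtlas hφ.mem_real

theorem IsHolChart.contMDiffOn_symm (hφ : IsHolChart φ) :
    ContMDiffOn 𝓘(ℝ, CSpace n) 𝓘(ℝ, CSpace n) ∞ φ.symm φ.target :=
  contMDiffOn_symm_of_mem_maximalAtlas hφ.mem_real

theorem IsHolChart.contMDiffAt (hφ : IsHolChart φ) {x : M} (hx : x ∈ φ.source) :
    ContMDiffAt 𝓘(ℝ, CSpace n) 𝓘(ℝ, CSpace n) ∞ φ x :=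
  hφ.contMDiffOn.contMDiffAt (φ.open_source.mem_nhds hx)

theorem IsHolChart.contMDiffAt_symm (hφ : IsHolChart φ) {y : CSpace n} (hy : y ∈ φ.target) :
    ContMDiffAt 𝓘(ℝ, CSpace n) 𝓘(ℝ, CSpace n) ∞ φ.symm y :=
  hφ.contMDiffOn_symm.contMDiffAt (φ.open_target.mem_nhds hy)

theorem IsHolChart.mdifferentiableAt (hφ : IsHolChart φ) {x : M} (hx : x ∈ φ.source) :
    MDifferentiableAt 𝓘(ℝ, CSpace n) 𝓘(ℝ, CSpace n) φ x :=
  (hφ.contMDiffAt hx).mdifferentiableAt (by simp)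

theorem IsHolChart.mdifferentiableAt_symm (hφ : IsHolChart φ) {y : CSpace n} (hy : y ∈ φ.target) :
    MDifferentiableAt 𝓘(ℝ, CSpace n) 𝓘(ℝ, CSpace n) φ.symm y :=
  (hφ.contMDiffAt_symm hy).mdifferentiableAt (by simp)

/-- The differential of the inverse chart. -/
def dsymm (φ : OpenPartialHomeomorph M (CSpace n)) (y : CSpace n) : CSpace n →L[ℝ] CSpace n :=
  mfderiv 𝓘(ℝ, CSpace n) 𝓘(ℝ, CSpace n) φ.symm y

theorem dcoord_dsymm (hφ : IsHolChart φ) {y : CSpace n} (hy : y ∈ φ.target) :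
    (dcoord φ (φ.symm y)).comp (dsymm φ y) = ContinuousLinearMap.id ℝ (CSpace n) := by
  have h := mfderiv_comp y (hφ.mdifferentiableAt (φ.map_target hy))
    (hφ.mdifferentiableAt_symm hy)
  have h2 : mfderiv 𝓘(ℝ, CSpace n) 𝓘(ℝ, CSpace n) (φ ∘ φ.symm) y =
      mfderiv 𝓘(ℝ, CSpace n) 𝓘(ℝ, CSpace n) (id : CSpace n → CSpace n) y := by
    apply Filter.EventuallyEq.mfderiv_eq
    filter_upwards [φ.open_target.mem_nhds hy] with z hz
    exact φ.right_inv hz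
  rw [h2, mfderiv_id] at h
  exact h.symm

theorem dsymm_dcoord (hφ : IsHolChart φ) {x : M} (hx : x ∈ φ.source) :
    (dsymm φ (φ x)).comp (dcoord φ x) = ContinuousLinearMap.id ℝ (CSpace n) := by
  have h0 : MDifferentiableAt 𝓘(ℝ, CSpace n) 𝓘(ℝ, CSpace n) φ.symm (φ x) :=
    hφ.mdifferentiableAt_symm (φ.map_source hx)
  have h := mfderiv_comp x h0 (hφ.mdifferentiableAt hx)
  have h2 : mfderiv 𝓘(ℝ, CSpace n) 𝓘(ℝ, CSpace n) (φ.symm ∘ φ) x =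
      mfderiv 𝓘(ℝ, CSpace n) 𝓘(ℝ, CSpace n) (id : M → M) x := by
    apply Filter.EventuallyEq.mfderiv_eq
    filter_upwards [φ.open_source.mem_nhds hx] with z hz
    exact φ.left_inv hz
  rw [h2, mfderiv_id] at h
  exact h.symm

/-- The differential of a holomorphic chart as a linear equivalence. -/
def dcoordEquiv (hφ : IsHolChart φ) {x : M} (hx : x ∈ φ.source) : CSpace n ≃L[ℝ] CSpace n :=
  ContinuousLinearEquiv.equivOfInverse (dcoord φ x) (dsymm φ (φ x))
    (fun v ↦ DFunLike.congr_fun (dsymm_dcoord hφ hx) v)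
    (fun v ↦ by
      have := dcoord_dsymm hφ (φ.map_source hx)
      rw [φ.left_inv hx] at this
      exact DFunLike.congr_fun this v)

theorem mfderiv_isInvertible (hφ : IsHolChart φ) {x : M} (hx : x ∈ φ.source) :
    (mfderiv 𝓘(ℝ, CSpace n) 𝓘(ℝ, CSpace n) φ x).IsInvertible :=
  ⟨dcoordEquiv hφ hx, rfl⟩

/-- The pullback of a vector field is defined through `ContinuousLinearMap.inverse`, which is zero
on non-invertible maps. On the source of the chart it is the genuine inverse, given by the
derivative of `φ.symm`. -/
theorem realCoordField_eq (hφ : IsHolChart φ) {x : M} (hx : x ∈ φ.source) (v : CSpace n) :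
    realCoordField φ v x = dsymm φ (φ x) v := by
  have h : (mfderiv 𝓘(ℝ, CSpace n) 𝓘(ℝ, CSpace n) φ x).inverse =
      ((dcoordEquiv hφ hx).symm : CSpace n →L[ℝ] CSpace n) :=
    ContinuousLinearMap.inverse_equiv (dcoordEquiv hφ hx)
  exact DFunLike.congr_fun h v

theorem dcoord_realCoordField (hφ : IsHolChart φ) {x : M} (hx : x ∈ φ.source) (v : CSpace n) :
    dcoord φ x (realCoordField φ v x) = v := by
  rw [realCoordField_eq hφ hx]
  exact (dcoordEquiv hφ hx).apply_symm_apply v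

theorem dcoord_injective (hφ : IsHolChart φ) {x : M} (hx : x ∈ φ.source) :
    Function.Injective (dcoord φ x) := (dcoordEquiv hφ hx).injective

/-- Coordinate changes are holomorphic. -/
theorem IsHolChart.contDiffOn_comp (hφ : IsHolChart φ) (hψ : IsHolChart ψ) :
    ContDiffOn ℂ ω (ψ ∘ φ.symm) (φ.symm ≫ₕ ψ).source := by
  have h := IsManifold.compatible_of_mem_maximalAtlas hφ hψ
  rw [contDiffGroupoid, mem_groupoid_of_pregroupoid] at h
  have h1 : ContDiffOn ℂ ω (ψ ∘ φ.symm) _ := h.1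
  simpa using h1

theorem trans_source_mem_nhds {x : M} (hx : x ∈ φ.source) (hx' : x ∈ ψ.source) :
    (φ.symm ≫ₕ ψ).source ∈ nhds (φ x) := by
  apply (φ.symm ≫ₕ ψ).open_source.mem_nhds
  simp [φ.map_source hx, φ.left_inv hx, hx']

theorem IsHolChart.contDiffAt_comp (hφ : IsHolChart φ) (hψ : IsHolChart ψ) {x : M}
    (hx : x ∈ φ.source) (hx' : x ∈ ψ.source) : ContDiffAt ℂ ω (ψ ∘ φ.symm) (φ x) :=
  (hφ.contDiffOn_comp hψ).contDiffAt (trans_source_mem_nhds hx hx')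

/-- Chain rule for `ψ = (ψ ∘ φ⁻¹) ∘ φ` near `x`. The first factor is holomorphic, so complex
linearity passes from one chart to another. -/
theorem dcoord_eq_fderiv_comp (hφ : IsHolChart φ) (hψ : IsHolChart ψ) {x : M}
    (hx : x ∈ φ.source) (hx' : x ∈ ψ.source) :
    dcoord ψ x = (fderiv ℝ (ψ ∘ φ.symm) (φ x)).comp (dcoord φ x) := by
  have h1 : MDifferentiableAt 𝓘(ℝ, CSpace n) 𝓘(ℝ, CSpace n) (ψ ∘ φ.symm) (φ x) :=
    (((hφ.contDiffAt_comp hψ hx hx').restrict_scalars ℝ).differentiableAt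
      (by simp)).mdifferentiableAt
  have h := mfderiv_comp x h1 (hφ.mdifferentiableAt hx)
  have h2 : mfderiv 𝓘(ℝ, CSpace n) 𝓘(ℝ, CSpace n) ((ψ ∘ φ.symm) ∘ φ) x =
      mfderiv 𝓘(ℝ, CSpace n) 𝓘(ℝ, CSpace n) ψ x := by
    apply Filter.EventuallyEq.mfderiv_eq
    filter_upwards [φ.open_source.mem_nhds hx] with z hz
    simp [φ.left_inv hz]
  rw [h2, mfderiv_eq_fderiv] at h
  exact h

theorem fderiv_real_I {E F : Type*} [NormedAddCommGroup E] [NormedSpace ℂ E]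
    [NormedAddCommGroup F] [NormedSpace ℂ F] {f : E → F} {y : E} (hf : DifferentiableAt ℂ f y)
    (v : E) : fderiv ℝ f y (Complex.I • v) = Complex.I • fderiv ℝ f y v := by
  rw [hf.fderiv_restrictScalars ℝ]
  simp

/-- The tangent space at `x` is the model space read through the preferred chart. This anchors `J`,
which is multiplication by `√-1` in exactly that identification. -/
theorem dcoord_chartAt_self (x : M) :
    dcoord (chartAt (CSpace n) x) x = ContinuousLinearMap.id ℝ (CSpace n) := by
  have h0 := (isHolChart_chartAt (n := n) x).mdifferentiableAt (mem_chart_source _ x)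
  have h : dcoord (chartAt (CSpace n) x) x =
      fderivWithin ℝ (writtenInExtChartAt 𝓘(ℝ, CSpace n) 𝓘(ℝ, CSpace n) x
        (chartAt (CSpace n) x)) (Set.range 𝓘(ℝ, CSpace n))
        (extChartAt 𝓘(ℝ, CSpace n) x x) := by
    rw [← h0.mfderiv]; rfl
  rw [h]
  have e : writtenInExtChartAt 𝓘(ℝ, CSpace n) 𝓘(ℝ, CSpace n) x (chartAt (CSpace n) x) =ᶠ[
      nhds (chartAt (CSpace n) x x)] id := by
    filter_upwards [(chartAt (CSpace n) x).open_target.mem_nhds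
      ((chartAt (CSpace n) x).map_source (mem_chart_source _ x))] with z hz
    simp [writtenInExtChartAt, hz, chartAt_self_eq]
  simp only [modelWithCornersSelf_coe, Set.range_id, fderivWithin_univ]
  exact e.fderiv_eq.trans fderiv_id

/-- Holomorphic coordinates have complex linear differential. -/
theorem dcoord_I (hφ : IsHolChart φ) {x : M} (hx : x ∈ φ.source) (v : CSpace n) :
    dcoord φ x (Complex.I • v) = Complex.I • dcoord φ x v := by
  rw [dcoord_eq_fderiv_comp (isHolChart_chartAt x) hφ (mem_chart_source _ x) hx,
    dcoord_chartAt_self]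
  exact fderiv_real_I (((isHolChart_chartAt x).contDiffAt_comp hφ (mem_chart_source _ x)
    hx).differentiableAt (by simp)) v

theorem realCoordField_I (hφ : IsHolChart φ) {x : M} (hx : x ∈ φ.source) (v : CSpace n) :
    realCoordField φ (Complex.I • v) x = J x (realCoordField φ v x) := by
  apply dcoord_injective hφ hx
  rw [dcoord_realCoordField hφ hx]
  have h : dcoord φ x (J x (realCoordField φ v x)) =
    Complex.I • dcoord φ x (realCoordField φ v x) := dcoord_I hφ hx (realCoordField φ v x)
  rw [h, dcoord_realCoordField hφ hx]

theorem realCoordField_smul (φ : OpenPartialHomeomorph M (CSpace n)) (c : ℝ) (v : CSpace n)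
    (x : M) : realCoordField φ (c • v) x = c • realCoordField φ v x :=
  map_smul (mfderiv 𝓘(ℝ, CSpace n) 𝓘(ℝ, CSpace n) φ x).inverse c v

end Charts

end

/-! ### Smooth functions, derivatives in complex directions, and the coordinate frame of `T^{1,0}M`
-/

section

variable {n : ℕ} {M : Type*} [TopologicalSpace M] [ChartedSpace (CSpace n) M]
variable [IsManifold 𝓘(ℂ, CSpace n) ω M]
variable {φ ψ : OpenPartialHomeomorph M (CSpace n)} {U : Set M} {x : M} {f h : M → ℂ}

/-! ### Complex coordinate directions -/

/-- The complex vector field `∂_a + √-1 ∂_b` with constant coefficients in the coordinates `φ`. -/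
def constField (φ : OpenPartialHomeomorph M (CSpace n)) (a b : CSpace n) : CField n M := fun x ↦
  (realCoordField φ a x, realCoordField φ b x)

/-- The standard basis vectors of `ℂⁿ`. -/
abbrev stdVec (i : Fin n) : CSpace n := EuclideanSpace.single i 1

theorem single_I (i : Fin n) :
    (EuclideanSpace.single i Complex.I : CSpace n) = Complex.I • stdVec i := by
  ext k; by_cases hk : k = i <;> simp [stdVec, hk]

theorem dz_eq_constField (φ : OpenPartialHomeomorph M (CSpace n)) (i : Fin n) :
    dz φ i = constField φ ((1 / 2 : ℝ) • stdVec i) ((-(1 / 2) : ℝ) • (Complex.I • stdVec i)) := by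
  funext x
  simp only [dz, constField, realCoordField_smul, single_I, neg_smul (M := RT n x)]

theorem dzbar_eq_constField (φ : OpenPartialHomeomorph M (CSpace n)) (i : Fin n) :
    dzbar φ i = constField φ ((1 / 2 : ℝ) • stdVec i) ((1 / 2 : ℝ) • (Complex.I • stdVec i)) := by
  funext x
  simp only [dzbar, constField, realCoordField_smul, single_I]

/-- The complex extension of a real linear form, evaluated at `u + √-1 v`. -/
def evalC (L : CSpace n →L[ℝ] ℂ) (u v : CSpace n) : ℂ := L u + Complex.I * L v

theorem dirDeriv_eq_evalC (Z : CT n x) (f : M → ℂ) : dirDeriv Z f = evalC (dfun f x) Z.1 Z.2 := rfl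

theorem evalC_add (L L' : CSpace n →L[ℝ] ℂ) (u v : CSpace n) :
    evalC (L + L') u v = evalC L u v + evalC L' u v := by
  simp only [evalC, add_apply]; ring

theorem evalC_zero (u v : CSpace n) : evalC (0 : CSpace n →L[ℝ] ℂ) u v = 0 := by
  simp [evalC]

theorem evalC_sub (L L' : CSpace n →L[ℝ] ℂ) (u v : CSpace n) :
    evalC (L - L') u v = evalC L u v - evalC L' u v := by
  simp only [evalC, sub_apply]; ring

theorem evalC_neg (L : CSpace n →L[ℝ] ℂ) (u v : CSpace n) : evalC (-L) u v = -evalC L u v := by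
  simp only [evalC, neg_apply]; ring

theorem evalC_smul (c : ℂ) (L : CSpace n →L[ℝ] ℂ) (u v : CSpace n) :
    evalC (c • L) u v = c * evalC L u v := by
  simp only [evalC, smul_apply, smul_eq_mul]; ring

theorem evalC_conj (L : CSpace n →L[ℝ] ℂ) (u v : CSpace n) :
    evalC ((Complex.conjCLE : ℂ →L[ℝ] ℂ).comp L) u v = conj (evalC L u (-v)) := by
  simp [evalC]

/-! ### Smooth functions on an open set -/

/-- Smooth complex functions on a subset of `M`. -/
def SmoothOn (U : Set M) (f : M → ℂ) : Prop := ContMDiffOn 𝓘(ℝ, CSpace n) 𝓘(ℝ, ℂ) ∞ f U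

/-- The part of the target of a chart corresponding to `U`. -/
def chartImage (φ : OpenPartialHomeomorph M (CSpace n)) (U : Set M) : Set (CSpace n) :=
  φ.target ∩ φ.symm ⁻¹' U

theorem isOpen_chartImage (hU : IsOpen U) : IsOpen (chartImage φ U) :=
  φ.isOpen_inter_preimage_symm hU

theorem mem_chartImage (hx : x ∈ U) (hx' : x ∈ φ.source) : φ x ∈ chartImage φ U :=
  ⟨φ.map_source hx', by simpa [φ.left_inv hx'] using hx⟩

/-- A chart is a diffeomorphism onto its image, so one chart containing `U` suffices. Derivatives
can then be handled by calculus on `ℂⁿ`. -/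
theorem smoothOn_iff (hφ : IsHolChart φ) (hUφ : U ⊆ φ.source) :
    SmoothOn (n := n) U f ↔ ContDiffOn ℝ ∞ (f ∘ φ.symm) (chartImage φ U) := by
  rw [← contMDiffOn_iff_contDiffOn]
  constructor
  · intro hf
    exact ContMDiffOn.comp hf (hφ.contMDiffOn_symm.mono Set.inter_subset_left) fun y hy ↦ hy.2
  · intro hf
    have := ContMDiffOn.comp hf (hφ.contMDiffOn.mono hUφ) fun y hy ↦ mem_chartImage hy (hUφ hy)
    refine this.congr fun y hy ↦ ?_
    simp [φ.left_inv (hUφ hy)]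

theorem SmoothOn.mono {V : Set M} (hf : SmoothOn (n := n) U f) (hV : V ⊆ U) :
    SmoothOn (n := n) V f := ContMDiffOn.mono hf hV

theorem SmoothOn.mdifferentiableAt (hf : SmoothOn (n := n) U f) (hU : IsOpen U) (hx : x ∈ U) :
    MDifferentiableAt 𝓘(ℝ, CSpace n) 𝓘(ℝ, ℂ) f x :=
  (ContMDiffOn.contMDiffAt hf (hU.mem_nhds hx)).mdifferentiableAt (by simp)

theorem smoothOn_const (c : ℂ) : SmoothOn (n := n) U (fun _ ↦ c) := contMDiffOn_const

theorem SmoothOn.comp_contDiff (hf : SmoothOn (n := n) U f) {T : ℂ → ℂ} (hT : ContDiff ℝ ∞ T) :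
    SmoothOn (n := n) U (fun y ↦ T (f y)) :=
  (contMDiff_iff_contDiff.mpr hT).comp_contMDiffOn hf

theorem SmoothOn.conj (hf : SmoothOn (n := n) U f) : SmoothOn (n := n) U (fun y ↦ conj (f y)) :=
  hf.comp_contDiff Complex.conjCLE.contDiff

theorem SmoothOn.neg (hf : SmoothOn (n := n) U f) : SmoothOn (n := n) U (fun y ↦ -(f y)) :=
  hf.comp_contDiff contDiff_neg

theorem SmoothOn.comp_contDiff₂ (hf : SmoothOn (n := n) U f) (hh : SmoothOn (n := n) U h)
    {T : ℂ × ℂ → ℂ} (hT : ContDiff ℝ ∞ T) : SmoothOn (n := n) U (fun y ↦ T (f y, h y)) :=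
  (contMDiff_iff_contDiff.mpr hT).comp_contMDiffOn (ContMDiffOn.prodMk_space hf hh)

theorem SmoothOn.add (hf : SmoothOn (n := n) U f) (hh : SmoothOn (n := n) U h) :
    SmoothOn (n := n) U (fun y ↦ f y + h y) := hf.comp_contDiff₂ hh contDiff_add

theorem SmoothOn.sub (hf : SmoothOn (n := n) U f) (hh : SmoothOn (n := n) U h) :
    SmoothOn (n := n) U (fun y ↦ f y - h y) := by
  simpa only [sub_eq_add_neg] using hf.add hh.neg

theorem SmoothOn.mul (hf : SmoothOn (n := n) U f) (hh : SmoothOn (n := n) U h) :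
    SmoothOn (n := n) U (fun y ↦ f y * h y) := hf.comp_contDiff₂ hh contDiff_mul

theorem SmoothOn.sum {ι : Type*} {s : Finset ι} {F : ι → M → ℂ}
    (hF : ∀ i ∈ s, SmoothOn (n := n) U (F i)) : SmoothOn (n := n) U (fun y ↦ ∑ i ∈ s, F i y) := by
  classical
  induction s using Finset.induction_on with
  | empty => simpa using smoothOn_const 0
  | insert a s ha ih =>
    simp only [Finset.sum_insert ha]
    exact (hF a (by simp)).add (ih fun i hi ↦ hF i (by simp [hi]))

theorem SmoothOn.prod {ι : Type*} {s : Finset ι} {F : ι → M → ℂ}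
    (hF : ∀ i ∈ s, SmoothOn (n := n) U (F i)) : SmoothOn (n := n) U (fun y ↦ ∏ i ∈ s, F i y) := by
  classical
  induction s using Finset.induction_on with
  | empty => simpa using smoothOn_const 1
  | insert a s ha ih =>
    simp only [Finset.prod_insert ha]
    exact (hF a (by simp)).mul (ih fun i hi ↦ hF i (by simp [hi]))

theorem SmoothOn.inv (hf : SmoothOn (n := n) U f) (h0 : ∀ y ∈ U, f y ≠ 0) :
    SmoothOn (n := n) U (fun y ↦ (f y)⁻¹) := fun y hy ↦
  (contMDiffAt_iff_contDiffAt.mpr (contDiffAt_inv ℝ (h0 y hy))).comp_contMDiffWithinAt y (hf y hy)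

/-! ### Derivatives along complex directions -/

/-- The derivative in the complex direction `a + √-1 b` on `ℂⁿ`. -/
def flatDeriv (a b : CSpace n) (F : CSpace n → ℂ) (y : CSpace n) : ℂ :=
  fderiv ℝ F y a + Complex.I * fderiv ℝ F y b

theorem dfun_eq (hφ : IsHolChart φ) (hx : x ∈ φ.source)
    (hf : MDifferentiableAt 𝓘(ℝ, CSpace n) 𝓘(ℝ, ℂ) f x) :
    dfun f x = (fderiv ℝ (f ∘ φ.symm) (φ x)).comp (dcoord φ x) := by
  have h0 : MDifferentiableAt 𝓘(ℝ, CSpace n) 𝓘(ℝ, CSpace n) φ.symm (φ x) :=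
    hφ.mdifferentiableAt_symm (φ.map_source hx)
  have hf' : MDifferentiableAt 𝓘(ℝ, CSpace n) 𝓘(ℝ, ℂ) f (φ.symm (φ x)) := by
    rwa [φ.left_inv hx]
  have h1 : MDifferentiableAt 𝓘(ℝ, CSpace n) 𝓘(ℝ, ℂ) (f ∘ φ.symm) (φ x) := hf'.comp _ h0
  have h2 := mfderiv_comp x h1 (hφ.mdifferentiableAt hx)
  have h3 : mfderiv 𝓘(ℝ, CSpace n) 𝓘(ℝ, ℂ) ((f ∘ φ.symm) ∘ φ) x =
      mfderiv 𝓘(ℝ, CSpace n) 𝓘(ℝ, ℂ) f x := by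
    apply Filter.EventuallyEq.mfderiv_eq
    filter_upwards [φ.open_source.mem_nhds hx] with z hz
    simp [φ.left_inv hz]
  rw [h3, mfderiv_eq_fderiv] at h2
  exact h2

theorem dirDeriv_constField (hφ : IsHolChart φ) (hx : x ∈ φ.source)
    (hf : MDifferentiableAt 𝓘(ℝ, CSpace n) 𝓘(ℝ, ℂ) f x) (a b : CSpace n) :
    dirDeriv (constField φ a b x) f = flatDeriv a b (f ∘ φ.symm) (φ x) := by
  have h : ∀ v, dfun f x (realCoordField φ v x) = fderiv ℝ (f ∘ φ.symm) (φ x) v := fun v ↦ by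
    rw [dfun_eq hφ hx hf]
    exact congrArg _ (dcoord_realCoordField hφ hx v)
  simp only [dirDeriv, flatDeriv, constField]
  rw [h, h]

theorem differentiableAt_comp_symm (hφ : IsHolChart φ) (hx : x ∈ φ.source)
    (hf : MDifferentiableAt 𝓘(ℝ, CSpace n) 𝓘(ℝ, ℂ) f x) :
    DifferentiableAt ℝ (f ∘ φ.symm) (φ x) := by
  have h0 : MDifferentiableAt 𝓘(ℝ, CSpace n) 𝓘(ℝ, CSpace n) φ.symm (φ x) :=
    hφ.mdifferentiableAt_symm (φ.map_source hx)
  have hf' : MDifferentiableAt 𝓘(ℝ, CSpace n) 𝓘(ℝ, ℂ) f (φ.symm (φ x)) := by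
    rwa [φ.left_inv hx]
  exact (hf'.comp _ h0).differentiableAt

theorem contDiffOn_flatDeriv {F : CSpace n → ℂ} {V : Set (CSpace n)} (hV : IsOpen V)
    (hF : ContDiffOn ℝ ∞ F V) (a b : CSpace n) : ContDiffOn ℝ ∞ (flatDeriv a b F) V := by
  have h1 : ContDiffOn ℝ ∞ (fderiv ℝ F) V := hF.fderiv_of_isOpen hV (by simp)
  exact (h1.clm_apply contDiffOn_const).add
    (contDiffOn_const.mul (h1.clm_apply contDiffOn_const))

theorem flatDeriv_congr {F G : CSpace n → ℂ} {y : CSpace n} (hFG : F =ᶠ[nhds y] G)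
    (a b : CSpace n) : flatDeriv a b F y = flatDeriv a b G y := by
  rw [flatDeriv, flatDeriv, hFG.fderiv_eq]

/-- Symmetry of the real second derivative, extended bilinearly to directions `a + √-1 b` with
constant coefficients. -/
theorem flatDeriv_comm {F : CSpace n → ℂ} {V : Set (CSpace n)} (hV : IsOpen V)
    (hF : ContDiffOn ℝ ∞ F V) {y : CSpace n} (hy : y ∈ V) (a b c d : CSpace n) :
    flatDeriv a b (flatDeriv c d F) y = flatDeriv c d (flatDeriv a b F) y := by
  have h1 : DifferentiableAt ℝ (fderiv ℝ F) y :=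
    ((hF.fderiv_of_isOpen hV (m := ∞) (by simp)).contDiffAt (hV.mem_nhds hy)).differentiableAt
      (by simp)
  have h2 : ∀ c d v : CSpace n, fderiv ℝ (flatDeriv c d F) y v =
      fderiv ℝ (fderiv ℝ F) y v c + Complex.I * fderiv ℝ (fderiv ℝ F) y v d := by
    intro c d v
    have hc : ∀ c, HasFDerivAt (fun z ↦ fderiv ℝ F z c)
        ((fderiv ℝ (fderiv ℝ F) y).flip c) y := fun c ↦ by
      simpa using h1.hasFDerivAt.clm_apply (hasFDerivAt_const c y)
    have h3 := ((hc c).add ((hc d).const_mul Complex.I)).fderiv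
    have h4 : flatDeriv c d F = (fun z ↦ fderiv ℝ F z c) + fun z ↦ Complex.I * fderiv ℝ F z d :=
      rfl
    rw [h4, h3]
    simp
  have hs : ∀ v w : CSpace n, fderiv ℝ (fderiv ℝ F) y v w = fderiv ℝ (fderiv ℝ F) y w v :=
    ((hF.contDiffAt (hV.mem_nhds hy)).isSymmSndFDerivAt
      (by rw [minSmoothness_of_isRCLikeNormedField]; exact WithTop.coe_le_coe.mpr le_top))
  simp only [flatDeriv] at h2 ⊢
  rw [h2, h2, h2, h2, hs c a, hs c b, hs d a, hs d b]
  ring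

theorem SmoothOn.dirDeriv_constField (hφ : IsHolChart φ) (hU : IsOpen U) (hUφ : U ⊆ φ.source)
    (hf : SmoothOn (n := n) U f) (a b : CSpace n) :
    SmoothOn (n := n) U (fun y ↦ dirDeriv (constField φ a b y) f) := by
  rw [smoothOn_iff hφ hUφ]
  refine (contDiffOn_flatDeriv (isOpen_chartImage hU) ((smoothOn_iff hφ hUφ).mp hf) a b).congr
    fun y hy ↦ ?_
  have := HermitianConn.dirDeriv_constField hφ (hUφ hy.2) (hf.mdifferentiableAt hU hy.2) a b
  simpa [φ.right_inv hy.1] using this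

theorem dirDeriv_congr (hfh : f =ᶠ[nhds x] h) (Z : CT n x) : dirDeriv Z f = dirDeriv Z h := by
  have : dfun (n := n) f x = dfun h x := hfh.mfderiv_eq
  rw [dirDeriv, dirDeriv, this]

theorem dirDeriv_congr_on (hU : IsOpen U) (hx : x ∈ U) (hfh : ∀ y ∈ U, f y = h y)
    (Z : CT n x) : dirDeriv Z f = dirDeriv Z h :=
  dirDeriv_congr (by filter_upwards [hU.mem_nhds hx] with y hy using hfh y hy) Z

/-- In the chart both sides are iterated flat derivatives. The inner one has to be identified on a
whole neighbourhood before the outer one can be taken. -/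
theorem dirDeriv_comm (hφ : IsHolChart φ) (hU : IsOpen U) (hUφ : U ⊆ φ.source)
    (hf : SmoothOn (n := n) U f) (hx : x ∈ U) (a b c d : CSpace n) :
    dirDeriv (constField φ a b x) (fun y ↦ dirDeriv (constField φ c d y) f) =
      dirDeriv (constField φ c d x) (fun y ↦ dirDeriv (constField φ a b y) f) := by
  have key : ∀ a b c d : CSpace n,
      dirDeriv (constField φ a b x) (fun y ↦ dirDeriv (constField φ c d y) f) =
        flatDeriv a b (flatDeriv c d (f ∘ φ.symm)) (φ x) := by
    intro a b c d
    rw [HermitianConn.dirDeriv_constField hφ (hUφ hx)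
      ((hf.dirDeriv_constField hφ hU hUφ c d).mdifferentiableAt hU hx)]
    apply flatDeriv_congr
    filter_upwards [(isOpen_chartImage hU).mem_nhds (mem_chartImage hx (hUφ hx))] with y hy
    have := HermitianConn.dirDeriv_constField hφ (hUφ hy.2) (hf.mdifferentiableAt hU hy.2) c d
    simpa [φ.right_inv hy.1] using this
  rw [key, key]
  exact flatDeriv_comm (isOpen_chartImage hU) ((smoothOn_iff hφ hUφ).mp hf)
    (mem_chartImage hx (hUφ hx)) a b c d

section Rules

variable (Z : CT n x)

theorem dfun_const (c : ℂ) : dfun (n := n) (fun _ ↦ c) x = 0 := mfderiv_const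

theorem dirDeriv_const (c : ℂ) : dirDeriv Z (fun _ ↦ c) = 0 := by
  rw [dirDeriv_eq_evalC, dfun_const]
  exact evalC_zero _ _

theorem dirDeriv_comp_clm (hf : MDifferentiableAt 𝓘(ℝ, CSpace n) 𝓘(ℝ, ℂ) f x) (T : ℂ →L[ℝ] ℂ) :
    dfun (fun y ↦ T (f y)) x = T.comp (dfun (n := n) f x) := by
  have h := mfderiv_comp x (T.differentiableAt.mdifferentiableAt (x := f x)) hf
  rw [mfderiv_eq_fderiv, T.fderiv] at h
  exact h

theorem dirDeriv_add (hf : MDifferentiableAt 𝓘(ℝ, CSpace n) 𝓘(ℝ, ℂ) f x)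
    (hh : MDifferentiableAt 𝓘(ℝ, CSpace n) 𝓘(ℝ, ℂ) h x) :
    dirDeriv Z (fun y ↦ f y + h y) = dirDeriv Z f + dirDeriv Z h := by
  have : dfun (n := n) (fun y ↦ f y + h y) x = dfun f x + dfun h x := mfderiv_add hf hh
  simp only [dirDeriv_eq_evalC]
  rw [this]
  exact evalC_add _ _ _ _

theorem dirDeriv_neg (f : M → ℂ) : dirDeriv Z (fun y ↦ -(f y)) = -dirDeriv Z f := by
  have : dfun (n := n) (fun y ↦ -(f y)) x = -dfun f x := mfderiv_neg
  simp only [dirDeriv_eq_evalC]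
  rw [this]
  exact evalC_neg _ _ _

theorem dirDeriv_sub (hf : MDifferentiableAt 𝓘(ℝ, CSpace n) 𝓘(ℝ, ℂ) f x)
    (hh : MDifferentiableAt 𝓘(ℝ, CSpace n) 𝓘(ℝ, ℂ) h x) :
    dirDeriv Z (fun y ↦ f y - h y) = dirDeriv Z f - dirDeriv Z h := by
  have : dfun (n := n) (fun y ↦ f y - h y) x = dfun f x - dfun h x := mfderiv_sub hf hh
  simp only [dirDeriv_eq_evalC]
  rw [this]
  exact evalC_sub _ _ _ _

theorem dirDeriv_mul (hf : MDifferentiableAt 𝓘(ℝ, CSpace n) 𝓘(ℝ, ℂ) f x)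
    (hh : MDifferentiableAt 𝓘(ℝ, CSpace n) 𝓘(ℝ, ℂ) h x) :
    dirDeriv Z (fun y ↦ f y * h y) = f x * dirDeriv Z h + h x * dirDeriv Z f := by
  have : dfun (n := n) (fun y ↦ f y * h y) x = f x • dfun h x + h x • dfun f x :=
    (hf.hasMFDerivAt.mul hh.hasMFDerivAt).mfderiv
  simp only [dirDeriv_eq_evalC]
  rw [this]
  exact (evalC_add _ _ _ _).trans (congrArg₂ (· + ·) (evalC_smul _ _ _ _) (evalC_smul _ _ _ _))

theorem dirDeriv_sum {ι : Type*} (s : Finset ι) {F : ι → M → ℂ}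
    (hF : ∀ i ∈ s, MDifferentiableAt 𝓘(ℝ, CSpace n) 𝓘(ℝ, ℂ) (F i) x) :
    dirDeriv Z (fun y ↦ ∑ i ∈ s, F i y) = ∑ i ∈ s, dirDeriv Z (F i) := by
  classical
  have key : MDifferentiableAt 𝓘(ℝ, CSpace n) 𝓘(ℝ, ℂ) (fun y ↦ ∑ i ∈ s, F i y) x ∧
      dirDeriv Z (fun y ↦ ∑ i ∈ s, F i y) = ∑ i ∈ s, dirDeriv Z (F i) := by
    induction s using Finset.induction_on with
    | empty => simpa using ⟨mdifferentiableAt_const, dirDeriv_const Z 0⟩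
    | insert a s ha ih =>
      obtain ⟨h1, h2⟩ := ih fun i hi ↦ hF i (by simp [hi])
      have h3 := hF a (by simp)
      simp only [Finset.sum_insert ha]
      exact ⟨h3.add h1, by rw [dirDeriv_add Z h3 h1, h2]⟩
  exact key.2

/-- A real differential commutes with conjugation, so only the factor `√-1` in the direction changes
sign. Exchanges of `∂/∂z` and `∂/∂z̄` on functions under conjugation come from here. -/
theorem dirDeriv_conj (hf : MDifferentiableAt 𝓘(ℝ, CSpace n) 𝓘(ℝ, ℂ) f x) (Z : CT n x) :
    dirDeriv Z (fun y ↦ conj (f y)) = conj (dirDeriv ((Z.1, -Z.2) : CT n x) f) := by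
  have h1 := dirDeriv_comp_clm hf (Complex.conjCLE : ℂ →L[ℝ] ℂ)
  have h2 : dfun (n := n) (fun y ↦ conj (f y)) x =
      (Complex.conjCLE : ℂ →L[ℝ] ℂ).comp (dfun f x) := h1
  simp only [dirDeriv_eq_evalC]
  rw [h2]
  exact evalC_conj _ _ _

end Rules

theorem conj_dz_vec (φ : OpenPartialHomeomorph M (CSpace n)) (i : Fin n) (x : M) :
    (((dz φ i x).1, -(dz φ i x).2) : CT n x) = dzbar φ i x := by
  simp [dz, dzbar]

theorem conj_dzbar_vec (φ : OpenPartialHomeomorph M (CSpace n)) (i : Fin n) (x : M) :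
    (((dzbar φ i x).1, -(dzbar φ i x).2) : CT n x) = dz φ i x := by
  simp [dz, dzbar]

theorem dirDeriv_dz_conj (hf : MDifferentiableAt 𝓘(ℝ, CSpace n) 𝓘(ℝ, ℂ) f x)
    (φ : OpenPartialHomeomorph M (CSpace n)) (i : Fin n) :
    dirDeriv (dz φ i x) (fun y ↦ conj (f y)) = conj (dirDeriv (dzbar φ i x) f) := by
  rw [dirDeriv_conj hf, conj_dz_vec]

theorem dirDeriv_dzbar_conj (hf : MDifferentiableAt 𝓘(ℝ, CSpace n) 𝓘(ℝ, ℂ) f x)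
    (φ : OpenPartialHomeomorph M (CSpace n)) (i : Fin n) :
    dirDeriv (dzbar φ i x) (fun y ↦ conj (f y)) = conj (dirDeriv (dz φ i x) f) := by
  rw [dirDeriv_conj hf, conj_dzbar_vec]

/-! ### The coordinate functions and the frame -/

/-- The `k`-th coordinate function of a chart. -/
def coordFun (φ : OpenPartialHomeomorph M (CSpace n)) (k : Fin n) : M → ℂ := fun y ↦ φ y k

theorem smoothOn_coordFun (hφ : IsHolChart φ) (k : Fin n) :
    SmoothOn (n := n) φ.source (coordFun φ k) :=
  ((EuclideanSpace.proj k : CSpace n →L[ℂ] ℂ).restrictScalars ℝ).contDiff.contMDiff.comp_contMDiffOn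
    hφ.contMDiffOn

theorem dfun_coordFun (hφ : IsHolChart φ) (hx : x ∈ φ.source) (k : Fin n) :
    dfun (coordFun φ k) x = dzAt φ k x := by
  let p := ((EuclideanSpace.proj k : CSpace n →L[ℂ] ℂ).restrictScalars ℝ)
  have h := mfderiv_comp x (p.differentiableAt.mdifferentiableAt (x := φ x))
    (hφ.mdifferentiableAt hx)
  rw [mfderiv_eq_fderiv, p.fderiv] at h
  exact h

/-- With coordinate forms viewed as differentials of functions, the Jacobian of a coordinate change
becomes a matrix of smooth functions to which the derivative rules apply. -/
theorem dzForm_eq_dirDeriv (hφ : IsHolChart φ) (hx : x ∈ φ.source) (k : Fin n) (Z : CT n x) :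
    dzForm φ k Z = dirDeriv Z (coordFun φ k) := by
  rw [dirDeriv_eq_extC, dfun_coordFun hφ hx, dzForm_eq_extC]

theorem dzForm_constField (hφ : IsHolChart φ) (hx : x ∈ φ.source) (k : Fin n) (a b : CSpace n) :
    dzForm φ k (constField φ a b x) = a k + Complex.I * b k := by
  simp only [dzForm, constField]
  rw [dcoord_realCoordField hφ hx, dcoord_realCoordField hφ hx]

theorem dzForm_dz (hφ : IsHolChart φ) (hx : x ∈ φ.source) (k i : Fin n) :
    dzForm φ k (dz φ i x) = if k = i then 1 else 0 := by
  rw [dz_eq_constField, dzForm_constField hφ hx]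
  by_cases h : k = i
  · simp [stdVec, h]
    linear_combination (-(1 / 2) : ℂ) * Complex.I_sq
  · simp [stdVec, h]

theorem dzForm_dzbar (hφ : IsHolChart φ) (hx : x ∈ φ.source) (k i : Fin n) :
    dzForm φ k (dzbar φ i x) = 0 := by
  rw [dzbar_eq_constField, dzForm_constField hφ hx]
  by_cases h : k = i
  · simp [stdVec, h]
    linear_combination ((1 / 2) : ℂ) * Complex.I_sq
  · simp [stdVec, h]

/-- Holomorphic tangent vectors, i.e. elements of `T^{1,0}M`. -/
def IsHolVec (Z : CT n x) : Prop := ((J x Z.1, J x Z.2) : CT n x) = Complex.I • Z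

theorem J_realCoordField (hφ : IsHolChart φ) (hx : x ∈ φ.source) (v : CSpace n) :
    J x (realCoordField φ v x) = realCoordField φ (Complex.I • v) x :=
  (realCoordField_I hφ hx v).symm

theorem isHolVec_dz (hφ : IsHolChart φ) (hx : x ∈ φ.source) (i : Fin n) :
    IsHolVec (dz φ i x) := by
  rw [IsHolVec, dz_eq_constField]
  refine Prod.ext ?_ ?_
  · simp only [constField, smul_fst, J_realCoordField hφ hx, Complex.I_re, Complex.I_im, zero_smul,
      one_smul, zero_sub]
    rw [← neg_one_smul ℝ, ← realCoordField_smul]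
    congr 1
    ext k
    by_cases h : k = i <;> simp [h, mul_comm Complex.I]
  · simp only [constField, smul_snd, J_realCoordField hφ hx, Complex.I_re, Complex.I_im, zero_smul,
      one_smul, zero_add]
    congr 1
    ext k
    by_cases h : k = i
    · simp [h]
      linear_combination (-(1 / 2) : ℂ) * Complex.I_sq
    · simp [h]

/-- A vector of type `(1,0)` has the form `u - √-1 Ju`, and complex linearity of the coordinates
gives `dzᵏ(Z) = 2 dzᵏ(u)`. The forms `dzᵏ` therefore determine `u`, and `u` determines the vector.
-/
theorem eq_of_dzForm_fst (hφ : IsHolChart φ) (hx : x ∈ φ.source) {Z W : CT n x}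
    (hZ : IsHolVec Z) (hW : IsHolVec W) (h : ∀ k, dzForm φ k Z = dzForm φ k W) : Z = W := by
  have snd : ∀ {Z : CT n x}, IsHolVec Z → J x Z.1 = -Z.2 := fun {Z} hZ ↦ by
    have := congrArg Prod.fst hZ
    simpa [smul_fst] using this
  have val : ∀ {Z : CT n x}, IsHolVec Z → ∀ k, dzForm φ k Z = 2 * dcoord φ x Z.1 k := by
    intro Z hZ k
    have h1 : Z.2 = -J x Z.1 := by rw [snd hZ, neg_neg]
    have h2 : dcoord φ x Z.2 = -(Complex.I • dcoord φ x Z.1) := by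
      rw [h1]
      have h3 : dcoord φ x (J x Z.1) = Complex.I • dcoord φ x Z.1 := dcoord_I hφ hx Z.1
      rw [← h3]
      exact map_neg (dcoord φ x) (J x Z.1)
    rw [dzForm, h2]
    simp only [PiLp.neg_apply, PiLp.smul_apply, smul_eq_mul]
    linear_combination (-(dcoord φ x Z.1 k)) * Complex.I_sq
  have e1 : Z.1 = W.1 := by
    apply dcoord_injective hφ hx
    ext k
    have := h k
    rw [val hZ, val hW] at this
    exact mul_left_cancel₀ two_ne_zero this
  refine Prod.ext e1 ?_
  have h1 := snd hZ
  have h2 := snd hW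
  rw [e1, h2] at h1
  exact (neg_injective h1).symm

theorem IsHolVec.smul {Z : CT n x} (hZ : IsHolVec Z) (a : ℂ) : IsHolVec (a • Z) := by
  unfold IsHolVec at *
  rw [smul_comm, ← hZ]
  refine Prod.ext ?_ ?_ <;> simp [smul_fst, smul_snd]

theorem IsHolVec.add {Z W : CT n x} (hZ : IsHolVec Z) (hW : IsHolVec W) : IsHolVec (Z + W) := by
  unfold IsHolVec at *
  rw [smul_add, ← hZ, ← hW]
  refine Prod.ext ?_ ?_ <;> simp

theorem isHolVec_zero : IsHolVec (0 : CT n x) := by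
  simp [IsHolVec]

theorem IsHolVec.sum {ι : Type*} {s : Finset ι} {Z : ι → CT n x} (hZ : ∀ i ∈ s, IsHolVec (Z i)) :
    IsHolVec (∑ i ∈ s, Z i) := by
  classical
  induction s using Finset.induction_on with
  | empty => simpa using isHolVec_zero
  | insert a s ha ih =>
    rw [Finset.sum_insert ha]
    exact (hZ a (by simp)).add (ih fun i hi ↦ hZ i (by simp [hi]))

theorem dzForm_sum (φ : OpenPartialHomeomorph M (CSpace n)) (k : Fin n) {ι : Type*}
    (s : Finset ι) (Z : ι → CT n x) : dzForm φ k (∑ i ∈ s, Z i) = ∑ i ∈ s, dzForm φ k (Z i) := by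
  simp only [dzForm_eq_extC, map_sum]

theorem dzForm_smul (φ : OpenPartialHomeomorph M (CSpace n)) (k : Fin n) (a : ℂ) (Z : CT n x) :
    dzForm φ k (a • Z) = a * dzForm φ k Z := by
  simp only [dzForm_eq_extC, map_smul, smul_eq_mul]

theorem dzForm_sum_dz (hφ : IsHolChart φ) (hx : x ∈ φ.source) (k : Fin n) (c : Fin n → ℂ) :
    dzForm φ k (∑ i, c i • dz φ i x) = c k := by
  simp [dzForm_sum, dzForm_smul, dzForm_dz hφ hx]

theorem isHolVec_sum_dz (hφ : IsHolChart φ) (hx : x ∈ φ.source) (c : Fin n → ℂ) :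
    IsHolVec (∑ i, c i • dz φ i x) :=
  IsHolVec.sum fun i _ ↦ (isHolVec_dz hφ hx i).smul _

/-- A vector of `T^{1,0}M` in terms of the coordinate frame. -/
theorem IsHolVec.eq_sum (hφ : IsHolChart φ) (hx : x ∈ φ.source) {Z : CT n x} (hZ : IsHolVec Z) :
    Z = ∑ k, dzForm φ k Z • dz φ k x :=
  eq_of_dzForm_fst hφ hx hZ (isHolVec_sum_dz hφ hx _) fun k ↦
    (dzForm_sum_dz hφ hx k fun k ↦ dzForm φ k Z).symm

/-- Substitute `JZ = √-1 Z` into `(Z - √-1 JZ) / 2`. This is why the induced connection on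
`T^{1,0}M` agrees with the complexified one there. -/
theorem IsHolVec.proj10_eq {Z : CT n x} (hZ : IsHolVec Z) : proj10 Z = Z := by
  unfold IsHolVec at hZ
  simp only [proj10, csmul_eq_smul]
  rw [hZ, smul_smul, Complex.I_mul_I, neg_one_smul, sub_neg_eq_add, ← two_smul ℂ, smul_smul]
  norm_num

end

/-! ### Commuting coordinate fields, the Hermitian matrix, and the Chern connection -/

section

variable {n : ℕ} {M : Type*} [TopologicalSpace M] [ChartedSpace (CSpace n) M]
variable [IsManifold 𝓘(ℂ, CSpace n) ω M]
variable {φ ψ : OpenPartialHomeomorph M (CSpace n)} {U : Set M} {x : M} {f h : M → ℂ}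

/-! ### Coordinate vector fields -/

theorem contMDiffAt_realCoordField (hφ : IsHolChart φ) (hx : x ∈ φ.source) (v : CSpace n) :
    ContMDiffAt 𝓘(ℝ, CSpace n) (𝓘(ℝ, CSpace n).prod 𝓘(ℝ, CSpace n)) ∞
      (fun y ↦ (⟨y, realCoordField φ v y⟩ : TangentBundle 𝓘(ℝ, CSpace n) M)) x := by
  have hc : ContMDiffAt 𝓘(ℝ, CSpace n) (𝓘(ℝ, CSpace n).prod 𝓘(ℝ, CSpace n)) ∞
      (fun y : CSpace n ↦ (⟨y, v⟩ : TangentBundle 𝓘(ℝ, CSpace n) (CSpace n))) (φ x) :=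
    contMDiffAt_vectorSpace_iff_contDiffAt.mpr contDiffAt_const
  exact ContMDiffAt.mpullback_vectorField_preimage hc (hφ.contMDiffAt hx)
    (mfderiv_isInvertible hφ hx) (by simp)

theorem fieldDiffAt_realCoordField (hφ : IsHolChart φ) (hx : x ∈ φ.source) (v : CSpace n) :
    FieldDiffAt (realCoordField φ v) x :=
  (contMDiffAt_realCoordField hφ hx v).mdifferentiableAt (by simp)

/-- Brackets are natural under pullback, and constant fields on `ℂⁿ` commute. -/
theorem mlieBracket_realCoordField (hφ : IsHolChart φ) (hx : x ∈ φ.source) (v w : CSpace n) :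
    VectorField.mlieBracket 𝓘(ℝ, CSpace n) (realCoordField φ v) (realCoordField φ w) x = 0 := by
  have hc : ∀ v : CSpace n, MDifferentiableAt 𝓘(ℝ, CSpace n)
      (𝓘(ℝ, CSpace n).prod 𝓘(ℝ, CSpace n))
      (fun y : CSpace n ↦ (⟨y, v⟩ : TangentBundle 𝓘(ℝ, CSpace n) (CSpace n))) (φ x) := fun v ↦
    (contMDiffAt_vectorSpace_iff_contDiffAt (n := 1).mpr contDiffAt_const).mdifferentiableAt
      (by simp)
  have h := VectorField.mpullback_mlieBracket (I := 𝓘(ℝ, CSpace n)) (I' := 𝓘(ℝ, CSpace n))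
    (f := φ) (x₀ := x) (V := fun _ ↦ v) (W := fun _ ↦ w) (hc v) (hc w)
    (hφ.contMDiffAt hx)
    (by rw [minSmoothness_of_isRCLikeNormedField]; exact WithTop.coe_le_coe.mpr le_top)
  refine h.symm.trans ?_
  have h2 : VectorField.mlieBracket 𝓘(ℝ, CSpace n) (fun _ : CSpace n ↦ v) (fun _ ↦ w) (φ x) =
      (0 : CSpace n) := by
    have e1 := VectorField.mlieBracketWithin_eq_lieBracketWithin (𝕜 := ℝ) (s := Set.univ)
      (V := fun _ : CSpace n ↦ v) (W := fun _ ↦ w)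
    refine (congrFun (VectorField.mlieBracketWithin_univ.symm.trans e1) (φ x)).trans ?_
    simp [VectorField.lieBracketWithin]
    rfl
  rw [VectorField.mpullback_apply, h2]
  exact map_zero (mfderiv 𝓘(ℝ, CSpace n) 𝓘(ℝ, CSpace n) φ x).inverse

theorem cbracket_constField (hφ : IsHolChart φ) (hx : x ∈ φ.source) (a b c d : CSpace n) :
    cbracket (constField φ a b) (constField φ c d) x = 0 := by
  have h : ∀ v w, VectorField.mlieBracket 𝓘(ℝ, CSpace n) (fun y ↦ realCoordField φ v y)
    (fun y ↦ realCoordField φ w y) x = 0 := fun v w ↦ mlieBracket_realCoordField hφ hx v w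
  simp [cbracket, constField, h]

/-! ### The metric in coordinates -/

variable (g : HermitianMetric n M)

theorem smoothOn_inner (hφ : IsHolChart φ) (v w : CSpace n) :
    SmoothOn (n := n) φ.source fun y ↦
      ((g.metric.inner y (realCoordField φ v y) (realCoordField φ w y) : ℝ) : ℂ) := by
  intro y hy
  have h := ContMDiffAt.clm_bundle_apply₂ (F₁ := CSpace n) (F₂ := CSpace n) (F₃ := ℝ)
    (E₃ := Bundle.Trivial M ℝ) (g.metric.contMDiff.contMDiffAt (x := y))
    (contMDiffAt_realCoordField hφ hy v) (contMDiffAt_realCoordField hφ hy w)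
  have h2 : ContMDiffAt 𝓘(ℝ, CSpace n) 𝓘(ℝ, ℝ) ∞
      (fun y ↦ g.metric.inner y (realCoordField φ v y) (realCoordField φ w y)) y := by
    simp only [Bundle.contMDiffAt_totalSpace] at h
    exact h.2
  have h3 : ContMDiffAt 𝓘(ℝ, ℝ) 𝓘(ℝ, ℂ) ∞ (fun r : ℝ ↦ (r : ℂ))
      (g.metric.inner y (realCoordField φ v y) (realCoordField φ w y)) :=
    Complex.ofRealCLM.contDiff.contMDiff.contMDiffAt
  exact (h3.comp y h2).contMDiffWithinAt

theorem smoothOn_hC (hφ : IsHolChart φ) (a b c d : CSpace n) :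
    SmoothOn (n := n) φ.source fun y ↦ hC g (constField φ a b y) (constField φ c d y) := by
  simp only [hC, constField, Complex.ofReal_add, Complex.ofReal_sub]
  exact ((smoothOn_inner g hφ _ _).sub (smoothOn_inner g hφ _ _)).add
    ((smoothOn_const _).mul ((smoothOn_inner g hφ _ _).add (smoothOn_inner g hφ _ _)))

theorem smoothOn_hLow (hφ : IsHolChart φ) (i j : Fin n) :
    SmoothOn (n := n) φ.source fun y ↦ hLow g φ y i j := by
  simp only [hLow, Matrix.of_apply, dz_eq_constField, dzbar_eq_constField]
  exact smoothOn_hC g hφ _ _ _ _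

theorem hC_conj (Z W : CT n x) :
    conj (hC g Z W) = hC g ((Z.1, -Z.2) : CT n x) ((W.1, -W.2) : CT n x) := by
  simp [hC]
  ring

theorem hC_symm (Z W : CT n x) : hC g Z W = hC g W Z := by
  simp only [hC, g.metric.symm x Z.1, g.metric.symm x Z.2]
  ring_nf

theorem hLow_conj (φ : OpenPartialHomeomorph M (CSpace n)) (x : M) (i j : Fin n) :
    conj (hLow g φ x i j) = hLow g φ x j i := by
  simp only [hLow, Matrix.of_apply]
  rw [hC_conj, conj_dz_vec, conj_dzbar_vec, hC_symm]

theorem hLow_isHermitian (φ : OpenPartialHomeomorph M (CSpace n)) (x : M) :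
    (hLow g φ x).IsHermitian := by
  ext i j
  simpa using hLow_conj g φ x j i

theorem hC_conj_self (Z : CT n x) : hC g Z ((Z.1, -Z.2) : CT n x) =
    ((g.metric.inner x Z.1 Z.1 + g.metric.inner x Z.2 Z.2 : ℝ) : ℂ) := by
  simp [hC, g.metric.symm x Z.2 Z.1]

/-- `h(Z, Z̄)` is the sum of the squared `g`-lengths of the real and imaginary parts of `Z`. -/
theorem eq_zero_of_hC_conj_self {Z : CT n x} (hZ : hC g Z ((Z.1, -Z.2) : CT n x) = 0) : Z = 0 := by
  have nn : ∀ v : RT n x, 0 ≤ g.metric.inner x v v := fun v ↦ by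
    by_cases hv : v = 0
    · simp [hv]
    · exact (g.metric.pos x v hv).le
  rw [hC_conj_self, Complex.ofReal_eq_zero] at hZ
  have h1 := nn Z.1
  have h2 := nn Z.2
  refine Prod.ext ?_ ?_
  · by_contra h
    have := g.metric.pos x _ h
    linarith
  · by_contra h
    have := g.metric.pos x _ h
    linarith

/-- A left null vector `c` of the matrix gives `Z = cⁱ ∂/∂zⁱ` orthogonal to all `∂/∂z̄ʲ`, hence to
`Z̄`. Positivity forces `Z = 0`, and applying `dzᵏ` recovers `c = 0`. -/
theorem isUnit_det_hLow (hφ : IsHolChart φ) (hx : x ∈ φ.source) : IsUnit (hLow g φ x).det := by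
  rw [isUnit_iff_ne_zero]
  intro h0
  obtain ⟨c, hc, hc0⟩ := Matrix.exists_vecMul_eq_zero_iff.mpr h0
  apply hc
  set Z : CT n x := ∑ i, c i • dz φ i x with hZdef
  have hd : ∀ j, hC g Z (dzbar φ j x) = 0 := by
    intro j
    have := congrFun hc0 j
    simpa [Matrix.vecMul, dotProduct, hZdef, hC_eq, hLow] using this
  have hbar : ((Z.1, -Z.2) : CT n x) = ∑ i, conj (c i) • dzbar φ i x := by
    have hc1 : ∀ (a : ℂ) (W : CT n x), (((a • W).1, -(a • W).2) : CT n x) =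
        conj a • ((W.1, -W.2) : CT n x) := by
      intro a W
      refine Prod.ext ?_ ?_
      · simp [smul_fst]
      · simp [smul_snd, add_comm]
    have hc2 : ∀ s : Finset (Fin n), (((∑ i ∈ s, c i • dz φ i x).1,
        -(∑ i ∈ s, c i • dz φ i x).2) : CT n x) = ∑ i ∈ s, conj (c i) • dzbar φ i x := by
      intro s
      induction s using Finset.induction_on with
      | empty => simp
      | insert a s ha ih =>
        rw [Finset.sum_insert ha, Finset.sum_insert ha, ← ih, ← conj_dz_vec φ a x, ← hc1]
        refine Prod.ext rfl ?_
        simp [add_comm]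
    exact hc2 _
  have hZ0 : Z = 0 := by
    apply eq_zero_of_hC_conj_self g
    rw [hbar, hC_eq, map_sum]
    simp only [map_smul, ← hC_eq, hd]
    simp
  funext k
  have := dzForm_sum_dz hφ hx k c
  rw [← hZdef, hZ0] at this
  simpa [dzForm_eq_extC] using this.symm

/-- Because of the transpose in `hUp`, contracting the barred index is the identity `h h⁻¹ = 1`;
contracting the unbarred one, in `sum_hUp_mul_hLow'`, is `h⁻¹ h = 1`. -/
theorem sum_hUp_mul_hLow (hφ : IsHolChart φ) (hx : x ∈ φ.source) (k p : Fin n) :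
    ∑ l, hUp g φ x k l * hLow g φ x p l = if k = p then 1 else 0 := by
  have h := congrFun (congrFun (Matrix.mul_nonsing_inv _ (isUnit_det_hLow g hφ hx)) p) k
  rw [Matrix.mul_apply, Matrix.one_apply] at h
  simp only [eq_comm (a := k)]
  rw [← h]
  exact Finset.sum_congr rfl fun l _ ↦ mul_comm _ _

theorem sum_hUp_mul_hLow' (hφ : IsHolChart φ) (hx : x ∈ φ.source) (l q : Fin n) :
    ∑ k, hUp g φ x k l * hLow g φ x k q = if l = q then 1 else 0 := by
  have h := congrFun (congrFun (Matrix.nonsing_inv_mul _ (isUnit_det_hLow g hφ hx)) l) q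
  rw [Matrix.mul_apply, Matrix.one_apply] at h
  exact h

theorem hUp_conj (φ : OpenPartialHomeomorph M (CSpace n)) (x : M) (k l : Fin n) :
    conj (hUp g φ x k l) = hUp g φ x l k := by
  have h := (hLow_isHermitian g φ x).inv
  exact h.apply k l

/-- Cramer's rule: the entries of the inverse are determinants of smooth matrices divided by the
nowhere vanishing determinant of `h`. -/
theorem smoothOn_hUp (hφ : IsHolChart φ) (k l : Fin n) :
    SmoothOn (n := n) φ.source fun y ↦ hUp g φ y k l := by
  have hdet : ∀ A : M → Matrix (Fin n) (Fin n) ℂ,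
      (∀ i j, SmoothOn (n := n) φ.source fun y ↦ A y i j) →
      SmoothOn (n := n) φ.source fun y ↦ (A y).det := by
    intro A hA
    simp only [Matrix.det_apply']
    exact SmoothOn.sum fun σ _ ↦ (smoothOn_const _).mul (SmoothOn.prod fun i _ ↦ hA _ _)
  simp only [hUp, Matrix.inv_def, Matrix.smul_apply, Ring.inverse_eq_inv', smul_eq_mul,
    Matrix.adjugate_apply]
  refine ((hdet _ fun i j ↦ smoothOn_hLow g hφ i j).inv
    fun y hy ↦ (isUnit_det_hLow g hφ hy).ne_zero).mul (hdet _ fun i j ↦ ?_)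
  -- The minor is the determinant of `h` with row `k` replaced by a constant basis vector, so row
  -- `k` is treated apart from the others.
  by_cases hi : i = k
  · subst hi
    simpa using smoothOn_const _
  · simpa [Matrix.updateRow_ne hi] using smoothOn_hLow g hφ i j

/-! ### The Chern connection -/

theorem smoothOn_dz_deriv (hφ : IsHolChart φ) (hU : IsOpen U) (hUφ : U ⊆ φ.source)
    (hf : SmoothOn (n := n) U f) (i : Fin n) : SmoothOn (n := n) U fun y ↦ dirDeriv (dz φ i y) f := by
  rw [dz_eq_constField]
  exact hf.dirDeriv_constField hφ hU hUφ _ _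

theorem smoothOn_Gam (hφ : IsHolChart φ) (i j k : Fin n) :
    SmoothOn (n := n) φ.source (Gam g φ i j k) :=
  SmoothOn.sum fun l _ ↦ (smoothOn_hUp g hφ k l).mul
    (smoothOn_dz_deriv hφ φ.open_source subset_rfl (smoothOn_hLow g hφ j l) i)

theorem sum_mul_ite_symm {ι R : Type*} [Fintype ι] [DecidableEq ι] [Semiring R] (k : ι) (F : ι → R) :
    ∑ l, F l * (if l = k then 1 else 0) = F k := by simp

/-- The inverse matrix in the definition of `Γ` cancels. This is the form in which metric
compatibility of the Chern connection enters all later computations. -/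
theorem sum_Gam_mul_hLow (hφ : IsHolChart φ) (hx : x ∈ φ.source) (i j l : Fin n) :
    ∑ m, Gam g φ i j m x * hLow g φ x m l = dirDeriv (dz φ i x) fun y ↦ hLow g φ y j l := by
  simp only [Gam, Finset.sum_mul]
  rw [Finset.sum_comm]
  have : ∀ r, ∑ m, hUp g φ x m r * dirDeriv (dz φ i x) (fun y ↦ hLow g φ y j r) *
      hLow g φ x m l = dirDeriv (dz φ i x) (fun y ↦ hLow g φ y j r) * if r = l then 1 else 0 := by
    intro r
    rw [← sum_hUp_mul_hLow' g hφ hx, Finset.mul_sum]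
    exact Finset.sum_congr rfl fun m _ ↦ by ring
  simp only [this, sum_mul_ite_symm]

theorem chern_eq (hφ : IsHolChart φ) (hx : x ∈ φ.source) (X : CField n M) {Z : CField n M}
    {c : Fin n → M → ℂ} (hZ : ∀ y ∈ φ.source, Z y = ∑ m, c m y • dz φ m y) :
    chern g φ X Z x = ∑ k, (dirDeriv (X x) (c k) +
      ∑ i, ∑ j, Gam g φ i j k x * dzForm φ i (X x) * c j x) • dz φ k x := by
  simp only [chern, csmul_eq_smul]
  refine Finset.sum_congr rfl fun k _ ↦ ?_
  have h : ∀ k, ∀ y ∈ φ.source, dzForm φ k (Z y) = c k y := fun k y hy ↦ by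
    rw [hZ y hy, dzForm_sum_dz hφ hy k fun m ↦ c m y]
  rw [dirDeriv_congr_on φ.open_source hx (h k)]
  simp only [h _ x hx]

/-- Constant Kronecker coefficients put a frame vector into the general shape `c_m ∂/∂zᵐ` to which
the frame formulas apply. -/
theorem dz_eq_sum (i : Fin n) (y : M) :
    dz φ i y = ∑ m, (fun _ ↦ if m = i then 1 else 0 : M → ℂ) y • dz φ m y := by
  simp [ite_smul]

theorem chern_dz_dz (hφ : IsHolChart φ) (hx : x ∈ φ.source) (i k : Fin n) :
    chern g φ (dz φ i) (dz φ k) x = ∑ m, Gam g φ i k m x • dz φ m x := by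
  rw [chern_eq g hφ hx _ fun y _ ↦ dz_eq_sum k y]
  refine Finset.sum_congr rfl fun m _ ↦ ?_
  simp [dirDeriv_const, dzForm_dz hφ hx]

theorem chern_dzbar_dz (hφ : IsHolChart φ) (hx : x ∈ φ.source) (j k : Fin n) :
    chern g φ (dzbar φ j) (dz φ k) x = 0 := by
  rw [chern_eq g hφ hx _ fun y _ ↦ dz_eq_sum k y]
  refine Finset.sum_eq_zero fun m _ ↦ ?_
  simp [dirDeriv_const, dzForm_dzbar hφ hx]

theorem dirDeriv_zero (f : M → ℂ) : dirDeriv (0 : CT n x) f = 0 := by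
  rw [dirDeriv_eq_extC, map_zero]

/-- The frame is `∇_{∂/∂z̄ʲ}`-parallel and the bracket vanishes. Only `-∇_{∂/∂z̄ʲ}∇_{∂/∂zⁱ}`
survives, and it merely differentiates the coefficients `Γ`. -/
theorem chernCurv_eq (hφ : IsHolChart φ) (hx : x ∈ φ.source) (i j k l : Fin n) :
    chernCurv g φ i j k l x =
      -∑ m, dirDeriv (dzbar φ j x) (Gam g φ i k m) * hLow g φ x m l := by
  have hb : cbracket (dz φ i) (dzbar φ j) x = 0 := by
    rw [dz_eq_constField, dzbar_eq_constField]
    exact cbracket_constField hφ hx _ _ _ _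
  have h1 : chern g φ (dz φ i) (chern g φ (dzbar φ j) (dz φ k)) x = 0 := by
    rw [chern_eq g hφ hx (c := fun _ _ ↦ 0) _ fun y hy ↦ by simp [chern_dzbar_dz g hφ hy]]
    simp [dirDeriv_const]
  have h2 : chern g φ (dzbar φ j) (chern g φ (dz φ i) (dz φ k)) x =
      ∑ m, dirDeriv (dzbar φ j x) (Gam g φ i k m) • dz φ m x := by
    rw [chern_eq g hφ hx _ fun y hy ↦ chern_dz_dz g hφ hy i k]
    simp [dzForm_dzbar hφ hx]
  have h3 : chern g φ (cbracket (dz φ i) (dzbar φ j)) (dz φ k) x = 0 := by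
    rw [chern_eq g hφ hx _ fun y _ ↦ dz_eq_sum k y, hb]
    simp [dirDeriv_zero, dzForm_eq_extC]
  have h4 : curv (chern g φ) (dz φ i) (dzbar φ j) (dz φ k) x =
      -∑ m, dirDeriv (dzbar φ j x) (Gam g φ i k m) • dz φ m x := by
    simp only [curv, Pi.sub_apply]
    rw [h1, h2, h3]
    simp
  rw [chernCurv, h4, hC_eq]
  simp [hLow, hC_eq]

/-- Product rule for `∑ c_m h_{m l̄}`. -/
theorem dirDeriv_sum_mul_hLow (hφ : IsHolChart φ) (hx : x ∈ φ.source) {c : Fin n → M → ℂ}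
    (hc : ∀ m, SmoothOn (n := n) φ.source (c m)) (Z : CT n x) (l : Fin n) :
    dirDeriv Z (fun y ↦ ∑ m, c m y * hLow g φ y m l) =
      ∑ m, dirDeriv Z (c m) * hLow g φ x m l +
        ∑ m, c m x * dirDeriv Z fun y ↦ hLow g φ y m l := by
  have hd := fun m ↦ (hc m).mdifferentiableAt φ.open_source hx
  have hh := fun m ↦ (smoothOn_hLow g hφ m l).mdifferentiableAt φ.open_source hx
  rw [dirDeriv_sum Z _ fun m _ ↦ ((hc m).mul (smoothOn_hLow g hφ m l)).mdifferentiableAt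
    φ.open_source hx, ← Finset.sum_add_distrib]
  refine Finset.sum_congr rfl fun m _ ↦ ?_
  rw [dirDeriv_mul Z (hd m) (hh m)]
  ring

/-- Differentiate the lowered identity `Γh = ∂h` and solve for the term containing the derivative of
`Γ`. Curvature identities thereby reduce to second derivatives of `h` and terms quadratic in its
first derivatives. -/
theorem sum_dirDeriv_Gam_mul_hLow (hφ : IsHolChart φ) (hx : x ∈ φ.source) (Z : CT n x)
    (i k l : Fin n) :
    ∑ m, dirDeriv Z (Gam g φ i k m) * hLow g φ x m l =
      dirDeriv Z (fun y ↦ dirDeriv (dz φ i y) fun z ↦ hLow g φ z k l) -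
        ∑ m, Gam g φ i k m x * dirDeriv Z fun y ↦ hLow g φ y m l := by
  have h := dirDeriv_sum_mul_hLow g hφ hx (fun m ↦ smoothOn_Gam g hφ i k m) Z l
  rw [dirDeriv_congr_on φ.open_source hx fun y hy ↦ sum_Gam_mul_hLow g hφ hy i k l] at h
  rw [h]; ring

/-- After lowering, the curvature is `-∂∂̄h + h^{-1} ∂h ∂̄h`. The first term has the symmetry
because derivatives commute and `h` is Hermitian, the second because conjugation exchanges its two
first-order factors. This makes the Chern-Ricci form real. -/
theorem chernCurv_conj (hφ : IsHolChart φ) (hx : x ∈ φ.source) (i j k l : Fin n) :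
    conj (chernCurv g φ i j k l x) = chernCurv g φ j i l k x := by
  have hl := fun k l : Fin n ↦ smoothOn_hLow g hφ k l
  have hm := fun k l : Fin n ↦ (hl k l).mdifferentiableAt φ.open_source hx
  have e : ∀ k l : Fin n, (fun y ↦ hLow g φ y l k) = fun y ↦ conj (hLow g φ y k l) := fun k l ↦ by
    funext y; rw [hLow_conj]
  have cz : ∀ y ∈ φ.source, ∀ i k l, conj (dirDeriv (dz φ i y) fun y ↦ hLow g φ y k l) =
      dirDeriv (dzbar φ i y) fun y ↦ hLow g φ y l k := fun y hy i k l ↦ by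
    rw [e k l, dirDeriv_dzbar_conj ((hl k l).mdifferentiableAt φ.open_source hy)]
  have czb : ∀ y ∈ φ.source, ∀ i k l, conj (dirDeriv (dzbar φ i y) fun y ↦ hLow g φ y k l) =
      dirDeriv (dz φ i y) fun y ↦ hLow g φ y l k := fun y hy i k l ↦ by
    rw [e k l, dirDeriv_dz_conj ((hl k l).mdifferentiableAt φ.open_source hy)]
  have second : conj (dirDeriv (dzbar φ j x) fun y ↦ dirDeriv (dz φ i y) fun z ↦ hLow g φ z k l) =
      dirDeriv (dzbar φ i x) fun y ↦ dirDeriv (dz φ j y) fun z ↦ hLow g φ z l k := by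
    rw [← dirDeriv_dz_conj ((smoothOn_dz_deriv hφ φ.open_source subset_rfl
      (hl k l) i).mdifferentiableAt φ.open_source hx),
      dirDeriv_congr_on φ.open_source hx fun y hy ↦ cz y hy i k l]
    simp only [dz_eq_constField, dzbar_eq_constField]
    exact dirDeriv_comm hφ φ.open_source subset_rfl (hl l k) hx _ _ _ _
  rw [chernCurv_eq g hφ hx, chernCurv_eq g hφ hx, sum_dirDeriv_Gam_mul_hLow g hφ hx,
    sum_dirDeriv_Gam_mul_hLow g hφ hx, map_neg, map_sub, second, map_sum]
  congr 2
  simp only [Gam, map_mul, map_sum, czb x hx, cz x hx, hUp_conj, Finset.sum_mul]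
  rw [Finset.sum_comm]
  exact Finset.sum_congr rfl fun m _ ↦ Finset.sum_congr rfl fun r _ ↦ by ring

/-- The `(2,0)`-part of the Chern curvature vanishes. -/
theorem Gam_flat (hφ : IsHolChart φ) (hx : x ∈ φ.source) (i j k m : Fin n) :
    dirDeriv (dz φ i x) (Gam g φ j k m) - dirDeriv (dz φ j x) (Gam g φ i k m) +
      ∑ s, (Gam g φ j k s x * Gam g φ i s m x - Gam g φ i k s x * Gam g φ j s m x) = 0 := by
  -- The expression is treated as a row vector indexed by `m`. Multiplied by `h`, it reduces to the
  -- commutator of `∂/∂zⁱ` and `∂/∂zʲ` applied to `h_{k l̄}`; invertibility of `h` then gives `T =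
  -- 0`.
  set T : Fin n → ℂ := fun m ↦
    dirDeriv (dz φ i x) (Gam g φ j k m) - dirDeriv (dz φ j x) (Gam g φ i k m) +
      ∑ s, (Gam g φ j k s x * Gam g φ i s m x - Gam g φ i k s x * Gam g φ j s m x) with hT
  have hquad : ∀ i j l, ∑ m, (∑ s, Gam g φ j k s x * Gam g φ i s m x) * hLow g φ x m l =
      ∑ s, Gam g φ j k s x * dirDeriv (dz φ i x) fun y ↦ hLow g φ y s l := by
    intro i j l
    simp only [Finset.sum_mul]
    rw [Finset.sum_comm]
    refine Finset.sum_congr rfl fun s _ ↦ ?_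
    rw [← sum_Gam_mul_hLow g hφ hx, Finset.mul_sum]
    exact Finset.sum_congr rfl fun m _ ↦ by ring
  have hcomm : ∀ l, dirDeriv (dz φ i x) (fun y ↦ dirDeriv (dz φ j y) fun z ↦ hLow g φ z k l) =
      dirDeriv (dz φ j x) fun y ↦ dirDeriv (dz φ i y) fun z ↦ hLow g φ z k l := by
    intro l
    simp only [dz_eq_constField]
    exact dirDeriv_comm hφ φ.open_source subset_rfl (smoothOn_hLow g hφ k l) hx _ _ _ _
  have key : Matrix.vecMul T (hLow g φ x) = 0 := by
    funext l
    have h1 := sum_dirDeriv_Gam_mul_hLow g hφ hx (dz φ i x) j k l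
    have h2 := sum_dirDeriv_Gam_mul_hLow g hφ hx (dz φ j x) i k l
    have h3 := hquad i j l
    have h4 := hquad j i l
    have h5 := hcomm l
    simp only [Matrix.vecMul, dotProduct, hT, add_mul, sub_mul, Finset.sum_add_distrib,
      Finset.sum_sub_distrib, Pi.zero_apply]
    linear_combination h1 - h2 + h3 - h4 + h5
  have h0 : T = 0 := by
    have := congrArg (fun v ↦ Matrix.vecMul v (hLow g φ x)⁻¹) key
    simpa [Matrix.vecMul_vecMul, Matrix.mul_nonsing_inv _ (isUnit_det_hLow g hφ hx)] using this
  exact congrFun h0 m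

end

/-! ### Real affine connections, their complexification, and compatibility with `g` and `J` -/

section

variable {n : ℕ} {M : Type*} [TopologicalSpace M] [ChartedSpace (CSpace n) M]
variable [IsManifold 𝓘(ℂ, CSpace n) ω M]
variable {φ ψ : OpenPartialHomeomorph M (CSpace n)} {U : Set M} {x : M} {f h : M → ℂ}

/-! ### Calculus of a real affine connection -/

section RealConnection

variable (cov : AffineConn n M) {s t : ∀ y : M, RT n y}

theorem FieldDiffAt.add (hs : FieldDiffAt s x) (ht : FieldDiffAt t x) :
    FieldDiffAt (s + t) x := mdifferentiableAt_add_section hs ht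

theorem FieldDiffAt.neg (hs : FieldDiffAt s x) : FieldDiffAt (-s) x :=
  mdifferentiableAt_neg_section hs

theorem FieldDiffAt.smul {r : M → ℝ} (hr : MDifferentiableAt 𝓘(ℝ, CSpace n) 𝓘(ℝ, ℝ) r x)
    (hs : FieldDiffAt s x) : FieldDiffAt (fun y ↦ r y • s y) x :=
  MDifferentiableAt.smul_section hr hs

theorem FieldDiffAt.congr (hs : FieldDiffAt s x) (hst : ∀ᶠ y in nhds x, t y = s y) :
    FieldDiffAt t x := by
  refine MDifferentiableAt.congr_of_eventuallyEq hs ?_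
  filter_upwards [hst] with y hy
  rw [hy]

theorem cov_congr (hs : FieldDiffAt s x) (hst : ∀ᶠ y in nhds x, t y = s y) :
    cov t x = cov s x :=
  (cov.isCovariantDerivativeOn (s := Set.univ)).congr_of_eventuallyEq (hs.congr hst) hs
    Filter.univ_mem hst

theorem cov_add (hs : FieldDiffAt s x) (ht : FieldDiffAt t x) (v : RT n x) :
    cov (s + t) x v = cov s x v + cov t x v :=
  DFunLike.congr_fun ((cov.isCovariantDerivativeOn (s := Set.univ)).add hs ht trivial) v

theorem cov_neg (hs : FieldDiffAt s x) (v : RT n x) : cov (-s) x v = -cov s x v := by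
  have h := cov_add cov hs hs.neg v
  rw [add_neg_cancel] at h
  have h0 : cov (0 : ∀ y : M, RT n y) x = 0 := by rw [CovariantDerivative.zero]; rfl
  rw [h0] at h
  exact (neg_eq_of_add_eq_zero_right h.symm).symm

/-- The differential of a real function, as a real linear form. -/
def rdiff (r : M → ℝ) (x : M) : CSpace n →L[ℝ] ℝ := mfderiv 𝓘(ℝ, CSpace n) 𝓘(ℝ, ℝ) r x

theorem cov_smul {r : M → ℝ} (hr : MDifferentiableAt 𝓘(ℝ, CSpace n) 𝓘(ℝ, ℝ) r x)
    (hs : FieldDiffAt s x) (v : RT n x) :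
    cov (fun y ↦ r y • s y) x v = r x • cov s x v +
      rdiff r x v • s x :=
  DFunLike.congr_fun ((cov.isCovariantDerivativeOn (s := Set.univ)).leibniz hs hr trivial) v

end RealConnection

/-! ### Calculus of the complexified connection -/

/-- Complex vector fields differentiable at a point. -/
def CFieldDiffAt (Z : CField n M) (x : M) : Prop :=
  FieldDiffAt (fun y ↦ (Z y).1) x ∧ FieldDiffAt (fun y ↦ (Z y).2) x

theorem mdifferentiableAt_re (hf : MDifferentiableAt 𝓘(ℝ, CSpace n) 𝓘(ℝ, ℂ) f x) :
    MDifferentiableAt 𝓘(ℝ, CSpace n) 𝓘(ℝ, ℝ) (fun y ↦ (f y).re) x :=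
  (Complex.reCLM.differentiableAt.mdifferentiableAt (x := f x)).comp x hf

theorem mdifferentiableAt_im (hf : MDifferentiableAt 𝓘(ℝ, CSpace n) 𝓘(ℝ, ℂ) f x) :
    MDifferentiableAt 𝓘(ℝ, CSpace n) 𝓘(ℝ, ℝ) (fun y ↦ (f y).im) x :=
  (Complex.imCLM.differentiableAt.mdifferentiableAt (x := f x)).comp x hf

theorem mfderiv_re (hf : MDifferentiableAt 𝓘(ℝ, CSpace n) 𝓘(ℝ, ℂ) f x) (v : RT n x) :
    rdiff (fun y ↦ (f y).re) x v =
      (dfun f x v).re := by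
  have h := mfderiv_comp x (Complex.reCLM.differentiableAt.mdifferentiableAt (x := f x)) hf
  rw [mfderiv_eq_fderiv, Complex.reCLM.fderiv] at h
  exact DFunLike.congr_fun h v

theorem mfderiv_im (hf : MDifferentiableAt 𝓘(ℝ, CSpace n) 𝓘(ℝ, ℂ) f x) (v : RT n x) :
    rdiff (fun y ↦ (f y).im) x v =
      (dfun f x v).im := by
  have h := mfderiv_comp x (Complex.imCLM.differentiableAt.mdifferentiableAt (x := f x)) hf
  rw [mfderiv_eq_fderiv, Complex.imCLM.fderiv] at h
  exact DFunLike.congr_fun h v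

section Complexified

variable (cov : AffineConn n M) {Z W : CField n M}

theorem CFieldDiffAt.add (hZ : CFieldDiffAt Z x) (hW : CFieldDiffAt W x) :
    CFieldDiffAt (fun y ↦ Z y + W y) x := ⟨hZ.1.add hW.1, hZ.2.add hW.2⟩

theorem CFieldDiffAt.smul (hf : MDifferentiableAt 𝓘(ℝ, CSpace n) 𝓘(ℝ, ℂ) f x)
    (hZ : CFieldDiffAt Z x) : CFieldDiffAt (fun y ↦ f y • Z y) x := by
  have hr := mdifferentiableAt_re hf
  have hi := mdifferentiableAt_im hf
  refine ⟨(((hZ.1.smul hr)).add (hZ.2.smul hi).neg).congr (.of_forall fun y ↦ ?_),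
    (((hZ.2.smul hr)).add (hZ.1.smul hi))⟩
  exact sub_eq_add_neg _ _

theorem complexify_congr (hZ : CFieldDiffAt Z x) (hZW : ∀ᶠ y in nhds x, W y = Z y)
    (X : CField n M) : complexify cov X W x = complexify cov X Z x := by
  have h1 : cov (fun y ↦ (W y).1) x = cov (fun y ↦ (Z y).1) x :=
    cov_congr cov hZ.1 (hZW.mono fun y hy ↦ by rw [hy])
  have h2 : cov (fun y ↦ (W y).2) x = cov (fun y ↦ (Z y).2) x :=
    cov_congr cov hZ.2 (hZW.mono fun y hy ↦ by rw [hy])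
  simp only [complexify]
  rw [h1, h2]

theorem complexify_add (hZ : CFieldDiffAt Z x) (hW : CFieldDiffAt W x) (X : CField n M) :
    complexify cov X (fun y ↦ Z y + W y) x = complexify cov X Z x + complexify cov X W x := by
  have h1 := cov_add cov hZ.1 hW.1
  have h2 := cov_add cov hZ.2 hW.2
  refine Prod.ext ?_ ?_
  · refine (congrArg₂ (· - ·) (h1 (X x).1) (h2 (X x).2)).trans ?_
    simp only [complexify, Prod.fst_add]
    abel
  · refine (congrArg₂ (· + ·) (h2 (X x).1) (h1 (X x).2)).trans ?_
    simp only [complexify, Prod.snd_add]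
    abel

/-- The real Leibniz rule is applied to the four products of real and imaginary parts of `f` and
`Z`, and the results are reassembled. -/
theorem complexify_smul (hf : MDifferentiableAt 𝓘(ℝ, CSpace n) 𝓘(ℝ, ℂ) f x)
    (hZ : CFieldDiffAt Z x) (X : CField n M) :
    complexify cov X (fun y ↦ f y • Z y) x =
      dirDeriv (X x) f • Z x + f x • complexify cov X Z x := by
  have hr := mdifferentiableAt_re hf
  have hi := mdifferentiableAt_im hf
  have h1 : ∀ v : RT n x, cov (fun y ↦ (f y • Z y).1) x v =
      (f x).re • cov (fun y ↦ (Z y).1) x v + (dfun f x v).re • (Z x).1 -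
        ((f x).im • cov (fun y ↦ (Z y).2) x v + (dfun f x v).im • (Z x).2) := by
    intro v
    have e : (fun y ↦ (f y • Z y).1) =
        (fun y ↦ (f y).re • (Z y).1) + -(fun y ↦ (f y).im • (Z y).2) := by
      funext y; exact sub_eq_add_neg _ _
    rw [e, cov_add cov (hZ.1.smul hr) (hZ.2.smul hi).neg, cov_neg cov (hZ.2.smul hi),
      cov_smul cov hr hZ.1, cov_smul cov hi hZ.2, mfderiv_re hf, mfderiv_im hf, sub_eq_add_neg]
  have h2 : ∀ v : RT n x, cov (fun y ↦ (f y • Z y).2) x v =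
      (f x).re • cov (fun y ↦ (Z y).2) x v + (dfun f x v).re • (Z x).2 +
        ((f x).im • cov (fun y ↦ (Z y).1) x v + (dfun f x v).im • (Z x).1) := by
    intro v
    have e : (fun y ↦ (f y • Z y).2) =
        (fun y ↦ (f y).re • (Z y).2) + (fun y ↦ (f y).im • (Z y).1) := rfl
    rw [e, cov_add cov (hZ.2.smul hr) (hZ.1.smul hi),
      cov_smul cov hr hZ.2, cov_smul cov hi hZ.1, mfderiv_re hf, mfderiv_im hf]
  refine Prod.ext ?_ ?_
  · simp only [complexify]
    rw [h1, h2]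
    simp only [Prod.fst_add, smul_fst, dirDeriv, Complex.add_re, Complex.add_im, Complex.mul_re,
      Complex.mul_im, Complex.I_re, Complex.I_im]
    module
  · simp only [complexify]
    rw [h1, h2]
    simp only [Prod.snd_add, smul_snd, dirDeriv, Complex.add_re, Complex.add_im, Complex.mul_re,
      Complex.mul_im, Complex.I_re, Complex.I_im]
    module

theorem cFieldDiffAt_constField (hφ : IsHolChart φ) (hx : x ∈ φ.source) (a b : CSpace n) :
    CFieldDiffAt (constField φ a b) x :=
  ⟨fieldDiffAt_realCoordField hφ hx a, fieldDiffAt_realCoordField hφ hx b⟩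

theorem cFieldDiffAt_dz (hφ : IsHolChart φ) (hx : x ∈ φ.source) (i : Fin n) :
    CFieldDiffAt (dz φ i) x := by
  rw [dz_eq_constField]; exact cFieldDiffAt_constField hφ hx _ _

theorem complexify_sum {ι : Type*} (s : Finset ι) {F : ι → M → ℂ} {Z : ι → CField n M}
    (hF : ∀ i ∈ s, MDifferentiableAt 𝓘(ℝ, CSpace n) 𝓘(ℝ, ℂ) (F i) x)
    (hZ : ∀ i ∈ s, CFieldDiffAt (Z i) x) (X : CField n M) :
    CFieldDiffAt (fun y ↦ ∑ i ∈ s, F i y • Z i y) x ∧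
    complexify cov X (fun y ↦ ∑ i ∈ s, F i y • Z i y) x =
      ∑ i ∈ s, (dirDeriv (X x) (F i) • Z i x + F i x • complexify cov X (Z i) x) := by
  classical
  induction s using Finset.induction_on with
  | empty =>
    simp only [Finset.sum_empty]
    have h0 : cov (fun _ ↦ 0 : ∀ y : M, RT n y) x = 0 :=
      congrFun (CovariantDerivative.zero cov) x
    have hd : FieldDiffAt (fun y ↦ (0 : RT n y)) x := Bundle.mdifferentiableAt_zeroSection ..
    refine ⟨⟨hd, hd⟩, ?_⟩
    refine Prod.ext ?_ ?_ <;> simp [complexify, h0]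
  | insert a s ha ih =>
    obtain ⟨h1, h2⟩ := ih (fun i hi ↦ hF i (by simp [hi])) fun i hi ↦ hZ i (by simp [hi])
    have h3 := hF a (by simp)
    have h4 := hZ a (by simp)
    simp only [Finset.sum_insert ha]
    exact ⟨(h4.smul h3).add h1, by
      rw [complexify_add cov (h4.smul h3) h1, complexify_smul cov h3 h4, h2]⟩

theorem complexify_of_eq_zero (X Z : CField n M) (hX : X x = 0) : complexify cov X Z x = 0 := by
  refine Prod.ext ?_ ?_ <;> simp [complexify, hX]

/-- Complex conjugate vector fields. -/
def conjField (Z : CField n M) : CField n M := fun y ↦ ((Z y).1, -(Z y).2)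

/-- The connection is real, so its complex linear extension commutes with conjugation. This provides
`∇_{∂/∂z̄} ∂/∂z̄` from `∇_{∂/∂z} ∂/∂z`. -/
theorem complexify_conjField (hZ : CFieldDiffAt Z x) (X : CField n M) :
    complexify cov (conjField X) (conjField Z) x = conjField (complexify cov X Z) x := by
  have h := cov_neg cov hZ.2
  have h' : ∀ v, cov (fun y ↦ -(Z y).2) x v = -cov (fun y ↦ (Z y).2) x v := h
  refine Prod.ext ?_ ?_
  · simp only [complexify, conjField]
    rw [h', map_neg, neg_neg]
  · simp only [complexify, conjField]
    rw [h', map_neg]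
    abel

theorem conjField_dz (φ : OpenPartialHomeomorph M (CSpace n)) (i : Fin n) :
    conjField (dz φ i) = dzbar φ i := funext fun y ↦ conj_dz_vec φ i y

theorem conj_vec_sum {ι : Type*} (s : Finset ι) (c : ι → ℂ) (Z : ι → CT n x) :
    (((∑ i ∈ s, c i • Z i).1, -(∑ i ∈ s, c i • Z i).2) : CT n x) =
      ∑ i ∈ s, conj (c i) • (((Z i).1, -(Z i).2) : CT n x) := by
  classical
  have hc1 : ∀ (a : ℂ) (W : CT n x), (((a • W).1, -(a • W).2) : CT n x) =
      conj a • ((W.1, -W.2) : CT n x) := by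
    intro a W
    refine Prod.ext ?_ ?_
    · simp [smul_fst]
    · simp [smul_snd, add_comm]
  induction s using Finset.induction_on with
  | empty => simp
  | insert a s ha ih =>
    rw [Finset.sum_insert ha, Finset.sum_insert ha, ← ih, ← hc1]
    refine Prod.ext rfl ?_
    simp [add_comm]

end Complexified

/-! ### Connections compatible with the Hermitian structure -/

section Compatible

variable (g : HermitianMetric n M) {cov : AffineConn n M} {Z W : CField n M}

theorem isHolVec_iff (Z : CT n x) : IsHolVec Z ↔ J x Z.1 = -Z.2 ∧ J x Z.2 = Z.1 := by
  rw [IsHolVec, Prod.ext_iff]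
  simp [smul_fst, smul_snd]

variable {g} in
-- Being of type `(1,0)` is the pair of real equations `JZ₁ = -Z₂`, `JZ₂ = Z₁`, and a `J`-parallel
-- connection may be applied to both. They are needed near `x`, since the connection depends on the
-- germ of the field.
theorem isHolVec_complexify (hcov : MemAgJ g cov) (hZ : CFieldDiffAt Z x)
    (hZJ : ∀ᶠ y in nhds x, IsHolVec (Z y)) (X : CField n M) :
    IsHolVec (complexify cov X Z x) := by
  have h1 : ∀ v, J x (cov (fun y ↦ (Z y).1) x v) = -cov (fun y ↦ (Z y).2) x v := by
    intro v
    have h := cov_neg cov hZ.2 v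
    rw [← hcov.complex x _ hZ.1 v, ← h]
    exact DFunLike.congr_fun (cov_congr cov hZ.2.neg
      (hZJ.mono fun y hy ↦ ((isHolVec_iff _).mp hy).1)) v
  have h2 : ∀ v, J x (cov (fun y ↦ (Z y).2) x v) = cov (fun y ↦ (Z y).1) x v := by
    intro v
    rw [← hcov.complex x _ hZ.2 v]
    exact DFunLike.congr_fun (cov_congr cov hZ.1
      (hZJ.mono fun y hy ↦ ((isHolVec_iff _).mp hy).2)) v
  rw [isHolVec_iff]
  simp only [complexify, map_sub, map_add, h1, h2]
  exact ⟨by abel, by abel⟩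

variable {g} in
theorem dfun_ofReal_inner (hcov : MemAgJ g cov) (hφ : IsHolChart φ) (hx : x ∈ φ.source)
    (v w : CSpace n) (u : RT n x) :
    dfun (fun y ↦ ((g.metric.inner y (realCoordField φ v y) (realCoordField φ w y) : ℝ) : ℂ)) x u =
      ((g.metric.inner x (cov (realCoordField φ v) x u) (realCoordField φ w x) +
        g.metric.inner x (realCoordField φ v x) (cov (realCoordField φ w) x u) : ℝ) : ℂ) := by
  have hd := (smoothOn_inner g hφ v w).mdifferentiableAt φ.open_source hx
  have hm : rdiff (fun y ↦ g.metric.inner y (realCoordField φ v y) (realCoordField φ w y)) x u =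
      _ := hcov.metric x _ _ (fieldDiffAt_realCoordField hφ hx v)
        (fieldDiffAt_realCoordField hφ hx w) u
  rw [← hm]
  have hre := mfderiv_re hd u
  have him := mfderiv_im hd u
  simp only [Complex.ofReal_re, Complex.ofReal_im] at hre him
  apply Complex.ext
  · rw [← hre, Complex.ofReal_re]
  · rw [← him, Complex.ofReal_im]
    have h0 : mfderiv 𝓘(ℝ, CSpace n) 𝓘(ℝ, ℝ) (fun _ : M ↦ (0 : ℝ)) x = 0 := mfderiv_const
    exact DFunLike.congr_fun h0 u

variable {g} in
/-- `X h(Z, W) = h(∇_X Z, W) + h(Z, ∇_X W)` for coordinate vector fields `Z`, `W`. -/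
theorem dirDeriv_hC (hcov : MemAgJ g cov) (hφ : IsHolChart φ) (hx : x ∈ φ.source)
    (a b c d : CSpace n) (X : CField n M) :
    dirDeriv (X x) (fun y ↦ hC g (constField φ a b y) (constField φ c d y)) =
      hC g (complexify cov X (constField φ a b) x) (constField φ c d x) +
        hC g (constField φ a b x) (complexify cov X (constField φ c d) x) := by
  have hd := fun v w ↦ (smoothOn_inner g hφ v w).mdifferentiableAt φ.open_source hx
  -- `h(Z, W)` is a combination `(p - q) + √-1 (r + s)` of four real inner products, and `∇g = 0` is
  -- applied to each of them.
  have key : ∀ p q r s : M → ℂ, MDifferentiableAt 𝓘(ℝ, CSpace n) 𝓘(ℝ, ℂ) p x →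
      MDifferentiableAt 𝓘(ℝ, CSpace n) 𝓘(ℝ, ℂ) q x →
      MDifferentiableAt 𝓘(ℝ, CSpace n) 𝓘(ℝ, ℂ) r x →
      MDifferentiableAt 𝓘(ℝ, CSpace n) 𝓘(ℝ, ℂ) s x →
      dirDeriv (X x) (fun y ↦ (p y - q y) + Complex.I * (r y + s y)) =
        dirDeriv (X x) p - dirDeriv (X x) q + Complex.I * (dirDeriv (X x) r + dirDeriv (X x) s) := by
    intro p q r s hp hq hr hs
    have hI : MDifferentiableAt 𝓘(ℝ, CSpace n) 𝓘(ℝ, ℂ) (fun _ : M ↦ Complex.I) x :=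
      mdifferentiableAt_const
    have h1 := dirDeriv_add (X x) (hp.sub hq) (hI.mul (hr.add hs))
    have h2 := dirDeriv_mul (X x) hI (hr.add hs)
    have h3 := dirDeriv_sub (X x) hp hq
    have h4 := dirDeriv_add (X x) hr hs
    rw [dirDeriv_const, mul_zero, add_zero] at h2
    exact h1.trans (congrArg₂ (· + ·) h3 (h2.trans (congrArg _ h4)))
  have e : (fun y ↦ hC g (constField φ a b y) (constField φ c d y)) = fun y ↦
      (((g.metric.inner y (realCoordField φ a y) (realCoordField φ c y) : ℝ) : ℂ) -
        ((g.metric.inner y (realCoordField φ b y) (realCoordField φ d y) : ℝ) : ℂ)) +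
      Complex.I *
        (((g.metric.inner y (realCoordField φ a y) (realCoordField φ d y) : ℝ) : ℂ) +
        ((g.metric.inner y (realCoordField φ b y) (realCoordField φ c y) : ℝ) : ℂ)) := by
    funext y
    simp only [hC, constField, Complex.ofReal_add, Complex.ofReal_sub]
  rw [e, key _ _ _ _ (hd a c) (hd b d) (hd a d) (hd b c)]
  simp only [dirDeriv]
  simp only [dfun_ofReal_inner hcov hφ hx]
  simp only [hC, complexify, constField, map_add, map_sub, add_apply, sub_apply,
    Complex.ofReal_add, Complex.ofReal_sub]
  ring_nf
  simp only [Complex.I_sq]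
  ring

end Compatible

end

/-! ### The connection `∇^θ` in the coordinate frame and its curvature -/

section

variable {n : ℕ} {M : Type*} [TopologicalSpace M] [ChartedSpace (CSpace n) M]
variable [IsManifold 𝓘(ℂ, CSpace n) ω M]
variable {φ ψ : OpenPartialHomeomorph M (CSpace n)} {U : Set M} {x : M} {f h : M → ℂ}

/-! ### The connection `∇^θ` in the coordinate frame -/

section Frame

variable (g : HermitianMetric n M) {cov : AffineConn n M} {θ : EndForm n M}

theorem smoothOn_comp (θ : EndForm n M) (hφ : IsHolChart φ) (i j k : Fin n) :
    SmoothOn (n := n) φ.source (θ.comp φ i j k) := θ.smooth φ hφ i j k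

/-- The coefficients of `∇_{∂/∂z̄ʲ} ∂/∂zᵏ`. -/
def barCoef (θ : EndForm n M) (φ : OpenPartialHomeomorph M (CSpace n)) (j k m : Fin n) (x : M) :
    ℂ :=
  -∑ l, hUp g φ x m l * ∑ q, hLow g φ x k q * conj (θ.comp φ j l q x)

theorem smoothOn_barCoef (θ : EndForm n M) (hφ : IsHolChart φ) (j k m : Fin n) :
    SmoothOn (n := n) φ.source (barCoef g θ φ j k m) :=
  (SmoothOn.sum fun l _ ↦ (smoothOn_hUp g hφ m l).mul (SmoothOn.sum fun q _ ↦
    (smoothOn_hLow g hφ k q).mul (smoothOn_comp θ hφ j l q).conj)).neg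

theorem sum_hUp_lower (hφ : IsHolChart φ) (hx : x ∈ φ.source) (S : Fin n → ℂ) (l : Fin n) :
    ∑ m, (∑ r, hUp g φ x m r * S r) * hLow g φ x m l = S l := by
  simp only [Finset.sum_mul]
  rw [Finset.sum_comm]
  have : ∀ r, ∑ m, hUp g φ x m r * S r * hLow g φ x m l = S r * if r = l then 1 else 0 := by
    intro r
    rw [← sum_hUp_mul_hLow' g hφ hx, Finset.mul_sum]
    exact Finset.sum_congr rfl fun m _ ↦ by ring
  simp only [this, sum_mul_ite_symm]

/-- Invertibility of `h` allows frame coefficients to be compared after lowering, where the metric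
identities are available. -/
theorem lower_injective (hφ : IsHolChart φ) (hx : x ∈ φ.source) {c d : Fin n → ℂ}
    (h : ∀ l, ∑ m, c m * hLow g φ x m l = ∑ m, d m * hLow g φ x m l) : c = d := by
  have h1 : Matrix.vecMul c (hLow g φ x) = Matrix.vecMul d (hLow g φ x) := funext h
  have := congrArg (fun v ↦ Matrix.vecMul v (hLow g φ x)⁻¹) h1
  simpa [Matrix.vecMul_vecMul, Matrix.mul_nonsing_inv _ (isUnit_det_hLow g hφ hx)] using this

theorem sum_barCoef_mul_hLow (θ : EndForm n M) (hφ : IsHolChart φ) (hx : x ∈ φ.source)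
    (j k l : Fin n) :
    ∑ m, barCoef g θ φ j k m x * hLow g φ x m l =
      -∑ q, hLow g φ x k q * conj (θ.comp φ j l q x) := by
  have := sum_hUp_lower g hφ hx (fun l ↦ ∑ q, hLow g φ x k q * conj (θ.comp φ j l q x)) l
  simp only [barCoef, neg_mul, Finset.sum_neg_distrib]
  rw [this]

variable {g}

theorem complexify_dz_dz (hθ : IsNabla g cov θ) (hφ : IsHolChart φ) (hx : x ∈ φ.source)
    (i k : Fin n) : complexify cov (dz φ i) (dz φ k) x =
      ∑ m, (Gam g φ i k m x + θ.comp φ i k m x) • dz φ m x := hθ φ hφ x hx i k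

/-- By `∇J = 0` the vector is of type `(1,0)`, so it is determined by its products with `∂/∂z̄ˡ`.
Differentiating `h_{k l̄}` along `∂/∂z̄ʲ` gives this product plus `h(∂/∂zᵏ, ∇_{∂/∂z̄ʲ} ∂/∂z̄ˡ)`. In
the latter the conjugate of `Γ` already produces the full derivative of `h_{k l̄}`, so the product
must cancel the conjugate of `θ`. -/
theorem complexify_dzbar_dz (hcov : MemAgJ g cov) (hθ : IsNabla g cov θ) (hφ : IsHolChart φ)
    (hx : x ∈ φ.source) (j k : Fin n) : complexify cov (dzbar φ j) (dz φ k) x =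
      ∑ m, barCoef g θ φ j k m x • dz φ m x := by
  set V := complexify cov (dzbar φ j) (dz φ k) x with hV
  have hhol : IsHolVec V := isHolVec_complexify hcov (cFieldDiffAt_dz hφ hx k)
    (by filter_upwards [φ.open_source.mem_nhds hx] with y hy using isHolVec_dz hφ hy k) _
  rw [hhol.eq_sum hφ hx]
  have hlow : ∀ l, ∑ m, dzForm φ m V * hLow g φ x m l = hC g V (dzbar φ l x) := by
    intro l
    conv_rhs => rw [hhol.eq_sum hφ hx]
    simp [hC_eq, hLow]
  have hbar : ∀ l, complexify cov (dzbar φ j) (dzbar φ l) x =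
      ∑ p, conj (Gam g φ j l p x + θ.comp φ j l p x) • dzbar φ p x := by
    intro l
    rw [← conjField_dz, ← conjField_dz, complexify_conjField cov (cFieldDiffAt_dz hφ hx l),
      conjField, complexify_dz_dz hθ hφ hx, conj_vec_sum]
    simp only [conj_dz_vec]
  have hmet : ∀ l, hC g V (dzbar φ l x) = -∑ q, hLow g φ x k q * conj (θ.comp φ j l q x) := by
    intro l
    have h1 : dirDeriv (dzbar φ j x) (fun y ↦ hLow g φ y k l) =
        hC g V (dzbar φ l x) + hC g (dz φ k x) (complexify cov (dzbar φ j) (dzbar φ l) x) := by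
      have := dirDeriv_hC hcov hφ hx ((1 / 2 : ℝ) • stdVec k)
        ((-(1 / 2) : ℝ) • (Complex.I • stdVec k)) ((1 / 2 : ℝ) • stdVec l)
        ((1 / 2 : ℝ) • (Complex.I • stdVec l)) (dzbar φ j)
      rw [← dz_eq_constField, ← dzbar_eq_constField] at this
      exact this
    have h2 : hC g (dz φ k x) (complexify cov (dzbar φ j) (dzbar φ l) x) =
        ∑ p, conj (Gam g φ j l p x) * hLow g φ x k p +
          ∑ p, hLow g φ x k p * conj (θ.comp φ j l p x) := by
      rw [hbar, hC_eq, map_sum, ← Finset.sum_add_distrib]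
      refine Finset.sum_congr rfl fun p _ ↦ ?_
      rw [map_smul, ← hC_eq, map_add, smul_eq_mul]
      simp only [hLow, Matrix.of_apply]
      ring
    -- This is the conjugate of the lowering identity for `Γ`, applied to `h_{l k̄}`.
    have h3 : ∑ p, conj (Gam g φ j l p x) * hLow g φ x k p =
        dirDeriv (dzbar φ j x) fun y ↦ hLow g φ y k l := by
      have e : (fun y ↦ hLow g φ y k l) = fun y ↦ conj (hLow g φ y l k) := by
        funext y; rw [hLow_conj]
      rw [e, dirDeriv_dzbar_conj ((smoothOn_hLow g hφ l k).mdifferentiableAt φ.open_source hx),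
        ← sum_Gam_mul_hLow g hφ hx, map_sum]
      exact Finset.sum_congr rfl fun p _ ↦ by rw [map_mul, hLow_conj]
    linear_combination -h1 - h2 - h3
  have := lower_injective g hφ hx (c := fun m ↦ dzForm φ m V) (d := fun m ↦ barCoef g θ φ j k m x)
    fun l ↦ by rw [hlow, hmet, sum_barCoef_mul_hLow g θ hφ hx]
  exact Finset.sum_congr rfl fun m _ ↦ by rw [congrFun this m]

/-- `D_X (c_m ∂/∂zᵐ) = (X c_m + c_s a_s^m) ∂/∂zᵐ`. -/
def ActsOnFrame (φ : OpenPartialHomeomorph M (CSpace n))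
    (D : CField n M → CField n M → CField n M) (X : CField n M)
    (a : Fin n → Fin n → M → ℂ) : Prop :=
  ∀ (c : Fin n → M → ℂ) (Z : CField n M), (∀ m, SmoothOn (n := n) φ.source (c m)) →
    (∀ y ∈ φ.source, Z y = ∑ m, c m y • dz φ m y) → ∀ x ∈ φ.source,
    D X Z x = ∑ m, (dirDeriv (X x) (c m) + ∑ s, c s x * a s m x) • dz φ m x

theorem actsOnFrame_complexify (cov : AffineConn n M) (hφ : IsHolChart φ) {X : CField n M}
    {a : Fin n → Fin n → M → ℂ}
    (hX : ∀ k, ∀ y ∈ φ.source, complexify cov X (dz φ k) y = ∑ m, a k m y • dz φ m y) :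
    ActsOnFrame φ (complexify cov) X a := by
  intro c Z hc hZ x hx
  obtain ⟨h1, h2⟩ := complexify_sum cov Finset.univ
    (fun m _ ↦ (hc m).mdifferentiableAt φ.open_source hx) (fun m _ ↦ cFieldDiffAt_dz hφ hx m) X
  rw [complexify_congr cov h1 (by filter_upwards [φ.open_source.mem_nhds hx] with y hy using hZ y hy),
    h2]
  simp only [hX _ x hx, add_smul, Finset.sum_add_distrib, Finset.smul_sum, Finset.sum_smul,
    smul_smul]
  congr 1
  rw [Finset.sum_comm]

/-- The complexified connection already yields a combination of the `∂/∂zᵐ`, which the projection to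
`T^{1,0}M` fixes. The coefficient matrix is the same for both connections. -/
theorem actsOnFrame_restrict10 (cov : AffineConn n M) (hφ : IsHolChart φ) {X : CField n M}
    {a : Fin n → Fin n → M → ℂ}
    (hX : ∀ k, ∀ y ∈ φ.source, complexify cov X (dz φ k) y = ∑ m, a k m y • dz φ m y) :
    ActsOnFrame φ (restrict10 cov) X a := by
  intro c Z hc hZ x hx
  rw [restrict10, actsOnFrame_complexify cov hφ hX c Z hc hZ x hx]
  exact (isHolVec_sum_dz hφ hx _).proj10_eq

/-- This is the expression `X(b) - Y(a)` plus the commutator of the coefficient matrices. The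
operator is abstract, so the lemma applies verbatim to the complexified and to the induced
connection; equality of the two curvatures is then definitional. The hypothesis `h0` disposes of the
bracket term. -/
theorem curv_frame {D : CField n M → CField n M → CField n M} {X Y : CField n M}
    {a b : Fin n → Fin n → M → ℂ} (hX : ActsOnFrame φ D X a) (hY : ActsOnFrame φ D Y b)
    (ha : ∀ s m, SmoothOn (n := n) φ.source (a s m))
    (hb : ∀ s m, SmoothOn (n := n) φ.source (b s m)) (hx : x ∈ φ.source)
    (h0 : ∀ W Z : CField n M, W x = 0 → D W Z x = 0) (hXY : cbracket X Y x = 0) (k : Fin n) :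
    curv D X Y (dz φ k) x = ∑ m, (dirDeriv (X x) (b k m) + ∑ s, b k s x * a s m x -
      (dirDeriv (Y x) (a k m) + ∑ s, a k s x * b s m x)) • dz φ m x := by
  have hc : ∀ m, SmoothOn (n := n) φ.source (fun _ ↦ if m = k then 1 else 0) := fun m ↦
    smoothOn_const _
  have hXk : ∀ y ∈ φ.source, D X (dz φ k) y = ∑ m, a k m y • dz φ m y := fun y hy ↦ by
    rw [hX _ _ hc (fun y _ ↦ dz_eq_sum k y) y hy]
    simp [dirDeriv_const]
  have hYk : ∀ y ∈ φ.source, D Y (dz φ k) y = ∑ m, b k m y • dz φ m y := fun y hy ↦ by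
    rw [hY _ _ hc (fun y _ ↦ dz_eq_sum k y) y hy]
    simp [dirDeriv_const]
  simp only [curv, Pi.sub_apply]
  rw [h0 _ _ hXY, hX _ _ (hb k) hYk x hx, hY _ _ (ha k) hXk x hx, sub_zero,
    ← Finset.sum_sub_distrib]
  simp only [sub_smul]

theorem hC_sum_dz_dzbar (g : HermitianMetric n M) (φ : OpenPartialHomeomorph M (CSpace n))
    (x : M) (c : Fin n → ℂ) (l : Fin n) :
    hC g (∑ m, c m • dz φ m x) (dzbar φ l x) = ∑ m, c m * hLow g φ x m l := by
  simp [hC_eq, hLow]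

theorem cbracket_dz_dzbar (hφ : IsHolChart φ) (hx : x ∈ φ.source) (i j : Fin n) :
    cbracket (dz φ i) (dzbar φ j) x = 0 := by
  rw [dz_eq_constField, dzbar_eq_constField]
  exact cbracket_constField hφ hx _ _ _ _

theorem cbracket_dz_dz (hφ : IsHolChart φ) (hx : x ∈ φ.source) (i j : Fin n) :
    cbracket (dz φ i) (dz φ j) x = 0 := by
  rw [dz_eq_constField, dz_eq_constField]
  exact cbracket_constField hφ hx _ _ _ _

theorem restrict10_of_eq_zero (cov : AffineConn n M) (X Z : CField n M) (hX : X x = 0) :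
    restrict10 cov X Z x = 0 := by
  rw [restrict10, complexify_of_eq_zero cov X Z hX, isHolVec_zero.proj10_eq]

variable (θ) in
theorem smoothOn_frameCoef (g : HermitianMetric n M) (hφ : IsHolChart φ) (i k m : Fin n) :
    SmoothOn (n := n) φ.source fun y ↦ Gam g φ i k m y + θ.comp φ i k m y :=
  (smoothOn_Gam g hφ i k m).add (smoothOn_comp θ hφ i k m)

/-- The mixed curvature components in terms of the connection coefficients. -/
theorem curv_bar_eq (hcov : MemAgJ g cov) (hθ : IsNabla g cov θ) (hφ : IsHolChart φ)
    (hx : x ∈ φ.source) (i j k l : Fin n) :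
    R_bar g φ cov i j k l x = RR_bar g φ cov i j k l x ∧
    RR_bar g φ cov i j k l x =
      ∑ m, (dirDeriv (dz φ i x) (barCoef g θ φ j k m) +
        ∑ s, barCoef g θ φ j k s x * (Gam g φ i s m x + θ.comp φ i s m x) -
        (dirDeriv (dzbar φ j x) (fun y ↦ Gam g φ i k m y + θ.comp φ i k m y) +
          ∑ s, (Gam g φ i k s x + θ.comp φ i k s x) * barCoef g θ φ j s m x)) *
        hLow g φ x m l := by
  have hX : ∀ k, ∀ y ∈ φ.source, complexify cov (dz φ i) (dz φ k) y =
      ∑ m, (fun k m y ↦ Gam g φ i k m y + θ.comp φ i k m y) k m y • dz φ m y := fun k y hy ↦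
    complexify_dz_dz hθ hφ hy i k
  have hY : ∀ k, ∀ y ∈ φ.source, complexify cov (dzbar φ j) (dz φ k) y =
      ∑ m, barCoef g θ φ j k m y • dz φ m y := fun k y hy ↦
    complexify_dzbar_dz hcov hθ hφ hy j k
  have h1 := curv_frame (actsOnFrame_complexify cov hφ hX) (actsOnFrame_complexify cov hφ hY)
    (fun s m ↦ smoothOn_frameCoef θ g hφ i s m) (fun s m ↦ smoothOn_barCoef g θ hφ j s m) hx
    (complexify_of_eq_zero cov) (cbracket_dz_dzbar hφ hx i j) k
  have h2 := curv_frame (actsOnFrame_restrict10 cov hφ hX) (actsOnFrame_restrict10 cov hφ hY)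
    (fun s m ↦ smoothOn_frameCoef θ g hφ i s m) (fun s m ↦ smoothOn_barCoef g θ hφ j s m) hx
    (restrict10_of_eq_zero cov) (cbracket_dz_dzbar hφ hx i j) k
  rw [R_bar, RR_bar, h1, h2]
  exact ⟨rfl, hC_sum_dz_dzbar g φ x _ l⟩

/-- Only derivatives in directions of type `(1,0)` occur, and there the coefficients are the
prescribed `Γ + θ`. -/
theorem curv_hol_eq (hθ : IsNabla g cov θ) (hφ : IsHolChart φ)
    (hx : x ∈ φ.source) (i j k l : Fin n) :
    R_hol g φ cov i j k l x = RR_hol g φ cov i j k l x ∧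
    RR_hol g φ cov i j k l x =
      ∑ m, (dirDeriv (dz φ i x) (fun y ↦ Gam g φ j k m y + θ.comp φ j k m y) +
        ∑ s, (Gam g φ j k s x + θ.comp φ j k s x) * (Gam g φ i s m x + θ.comp φ i s m x) -
        (dirDeriv (dz φ j x) (fun y ↦ Gam g φ i k m y + θ.comp φ i k m y) +
          ∑ s, (Gam g φ i k s x + θ.comp φ i k s x) * (Gam g φ j s m x + θ.comp φ j s m x))) *
        hLow g φ x m l := by
  have hX : ∀ i k, ∀ y ∈ φ.source, complexify cov (dz φ i) (dz φ k) y =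
      ∑ m, (fun k m y ↦ Gam g φ i k m y + θ.comp φ i k m y) k m y • dz φ m y := fun i k y hy ↦
    complexify_dz_dz hθ hφ hy i k
  have h1 := curv_frame (actsOnFrame_complexify cov hφ (hX i))
    (actsOnFrame_complexify cov hφ (hX j))
    (fun s m ↦ smoothOn_frameCoef θ g hφ i s m) (fun s m ↦ smoothOn_frameCoef θ g hφ j s m) hx
    (complexify_of_eq_zero cov) (cbracket_dz_dz hφ hx i j) k
  have h2 := curv_frame (actsOnFrame_restrict10 cov hφ (hX i))
    (actsOnFrame_restrict10 cov hφ (hX j))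
    (fun s m ↦ smoothOn_frameCoef θ g hφ i s m) (fun s m ↦ smoothOn_frameCoef θ g hφ j s m) hx
    (restrict10_of_eq_zero cov) (cbracket_dz_dz hφ hx i j) k
  rw [R_hol, RR_hol, h1, h2]
  exact ⟨rfl, hC_sum_dz_dzbar g φ x _ l⟩

/-- Write `b` for `barCoef`. The derivative of `b` is found from that of the lowered `b`, at the
price of the terms `b ∂h` and `θ̄ ∂h`. The products `bΓ` cancel the first, by `e3`; the products
`Γb` cancel the second, by `e5` and `e6`. The products `bθ` and `θb` give the two quadratic terms,
and `-∂Γ/∂z̄ʲ` is the Chern curvature. -/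
theorem RR_bar_formula (hcov : MemAgJ g cov) (hθ : IsNabla g cov θ) (hφ : IsHolChart φ)
    (hx : x ∈ φ.source) (i j k l : Fin n) :
    RR_bar g φ cov i j k l x =
      chernCurv g φ i j k l x
      - ((∑ p, hLow g φ x k p * dirDeriv (dz φ i x) (fun y ↦ conj (θ.comp φ j l p y)))
        + ∑ p, hLow g φ x p l * dirDeriv (dzbar φ j x) (θ.comp φ i k p))
      + ((∑ p, ∑ q, θ.comp φ i k p x * conj (θ.comp φ j l q x) * hLow g φ x p q)
        - ∑ m, ∑ r, ∑ p, ∑ q, hUp g φ x m r * θ.comp φ i m p x *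
            conj (θ.comp φ j r q x) * hLow g φ x p l * hLow g φ x k q) := by
  rw [(curv_bar_eq hcov hθ hφ hx i j k l).2, chernCurv_eq g hφ hx]
  have hdl := fun k l ↦ (smoothOn_hLow g hφ k l).mdifferentiableAt φ.open_source hx
  have hdG := fun m ↦ (smoothOn_Gam g hφ i k m).mdifferentiableAt φ.open_source hx
  have hdθ := fun i k m ↦ (smoothOn_comp θ hφ i k m).mdifferentiableAt φ.open_source hx
  have hdc := fun i k m ↦ (smoothOn_comp θ hφ i k m).conj.mdifferentiableAt φ.open_source hx
  have e1 : ∀ m, dirDeriv (dzbar φ j x) (fun y ↦ Gam g φ i k m y + θ.comp φ i k m y) =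
      dirDeriv (dzbar φ j x) (Gam g φ i k m) + dirDeriv (dzbar φ j x) (θ.comp φ i k m) :=
    fun m ↦ dirDeriv_add _ (hdG m) (hdθ i k m)
  have e2 : ∑ m, dirDeriv (dz φ i x) (barCoef g θ φ j k m) * hLow g φ x m l +
      ∑ m, barCoef g θ φ j k m x * dirDeriv (dz φ i x) (fun y ↦ hLow g φ y m l) =
      -∑ q, (hLow g φ x k q * dirDeriv (dz φ i x) (fun y ↦ conj (θ.comp φ j l q y)) +
        conj (θ.comp φ j l q x) * dirDeriv (dz φ i x) fun y ↦ hLow g φ y k q) := by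
    rw [← dirDeriv_sum_mul_hLow g hφ hx (fun m ↦ smoothOn_barCoef g θ hφ j k m),
      dirDeriv_congr_on φ.open_source hx fun y hy ↦ sum_barCoef_mul_hLow g θ hφ hy j k l,
      dirDeriv_neg, dirDeriv_sum _ _ fun q _ ↦ ((smoothOn_hLow g hφ k q).mul
        (smoothOn_comp θ hφ j l q).conj).mdifferentiableAt φ.open_source hx]
    congr 1
    exact Finset.sum_congr rfl fun q _ ↦ dirDeriv_mul _ (hdl k q) (hdc j l q)
  have e3 : ∑ m, (∑ s, barCoef g θ φ j k s x * Gam g φ i s m x) * hLow g φ x m l =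
      ∑ m, barCoef g θ φ j k m x * dirDeriv (dz φ i x) (fun y ↦ hLow g φ y m l) := by
    simp only [Finset.sum_mul]
    rw [Finset.sum_comm]
    refine Finset.sum_congr rfl fun s _ ↦ ?_
    rw [← sum_Gam_mul_hLow g hφ hx, Finset.mul_sum]
    exact Finset.sum_congr rfl fun m _ ↦ by ring
  have e4 : ∑ m, (∑ s, barCoef g θ φ j k s x * θ.comp φ i s m x) * hLow g φ x m l =
      -∑ m, ∑ r, ∑ p, ∑ q, hUp g φ x m r * θ.comp φ i m p x *
            conj (θ.comp φ j r q x) * hLow g φ x p l * hLow g φ x k q := by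
    simp only [barCoef, Finset.sum_mul, Finset.mul_sum, neg_mul, ← Finset.sum_neg_distrib]
    rw [Finset.sum_comm]
    refine Finset.sum_congr rfl fun s _ ↦ ?_
    rw [Finset.sum_comm]
    refine Finset.sum_congr rfl fun r _ ↦ Finset.sum_congr rfl fun p _ ↦
      Finset.sum_congr rfl fun q _ ↦ by ring
  -- The vector `a` stands for `Γ_{ik}` in `e7` and for `θ_{ik}` in `e8`.
  have e5 : ∀ a : Fin n → ℂ, ∑ m, (∑ s, a s * barCoef g θ φ j s m x) * hLow g φ x m l =
      -∑ s, ∑ q, a s * conj (θ.comp φ j l q x) * hLow g φ x s q := by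
    intro a
    simp only [Finset.sum_mul]
    rw [Finset.sum_comm, ← Finset.sum_neg_distrib]
    refine Finset.sum_congr rfl fun s _ ↦ ?_
    have := congrArg (fun z ↦ a s * z) (sum_barCoef_mul_hLow g θ hφ hx j s l)
    simp only [Finset.mul_sum, mul_neg] at this
    calc _ = ∑ m, a s * (barCoef g θ φ j s m x * hLow g φ x m l) :=
          Finset.sum_congr rfl fun m _ ↦ by ring
      _ = _ := by
        rw [this]
        congr 1
        exact Finset.sum_congr rfl fun q _ ↦ by ring
  have e6 : ∑ s, ∑ q, Gam g φ i k s x * conj (θ.comp φ j l q x) * hLow g φ x s q =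
      ∑ q, conj (θ.comp φ j l q x) * dirDeriv (dz φ i x) fun y ↦ hLow g φ y k q := by
    rw [Finset.sum_comm]
    refine Finset.sum_congr rfl fun q _ ↦ ?_
    rw [← sum_Gam_mul_hLow g hφ hx, Finset.mul_sum]
    exact Finset.sum_congr rfl fun m _ ↦ by ring
  have e7 := e5 fun s ↦ Gam g φ i k s x
  have e8 := e5 fun s ↦ θ.comp φ i k s x
  have e9 : ∑ m, dirDeriv (dzbar φ j x) (θ.comp φ i k m) * hLow g φ x m l =
      ∑ p, hLow g φ x p l * dirDeriv (dzbar φ j x) (θ.comp φ i k p) :=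
    Finset.sum_congr rfl fun m _ ↦ mul_comm _ _
  simp only [e1, mul_add, add_mul, sub_mul, Finset.sum_add_distrib, Finset.sum_sub_distrib]
    at e2 ⊢
  linear_combination e2 + e3 + e4 - e7 - e8 + e6 - e9

/-- Expand in `Γ + θ`. The pure `Γ` part vanishes by `Gam_flat`, since the Chern curvature has no
`(2,0)` part; the mixed and the quadratic parts are the two sums that remain. -/
theorem RR_hol_formula (hθ : IsNabla g cov θ) (hφ : IsHolChart φ)
    (hx : x ∈ φ.source) (i j k l : Fin n) :
    RR_hol g φ cov i j k l x =
      (∑ m, (dirDeriv (dz φ i x) (θ.comp φ j k m) - dirDeriv (dz φ j x) (θ.comp φ i k m)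
        + ∑ s, (Gam g φ j k s x * θ.comp φ i s m x - Gam g φ j s m x * θ.comp φ i k s x
            + Gam g φ i s m x * θ.comp φ j k s x - Gam g φ i k s x * θ.comp φ j s m x))
          * hLow g φ x m l)
      + ∑ m, (∑ p, (θ.comp φ i p m x * θ.comp φ j k p x
          - θ.comp φ i k p x * θ.comp φ j p m x)) * hLow g φ x m l := by
  rw [(curv_hol_eq hθ hφ hx i j k l).2, ← Finset.sum_add_distrib]
  refine Finset.sum_congr rfl fun m _ ↦ ?_
  have hdG := fun i ↦ (smoothOn_Gam g hφ i k m).mdifferentiableAt φ.open_source hx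
  have hdθ := fun i ↦ (smoothOn_comp θ hφ i k m).mdifferentiableAt φ.open_source hx
  have h := Gam_flat g hφ hx i j k m
  have e1 : ∀ Z : CT n x, ∀ i, dirDeriv Z (fun y ↦ Gam g φ i k m y + θ.comp φ i k m y) =
      dirDeriv Z (Gam g φ i k m) + dirDeriv Z (θ.comp φ i k m) :=
    fun Z i ↦ dirDeriv_add _ (hdG i) (hdθ i)
  rw [e1, e1, ← add_mul]
  congr 1
  have e2 : ∑ s, (Gam g φ j k s x + θ.comp φ j k s x) * (Gam g φ i s m x + θ.comp φ i s m x) -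
      ∑ s, (Gam g φ i k s x + θ.comp φ i k s x) * (Gam g φ j s m x + θ.comp φ j s m x) =
      ∑ s, (Gam g φ j k s x * Gam g φ i s m x - Gam g φ i k s x * Gam g φ j s m x) +
      ∑ s, (Gam g φ j k s x * θ.comp φ i s m x - Gam g φ j s m x * θ.comp φ i k s x
            + Gam g φ i s m x * θ.comp φ j k s x - Gam g φ i k s x * θ.comp φ j s m x) +
      ∑ p, (θ.comp φ i p m x * θ.comp φ j k p x - θ.comp φ i k p x * θ.comp φ j p m x) := by
    rw [← Finset.sum_sub_distrib, ← Finset.sum_add_distrib, ← Finset.sum_add_distrib]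
    exact Finset.sum_congr rfl fun s _ ↦ by ring
  linear_combination h + e2

end Frame

end

/-! ### Traces of the curvature, and change of holomorphic coordinates -/

section

variable {n : ℕ} {M : Type*} [TopologicalSpace M] [ChartedSpace (CSpace n) M]
variable [IsManifold 𝓘(ℂ, CSpace n) ω M]
variable {φ ψ : OpenPartialHomeomorph M (CSpace n)} {U : Set M} {x : M} {f h : M → ℂ}

/-! ### Traces of the curvature -/

section Traces

variable (g : HermitianMetric n M) {cov : AffineConn n M} {θ : EndForm n M}

/-- `Γ_{ik}^k`. -/
def traceGam (φ : OpenPartialHomeomorph M (CSpace n)) (i : Fin n) (x : M) : ℂ :=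
  ∑ k, Gam g φ i k k x

/-- `θ_{ik}^k`. -/
def traceComp (θ : EndForm n M) (φ : OpenPartialHomeomorph M (CSpace n)) (i : Fin n) (x : M) : ℂ :=
  ∑ k, θ.comp φ i k k x

theorem smoothOn_traceGam (hφ : IsHolChart φ) (i : Fin n) :
    SmoothOn (n := n) φ.source (traceGam g φ i) := SmoothOn.sum fun k _ ↦ smoothOn_Gam g hφ i k k

theorem smoothOn_traceComp (θ : EndForm n M) (hφ : IsHolChart φ) (i : Fin n) :
    SmoothOn (n := n) φ.source (traceComp θ φ i) :=
  SmoothOn.sum fun k _ ↦ smoothOn_comp θ hφ i k k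

/-- Lowering followed by contraction with `h^{k l̄}` is the plain trace of an endomorphism. The
primed variant treats an endomorphism lowered in the other slot, as happens for the conjugate of
`θ`. -/
theorem sum_hUp_contract (hφ : IsHolChart φ) (hx : x ∈ φ.source) (E : Fin n → Fin n → ℂ) :
    ∑ k, ∑ l, hUp g φ x k l * ∑ p, E k p * hLow g φ x p l = ∑ k, E k k := by
  refine Finset.sum_congr rfl fun k _ ↦ ?_
  simp only [Finset.mul_sum]
  rw [Finset.sum_comm]
  have : ∀ p, ∑ l, hUp g φ x k l * (E k p * hLow g φ x p l) = E k p * if k = p then 1 else 0 := by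
    intro p
    rw [← sum_hUp_mul_hLow g hφ hx, Finset.mul_sum]
    exact Finset.sum_congr rfl fun m _ ↦ by ring
  simp [this]

theorem sum_hUp_contract' (hφ : IsHolChart φ) (hx : x ∈ φ.source) (E : Fin n → Fin n → ℂ) :
    ∑ k, ∑ l, hUp g φ x k l * ∑ p, hLow g φ x k p * E l p = ∑ k, E k k := by
  rw [Finset.sum_comm]
  refine Finset.sum_congr rfl fun l _ ↦ ?_
  simp only [Finset.mul_sum]
  rw [Finset.sum_comm]
  have : ∀ p, ∑ k, hUp g φ x k l * (hLow g φ x k p * E l p) = E l p * if l = p then 1 else 0 := by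
    intro p
    rw [← sum_hUp_mul_hLow' g hφ hx, Finset.mul_sum]
    exact Finset.sum_congr rfl fun m _ ↦ by ring
  simp [this]

theorem dirDeriv_traceGam (hφ : IsHolChart φ) (hx : x ∈ φ.source) (Z : CT n x) (i : Fin n) :
    dirDeriv Z (traceGam g φ i) = ∑ k, dirDeriv Z (Gam g φ i k k) :=
  dirDeriv_sum Z _ fun k _ ↦ (smoothOn_Gam g hφ i k k).mdifferentiableAt φ.open_source hx

theorem dirDeriv_traceComp (θ : EndForm n M) (hφ : IsHolChart φ) (hx : x ∈ φ.source) (Z : CT n x)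
    (i : Fin n) : dirDeriv Z (traceComp θ φ i) = ∑ k, dirDeriv Z (θ.comp φ i k k) :=
  dirDeriv_sum Z _ fun k _ ↦ (smoothOn_comp θ hφ i k k).mdifferentiableAt φ.open_source hx

theorem dirDeriv_conj_traceComp (θ : EndForm n M) (hφ : IsHolChart φ) (hx : x ∈ φ.source)
    (Z : CT n x) (i : Fin n) : dirDeriv Z (fun y ↦ conj (traceComp θ φ i y)) =
      ∑ k, dirDeriv Z (fun y ↦ conj (θ.comp φ i k k y)) := by
  simp only [traceComp, map_sum]
  exact dirDeriv_sum Z _ fun k _ ↦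
    (smoothOn_comp θ hφ i k k).conj.mdifferentiableAt φ.open_source hx

/-- The trace commutes with the derivative of `Γ`. It makes the Chern-Ricci form locally `√-1 ∂̄` of
the trace of the connection form. -/
theorem chernCurv_trace (hφ : IsHolChart φ) (hx : x ∈ φ.source) (i j : Fin n) :
    ∑ k, ∑ l, hUp g φ x k l * chernCurv g φ i j k l x =
      -dirDeriv (dzbar φ j x) (traceGam g φ i) := by
  have h := sum_hUp_contract g hφ hx fun k m ↦ -dirDeriv (dzbar φ j x) (Gam g φ i k m)
  simp only [chernCurv_eq g hφ hx, ← Finset.sum_neg_distrib, ← neg_mul]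
  rw [h, dirDeriv_traceGam g hφ hx, Finset.sum_neg_distrib]

theorem chernCurv_trace_conj (hφ : IsHolChart φ) (hx : x ∈ φ.source) (i j : Fin n) :
    conj (∑ k, ∑ l, hUp g φ x k l * chernCurv g φ i j k l x) =
      ∑ k, ∑ l, hUp g φ x k l * chernCurv g φ j i k l x := by
  simp only [map_sum, map_mul, hUp_conj, chernCurv_conj g hφ hx]
  rw [Finset.sum_comm]

variable {g}

/-- The quadratic terms form a commutator of `θ_i` with the adjoint of `θ_j`, which has trace zero:
`h3` and `h4` show that their two traces coincide. -/
theorem RR_bar_trace (hcov : MemAgJ g cov) (hθ : IsNabla g cov θ) (hφ : IsHolChart φ)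
    (hx : x ∈ φ.source) (i j : Fin n) :
    ∑ k, ∑ l, hUp g φ x k l * RR_bar g φ cov i j k l x =
      ∑ k, ∑ l, hUp g φ x k l * chernCurv g φ i j k l x -
        (dirDeriv (dz φ i x) (fun y ↦ conj (traceComp θ φ j y)) +
          dirDeriv (dzbar φ j x) (traceComp θ φ i)) := by
  have h1 := sum_hUp_contract' g hφ hx fun l p ↦
    dirDeriv (dz φ i x) (fun y ↦ conj (θ.comp φ j l p y))
  have h2 := sum_hUp_contract g hφ hx fun k p ↦ dirDeriv (dzbar φ j x) (θ.comp φ i k p)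
  have h3 := sum_hUp_contract g hφ hx fun k p ↦ ∑ m, ∑ r, ∑ q, hUp g φ x m r * θ.comp φ i m p x *
            conj (θ.comp φ j r q x) * hLow g φ x k q
  have h4 : ∑ k, ∑ m, ∑ r, ∑ q, hUp g φ x m r * θ.comp φ i m k x *
            conj (θ.comp φ j r q x) * hLow g φ x k q =
      ∑ k, ∑ l, hUp g φ x k l * ∑ p, ∑ q, θ.comp φ i k p x * conj (θ.comp φ j l q x) *
        hLow g φ x p q := by
    rw [Finset.sum_comm]
    refine Finset.sum_congr rfl fun m _ ↦ ?_
    rw [Finset.sum_comm]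
    refine Finset.sum_congr rfl fun r _ ↦ ?_
    simp only [Finset.mul_sum]
    exact Finset.sum_congr rfl fun p _ ↦ Finset.sum_congr rfl fun q _ ↦ by ring
  have h5 : ∀ k l, ∑ p, (∑ m, ∑ r, ∑ q, hUp g φ x m r * θ.comp φ i m p x *
            conj (θ.comp φ j r q x) * hLow g φ x k q) * hLow g φ x p l =
      ∑ m, ∑ r, ∑ p, ∑ q, hUp g φ x m r * θ.comp φ i m p x *
            conj (θ.comp φ j r q x) * hLow g φ x p l * hLow g φ x k q := by
    intro k l
    simp only [Finset.sum_mul]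
    rw [Finset.sum_comm]
    refine Finset.sum_congr rfl fun m _ ↦ ?_
    rw [Finset.sum_comm]
    exact Finset.sum_congr rfl fun r _ ↦ Finset.sum_congr rfl fun p _ ↦
      Finset.sum_congr rfl fun q _ ↦ by ring
  have h6 : ∀ k, ∑ p, dirDeriv (dzbar φ j x) (θ.comp φ i k p) * hLow g φ x p k =
      ∑ p, hLow g φ x p k * dirDeriv (dzbar φ j x) (θ.comp φ i k p) := fun k ↦
    Finset.sum_congr rfl fun p _ ↦ mul_comm _ _
  simp only [h5] at h3
  simp only [mul_comm (dirDeriv (dzbar φ j x) _)] at h2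
  rw [dirDeriv_traceComp θ hφ hx, dirDeriv_conj_traceComp θ hφ hx]
  simp only [RR_bar_formula hcov hθ hφ hx, mul_add, mul_sub, Finset.sum_add_distrib,
    Finset.sum_sub_distrib]
  linear_combination -h1 - h2 - h3 - h4

end Traces

/-! ### Change of coordinates -/

section Change

/-- The Jacobian matrix `∂wᵃ/∂zⁱ` of the change from `z` to `w`. -/
def jac (φ ψ : OpenPartialHomeomorph M (CSpace n)) (i a : Fin n) (x : M) : ℂ :=
  dirDeriv (dz φ i x) (coordFun ψ a)

theorem dz_change (hφ : IsHolChart φ) (hψ : IsHolChart ψ) (hx : x ∈ φ.source) (hx' : x ∈ ψ.source) (i : Fin n) :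
    dz φ i x = ∑ a, jac φ ψ i a x • dz ψ a x := by
  have := (isHolVec_dz hφ hx i).eq_sum hψ hx'
  simpa only [dzForm_eq_dirDeriv hψ hx'] using! this

theorem dzbar_change (hφ : IsHolChart φ) (hψ : IsHolChart ψ) (hx : x ∈ φ.source) (hx' : x ∈ ψ.source) (j : Fin n) :
    dzbar φ j x = ∑ b, conj (jac φ ψ j b x) • dzbar ψ b x := by
  rw [← conj_dz_vec, dz_change hφ hψ hx hx', conj_vec_sum]
  simp only [conj_dz_vec]

theorem dirDeriv_dz_change (hφ : IsHolChart φ) (hψ : IsHolChart ψ) (hx : x ∈ φ.source) (hx' : x ∈ ψ.source) (i : Fin n) (f : M → ℂ) :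
    dirDeriv (dz φ i x) f = ∑ a, jac φ ψ i a x * dirDeriv (dz ψ a x) f := by
  rw [dz_change hφ hψ hx hx']
  simp [dirDeriv_eq_extC]

theorem dirDeriv_dzbar_change (hφ : IsHolChart φ) (hψ : IsHolChart ψ) (hx : x ∈ φ.source) (hx' : x ∈ ψ.source) (j : Fin n) (f : M → ℂ) :
    dirDeriv (dzbar φ j x) f = ∑ b, conj (jac φ ψ j b x) * dirDeriv (dzbar ψ b x) f := by
  rw [dzbar_change hφ hψ hx hx']
  simp [dirDeriv_eq_extC]

/-- Each `∂/∂z̄ʲ` is a combination of the vectors `∂/∂w̄ᵇ` of the other chart, and these are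
annihilated by `dwᵃ`. -/
theorem dirDeriv_dzbar_coordFun (hφ : IsHolChart φ) (hψ : IsHolChart ψ) (hx : x ∈ φ.source) (hx' : x ∈ ψ.source) (j a : Fin n) :
    dirDeriv (dzbar φ j x) (coordFun ψ a) = 0 := by
  rw [dirDeriv_dzbar_change hφ hψ hx hx']
  simp [← dzForm_eq_dirDeriv hψ hx', dzForm_dzbar hψ hx']

theorem smoothOn_jac (hφ : IsHolChart φ) (hψ : IsHolChart ψ) (i a : Fin n) :
    SmoothOn (n := n) (φ.source ∩ ψ.source) (jac φ ψ i a) :=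
  smoothOn_dz_deriv hφ (φ.open_source.inter ψ.open_source) Set.inter_subset_left
    ((smoothOn_coordFun hψ a).mono Set.inter_subset_right) i

/-- If `f` is holomorphic, so is `∂f/∂zⁱ`. -/
theorem dirDeriv_dzbar_dz_eq_zero (hφ : IsHolChart φ) (hU : IsOpen U) (hUφ : U ⊆ φ.source)
    (hf : SmoothOn (n := n) U f) (j : Fin n) (hf0 : ∀ y ∈ U, dirDeriv (dzbar φ j y) f = 0)
    (hx : x ∈ U) (i : Fin n) :
    dirDeriv (dzbar φ j x) (fun y ↦ dirDeriv (dz φ i y) f) = 0 := by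
  have h := dirDeriv_congr_on hU hx hf0 (dz φ i x)
  rw [dirDeriv_const] at h
  rw [← h]
  simp only [dz_eq_constField, dzbar_eq_constField]
  exact dirDeriv_comm hφ hU hUφ hf hx _ _ _ _

theorem dirDeriv_dzbar_jac (hφ : IsHolChart φ) (hψ : IsHolChart ψ) (hx : x ∈ φ.source) (hx' : x ∈ ψ.source) (j i a : Fin n) :
    dirDeriv (dzbar φ j x) (jac φ ψ i a) = 0 :=
  dirDeriv_dzbar_dz_eq_zero hφ (φ.open_source.inter ψ.open_source) Set.inter_subset_left
    ((smoothOn_coordFun hψ a).mono Set.inter_subset_right) j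
    (fun _ hy ↦ dirDeriv_dzbar_coordFun hφ hψ hy.1 hy.2 j a) ⟨hx, hx'⟩ i

theorem jac_mul_jac (hφ : IsHolChart φ) (hψ : IsHolChart ψ) (hx : x ∈ φ.source) (hx' : x ∈ ψ.source) (i b : Fin n) :
    ∑ a, jac φ ψ i a x * jac ψ φ a b x = if i = b then 1 else 0 := by
  have h := dzForm_dz hφ hx b i
  rw [dz_change hφ hψ hx hx', dzForm_sum] at h
  simp only [eq_comm (a := i)]
  rw [← h]
  refine Finset.sum_congr rfl fun a _ ↦ ?_
  rw [dzForm_smul, dzForm_eq_dirDeriv hφ hx]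
  rfl

theorem hLow_change (hφ : IsHolChart φ) (hψ : IsHolChart ψ)
    (g : HermitianMetric n M) (hx : x ∈ φ.source) (hx' : x ∈ ψ.source) (i j : Fin n) :
    hLow g φ x i j = ∑ a, ∑ b, jac φ ψ i a x * conj (jac φ ψ j b x) * hLow g ψ x a b := by
  simp only [hLow, Matrix.of_apply]
  rw [dz_change hφ hψ hx hx', dzbar_change hφ hψ hx hx', hC_eq]
  simp only [map_sum, map_smul, LinearMap.sum_apply, LinearMap.smul_apply, smul_eq_mul,
    Finset.mul_sum, ← hC_eq]
  rw [Finset.sum_comm]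
  exact Finset.sum_congr rfl fun a _ ↦ Finset.sum_congr rfl fun b _ ↦ by ring

/-- Multiply the transformation law of `h` by the inverse Jacobian. It serves to trade a conjugate
Jacobian on one side for an inverse Jacobian on the other when `Γ` is transformed. -/
theorem sum_conj_jac_hLow (hφ : IsHolChart φ) (hψ : IsHolChart ψ)
    (g : HermitianMetric n M) (hx : x ∈ φ.source) (hx' : x ∈ ψ.source) (m l : Fin n) :
    ∑ b, conj (jac φ ψ l b x) * hLow g ψ x m b = ∑ k, jac ψ φ m k x * hLow g φ x k l := by
  simp only [hLow_change hφ hψ g hx hx', Finset.mul_sum]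
  rw [Finset.sum_comm]
  have : ∀ a, ∑ k, ∑ b, jac ψ φ m k x * (jac φ ψ k a x * conj (jac φ ψ l b x) * hLow g ψ x a b) =
      (∑ b, conj (jac φ ψ l b x) * hLow g ψ x a b) * if m = a then 1 else 0 := by
    intro a
    rw [← jac_mul_jac hψ hφ hx' hx m a, Finset.mul_sum]
    refine Finset.sum_congr rfl fun k _ ↦ ?_
    rw [Finset.sum_mul]
    exact Finset.sum_congr rfl fun b _ ↦ by ring
  simp [this]

/-- Of the three factors in the transformation law, the conjugate Jacobian is antiholomorphic and is
not seen by `∂/∂zⁱ`. -/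
theorem dirDeriv_hLow_change (hφ : IsHolChart φ) (hψ : IsHolChart ψ)
    (g : HermitianMetric n M) (hx : x ∈ φ.source) (hx' : x ∈ ψ.source) (i k l : Fin n) :
    dirDeriv (dz φ i x) (fun y ↦ hLow g φ y k l) =
      ∑ a, ∑ b, (dirDeriv (dz φ i x) (jac φ ψ k a) * conj (jac φ ψ l b x) * hLow g ψ x a b +
        jac φ ψ k a x * conj (jac φ ψ l b x) *
          dirDeriv (dz φ i x) fun y ↦ hLow g ψ y a b) := by
  have hU : IsOpen (φ.source ∩ ψ.source) := φ.open_source.inter ψ.open_source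
  have hA := fun k a ↦ (smoothOn_jac hφ hψ k a)
  have hl := fun a b ↦ (smoothOn_hLow g hψ a b).mono (n := n)
    (Set.inter_subset_right (s := φ.source))
  have d := fun {f : M → ℂ} (hf : SmoothOn (n := n) (φ.source ∩ ψ.source) f) ↦
    hf.mdifferentiableAt hU ⟨hx, hx'⟩
  rw [dirDeriv_congr_on hU ⟨hx, hx'⟩ fun y hy ↦ hLow_change hφ hψ g hy.1 hy.2 k l,
    dirDeriv_sum _ _ fun a _ ↦ d (SmoothOn.sum fun b _ ↦ ((hA k a).mul (hA l b).conj).mul (hl a b))]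
  refine Finset.sum_congr rfl fun a _ ↦ ?_
  rw [dirDeriv_sum _ _ fun b _ ↦ d (((hA k a).mul (hA l b).conj).mul (hl a b))]
  refine Finset.sum_congr rfl fun b _ ↦ ?_
  have h1 := dirDeriv_mul (dz φ i x) (d ((hA k a).mul (hA l b).conj)) (d (hl a b))
  have h2 := dirDeriv_mul (dz φ i x) (d (hA k a)) (d (hA l b).conj)
  rw [dirDeriv_dz_conj (d (hA l b)), dirDeriv_dzbar_jac hφ hψ hx hx'] at h2
  rw [h1, h2, map_zero]
  ring

/-- The transformation law of the Christoffel symbols of the Chern connection. -/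
theorem Gam_change (hφ : IsHolChart φ) (hψ : IsHolChart ψ)
    (g : HermitianMetric n M) (hx : x ∈ φ.source) (hx' : x ∈ ψ.source) (i k k' : Fin n) :
    Gam g φ i k k' x = ∑ a, dirDeriv (dz φ i x) (jac φ ψ k a) * jac ψ φ a k' x +
      ∑ a, ∑ c, ∑ m, jac φ ψ k a x * jac φ ψ i c x * Gam g ψ c a m x * jac ψ φ m k' x := by
  -- After lowering, the left side is a derivative of `h`, whose transformation law is known.
  refine congrFun (lower_injective g hφ hx (c := fun k' ↦ Gam g φ i k k' x) (d := fun k' ↦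
    ∑ a, dirDeriv (dz φ i x) (jac φ ψ k a) * jac ψ φ a k' x +
      ∑ a, ∑ c, ∑ m, jac φ ψ k a x * jac φ ψ i c x * Gam g ψ c a m x * jac ψ φ m k' x)
    fun l ↦ ?_) k'
  rw [sum_Gam_mul_hLow g hφ hx, dirDeriv_hLow_change hφ hψ g hx hx']
  simp only [Finset.sum_add_distrib, add_mul]
  congr 1
  · simp only [Finset.sum_mul]
    rw [Finset.sum_comm (s := Finset.univ) (t := Finset.univ)]
    conv_rhs => rw [Finset.sum_comm]
    rw [Finset.sum_comm]
    refine Finset.sum_congr rfl fun a _ ↦ ?_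
    have := congrArg (fun z ↦ dirDeriv (dz φ i x) (jac φ ψ k a) * z)
      (sum_conj_jac_hLow hφ hψ g hx hx' a l)
    simp only [Finset.mul_sum, ← mul_assoc] at this
    exact this
  · have e : ∀ a b, dirDeriv (dz φ i x) (fun y ↦ hLow g ψ y a b) =
        ∑ c, ∑ m, jac φ ψ i c x * (Gam g ψ c a m x * hLow g ψ x m b) := by
      intro a b
      rw [dirDeriv_dz_change hφ hψ hx hx']
      simp only [← sum_Gam_mul_hLow g hψ hx', Finset.mul_sum]
    have e2 : ∀ a, ∑ b, jac φ ψ k a x * conj (jac φ ψ l b x) *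
        dirDeriv (dz φ i x) (fun y ↦ hLow g ψ y a b) =
        ∑ k', (∑ c, ∑ m, jac φ ψ k a x * jac φ ψ i c x * Gam g ψ c a m x * jac ψ φ m k' x) *
          hLow g φ x k' l := by
      intro a
      simp only [e, Finset.mul_sum, Finset.sum_mul]
      rw [Finset.sum_comm]
      conv_rhs => rw [Finset.sum_comm]
      refine Finset.sum_congr rfl fun c _ ↦ ?_
      rw [Finset.sum_comm]
      conv_rhs => rw [Finset.sum_comm]
      refine Finset.sum_congr rfl fun m _ ↦ ?_
      have := congrArg (fun z ↦ jac φ ψ k a x * jac φ ψ i c x * Gam g ψ c a m x * z)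
        (sum_conj_jac_hLow hφ hψ g hx hx' m l)
      simp only [Finset.mul_sum] at this
      calc _ = ∑ b, jac φ ψ k a x * jac φ ψ i c x * Gam g ψ c a m x *
            (conj (jac φ ψ l b x) * hLow g ψ x m b) :=
            Finset.sum_congr rfl fun b _ ↦ by ring
        _ = _ := by
          rw [this]
          exact Finset.sum_congr rfl fun b _ ↦ by ring
    simp only [e2]
    rw [Finset.sum_comm]
    simp only [Finset.sum_mul]

/-- The inhomogeneous term is the trace of `∂J · J⁻¹` for the Jacobian `J`, i.e. `∂ log det J`. It
is holomorphic, so `∂/∂z̄ʲ` removes it. -/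
theorem traceGam_change (hφ : IsHolChart φ) (hψ : IsHolChart ψ)
    (g : HermitianMetric n M) (hx : x ∈ φ.source) (hx' : x ∈ ψ.source) (i : Fin n) :
    traceGam g φ i x = ∑ c, jac φ ψ i c x * traceGam g ψ c x +
      ∑ k, ∑ a, dirDeriv (dz φ i x) (jac φ ψ k a) * jac ψ φ a k x := by
  simp only [traceGam, Gam_change hφ hψ g hx hx', Finset.sum_add_distrib]
  rw [add_comm]
  congr 1
  rw [Finset.sum_comm]
  have e : ∀ a, ∑ k, ∑ c, ∑ m, jac φ ψ k a x * jac φ ψ i c x * Gam g ψ c a m x * jac ψ φ m k x =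
      ∑ c, jac φ ψ i c x * Gam g ψ c a a x := by
    intro a
    rw [Finset.sum_comm]
    refine Finset.sum_congr rfl fun c _ ↦ ?_
    rw [Finset.sum_comm]
    have : ∀ m, ∑ k, jac φ ψ k a x * jac φ ψ i c x * Gam g ψ c a m x * jac ψ φ m k x =
        (jac φ ψ i c x * Gam g ψ c a m x) * if m = a then 1 else 0 := by
      intro m
      rw [← jac_mul_jac hψ hφ hx' hx m a, Finset.mul_sum]
      exact Finset.sum_congr rfl fun k _ ↦ by ring
    simp [this]
  simp only [e]
  rw [Finset.sum_comm]
  simp only [Finset.mul_sum]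

/-- The coefficients `∂Γ_{ik}^k/∂z̄ʲ` transform as those of a `(1,1)`-form. -/
theorem dirDeriv_traceGam_change (hφ : IsHolChart φ) (hψ : IsHolChart ψ)
    (g : HermitianMetric n M) (hx : x ∈ φ.source) (hx' : x ∈ ψ.source) (i j : Fin n) :
    dirDeriv (dzbar φ j x) (traceGam g φ i) = ∑ a, ∑ b, jac φ ψ i a x * conj (jac φ ψ j b x) *
      dirDeriv (dzbar ψ b x) (traceGam g ψ a) := by
  have hU : IsOpen (φ.source ∩ ψ.source) := φ.open_source.inter ψ.open_source
  have d := fun {f : M → ℂ} (hf : SmoothOn (n := n) (φ.source ∩ ψ.source) f) ↦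
    hf.mdifferentiableAt hU ⟨hx, hx'⟩
  have hA := fun k a ↦ (smoothOn_jac hφ hψ k a)
  have hB : ∀ k a, SmoothOn (n := n) (φ.source ∩ ψ.source) (jac ψ φ k a) := fun k a ↦ by
    rw [Set.inter_comm]; exact smoothOn_jac hψ hφ k a
  have hG := fun c ↦ (smoothOn_traceGam g hψ c).mono (n := n)
    (Set.inter_subset_right (s := φ.source))
  have hDA := fun k a ↦ smoothOn_dz_deriv hφ hU Set.inter_subset_left (hA k a) i
  -- The inverse Jacobian is holomorphic in the coordinates `ψ`; rewriting `∂/∂z̄ʲ` through the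
  -- `∂/∂w̄ᵇ` gives the same in the coordinates `φ`.
  have hB0 : ∀ a k, dirDeriv (dzbar φ j x) (jac ψ φ a k) = 0 := by
    intro a k
    rw [dirDeriv_dzbar_change hφ hψ hx hx']
    simp [dirDeriv_dzbar_jac hψ hφ hx' hx]
  have hDA0 : ∀ k a, dirDeriv (dzbar φ j x) (fun y ↦ dirDeriv (dz φ i y) (jac φ ψ k a)) = 0 :=
    fun k a ↦ dirDeriv_dzbar_dz_eq_zero hφ hU Set.inter_subset_left (hA k a) j
      (fun y hy ↦ dirDeriv_dzbar_jac hφ hψ hy.1 hy.2 j k a) ⟨hx, hx'⟩ i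
  have s1 : SmoothOn (n := n) (φ.source ∩ ψ.source) fun y ↦
      ∑ c, jac φ ψ i c y * traceGam g ψ c y := SmoothOn.sum fun c _ ↦ (hA i c).mul (hG c)
  have s2 : ∀ k, SmoothOn (n := n) (φ.source ∩ ψ.source) fun y ↦
      ∑ a, dirDeriv (dz φ i y) (jac φ ψ k a) * jac ψ φ a k y := fun k ↦
    SmoothOn.sum fun a _ ↦ (hDA k a).mul (hB a k)
  rw [dirDeriv_congr_on hU ⟨hx, hx'⟩ fun y hy ↦ traceGam_change hφ hψ g hy.1 hy.2 i,
    dirDeriv_add _ (d s1) (d (SmoothOn.sum fun k _ ↦ s2 k)),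
    dirDeriv_sum _ _ fun c _ ↦ d ((hA i c).mul (hG c)),
    dirDeriv_sum _ _ fun k _ ↦ d (s2 k)]
  have z2 : ∑ k, dirDeriv (dzbar φ j x) (fun y ↦
      ∑ a, dirDeriv (dz φ i y) (jac φ ψ k a) * jac ψ φ a k y) = 0 := by
    refine Finset.sum_eq_zero fun k _ ↦ ?_
    rw [dirDeriv_sum _ _ fun a _ ↦ d ((hDA k a).mul (hB a k))]
    refine Finset.sum_eq_zero fun a _ ↦ ?_
    rw [dirDeriv_mul _ (d (hDA k a)) (d (hB a k)), hB0, hDA0]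
    ring
  rw [z2, add_zero]
  refine Finset.sum_congr rfl fun c _ ↦ ?_
  rw [dirDeriv_mul _ (d (hA i c)) (d (hG c)), dirDeriv_dzbar_jac hφ hψ hx hx', mul_zero, add_zero,
    dirDeriv_dzbar_change hφ hψ hx hx', Finset.mul_sum]
  exact Finset.sum_congr rfl fun b _ ↦ by ring

end Change

end

/-! ### The operators `∂` and `∂̄` on `ℂⁿ` as one family -/

section

variable {n : ℕ}

/-! ### The operators `∂` and `∂̄` on open subsets of `ℂⁿ` -/

section Flat

open ContinuousAlternatingMap

variable {V : Type*} [NormedAddCommGroup V] [NormedSpace ℝ V] [NormedSpace ℂ V]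
  [SMulCommClass ℝ ℂ V] {k : ℕ}

/-- `L ↦ (v ↦ (L v + c √-1 L (√-1 v)) / 2)`: the complex linear part of `L` for `c = -1`, the
antilinear part for `c = 1`. -/
def typePart (c : ℂ) : (CSpace n →L[ℝ] V) →L[ℝ] CSpace n →L[ℝ] V :=
  (1 / 2 : ℂ) • (ContinuousLinearMap.id ℝ _ + (c * Complex.I) •
    ContinuousLinearMap.precomp V (Complex.I • ContinuousLinearMap.id ℝ (CSpace n)))

theorem typePart_apply (c : ℂ) (L : CSpace n →L[ℝ] V) (v : CSpace n) :
    typePart c L v = (1 / 2 : ℂ) • (L v + (c * Complex.I) • L (Complex.I • v)) := rfl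

/-- The operators `∂` (for `c = -1`) and `∂̄` (for `c = 1`). -/
def typeDeriv (c : ℂ) (η : CSpace n → (CSpace n) [⋀^Fin k]→L[ℝ] ℂ) (y : CSpace n) :
    (CSpace n) [⋀^Fin (k + 1)]→L[ℝ] ℂ :=
  alternatizeUncurryFinCLM ℝ (CSpace n) ℂ (typePart c (fderiv ℝ η y))

/-- With both operators as members of one family in `c`, naturality and the anticommutation rules
need only one proof. -/
theorem delLoc_eq (η : CSpace n → (CSpace n) [⋀^Fin k]→L[ℝ] ℂ) : delLoc η = typeDeriv (-1) η := by
  funext y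
  refine congrArg alternatizeUncurryFin ?_
  refine ContinuousLinearMap.ext fun v ↦ ?_
  rw [typePart_apply, neg_one_mul, neg_smul, ← sub_eq_add_neg]
  rfl

theorem delbarLoc_eq (η : CSpace n → (CSpace n) [⋀^Fin k]→L[ℝ] ℂ) :
    delbarLoc η = typeDeriv 1 η := by
  funext y
  refine congrArg alternatizeUncurryFin ?_
  refine ContinuousLinearMap.ext fun v ↦ ?_
  rw [typePart_apply, one_mul]
  rfl

theorem typeDeriv_congr {c : ℂ} {η ζ : CSpace n → (CSpace n) [⋀^Fin k]→L[ℝ] ℂ} {y : CSpace n}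
    (h : η =ᶠ[nhds y] ζ) : typeDeriv c η y = typeDeriv c ζ y := by
  rw [typeDeriv, typeDeriv, h.fderiv_eq]

theorem contDiffOn_typeDeriv {c : ℂ} {η : CSpace n → (CSpace n) [⋀^Fin k]→L[ℝ] ℂ}
    {s : Set (CSpace n)} (hs : IsOpen s) (hη : ContDiffOn ℝ ∞ η s) :
    ContDiffOn ℝ ∞ (typeDeriv c η) s := by
  have h1 : ContDiffOn ℝ ∞ (fderiv ℝ η) s := hη.fderiv_of_isOpen hs (m := ∞) (by simp)
  have h2 : ContDiffOn ℝ ∞ (fun y ↦ typePart c (fderiv ℝ η y)) s :=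
    (typePart (V := (CSpace n) [⋀^Fin k]→L[ℝ] ℂ) c).contDiff.comp_contDiffOn h1
  exact (alternatizeUncurryFinCLM ℝ (CSpace n) ℂ).contDiff.comp_contDiffOn h2

theorem alternatize_smul (a : ℂ) (L : CSpace n →L[ℝ] (CSpace n) [⋀^Fin k]→L[ℝ] ℂ) :
    alternatizeUncurryFinCLM ℝ (CSpace n) ℂ (a • L) =
      a • alternatizeUncurryFinCLM ℝ (CSpace n) ℂ L :=
  alternatizeUncurryFin_smul a L

theorem typePart_alternatize_comp (c : ℂ)
    (G : CSpace n →L[ℝ] CSpace n →L[ℝ] (CSpace n) [⋀^Fin k]→L[ℝ] ℂ) :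
    typePart c (alternatizeUncurryFinCLM ℝ (CSpace n) ℂ ∘L G) =
      alternatizeUncurryFinCLM ℝ (CSpace n) ℂ ∘L
        typePart (V := CSpace n →L[ℝ] (CSpace n) [⋀^Fin k]→L[ℝ] ℂ) c G := by
  refine ContinuousLinearMap.ext fun v ↦ ?_
  rw [ContinuousLinearMap.comp_apply, typePart_apply, typePart_apply, alternatize_smul, map_add,
    alternatize_smul]
  rfl

/-- Taking type parts and alternating are constant linear operations, so the outer derivative passes
through them. The result is a double alternation of the second derivative, which vanishes on
symmetric arguments. -/
theorem typeDeriv_typeDeriv {c c' : ℂ} {η : CSpace n → (CSpace n) [⋀^Fin k]→L[ℝ] ℂ}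
    {y : CSpace n} (hη : ContDiffAt ℝ ∞ η y) :
    typeDeriv c' (typeDeriv c η) y = alternatizeUncurryFinCLM ℝ (CSpace n) ℂ
      (alternatizeUncurryFinCLM ℝ (CSpace n) ℂ ∘L
        typePart (V := CSpace n →L[ℝ] (CSpace n) [⋀^Fin k]→L[ℝ] ℂ) c'
          (typePart (V := (CSpace n) [⋀^Fin k]→L[ℝ] ℂ) c ∘L fderiv ℝ (fderiv ℝ η) y)) := by
  have hd : DifferentiableAt ℝ (fderiv ℝ η) y :=
    (hη.fderiv_right (m := ∞) (by simp)).differentiableAt (by simp)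
  have h : fderiv ℝ (typeDeriv c η) y = alternatizeUncurryFinCLM ℝ (CSpace n) ℂ ∘L
      (typePart (V := (CSpace n) [⋀^Fin k]→L[ℝ] ℂ) c ∘L fderiv ℝ (fderiv ℝ η) y) :=
    ((alternatizeUncurryFinCLM ℝ (CSpace n) ℂ).hasFDerivAt.comp y
      ((typePart (V := (CSpace n) [⋀^Fin k]→L[ℝ] ℂ) c).hasFDerivAt.comp y hd.hasFDerivAt)).fderiv
  rw [← typePart_alternatize_comp, ← h]
  rfl

/-- In each summand the cross terms `D(u, √-1 v)` and `D(√-1 u, v)` carry different coefficients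
when `a ≠ b`. Adding the expression with `a` and `b` exchanged gives both the coefficient `a + b`,
which restores symmetry. -/
theorem typePart_typePart_add_symm {D : CSpace n →L[ℝ] CSpace n →L[ℝ] V}
    (hs : ∀ u v, D u v = D v u) (a b : ℂ) (u v : CSpace n) :
    typePart a (typePart b ∘L D) u v + typePart b (typePart a ∘L D) u v =
      typePart a (typePart b ∘L D) v u + typePart b (typePart a ∘L D) v u := by
  have key : ∀ a b : ℂ, ∀ u v : CSpace n, typePart a (typePart b ∘L D) u v =
      (1 / 4 : ℂ) • (D u v + (b * Complex.I) • D u (Complex.I • v) +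
        (a * Complex.I) • D (Complex.I • u) v -
          (a * b) • D (Complex.I • u) (Complex.I • v)) := by
    intro a b u v
    have e : typePart a (typePart b ∘L D) u v = (1 / 2 : ℂ) • (typePart b (D u) v +
        (a * Complex.I) • typePart b (D (Complex.I • u)) v) := rfl
    rw [e, typePart_apply, typePart_apply]
    have hI : a * b = -(a * Complex.I * (b * Complex.I)) := by
      linear_combination (a * b) * Complex.I_mul_I
    rw [hI]
    module
  rw [key, key, key, key, hs v u, hs (Complex.I • v) u, hs v (Complex.I • u),
    hs (Complex.I • v) (Complex.I • u)]
  module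

/-- `∂∂̄ + ∂̄∂ = 0`, and `∂² = ∂̄² = 0` (twice). -/
theorem typeDeriv_anticomm {c c' : ℂ} {η : CSpace n → (CSpace n) [⋀^Fin k]→L[ℝ] ℂ}
    {y : CSpace n} (hη : ContDiffAt ℝ ∞ η y) :
    typeDeriv c' (typeDeriv c η) y + typeDeriv c (typeDeriv c' η) y = 0 := by
  have hs : IsSymmSndFDerivAt ℝ η y := hη.isSymmSndFDerivAt (by
    rw [minSmoothness_of_isRCLikeNormedField]; exact WithTop.coe_le_coe.mpr le_top)
  rw [typeDeriv_typeDeriv hη, typeDeriv_typeDeriv hη, ← map_add, ← ContinuousLinearMap.comp_add]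
  exact alternatizeUncurryFin_alternatizeUncurryFinCLM_comp_of_symmetric fun u v ↦
    typePart_typePart_add_symm hs c' c u v

/-- An operator that anticommutes with itself has square zero, as `2` is invertible. -/
theorem typeDeriv_self_comp {c : ℂ} {η : CSpace n → (CSpace n) [⋀^Fin k]→L[ℝ] ℂ}
    {y : CSpace n} (hη : ContDiffAt ℝ ∞ η y) : typeDeriv c (typeDeriv c η) y = 0 := by
  have h := typeDeriv_anticomm (c := c) (c' := c) hη
  ext v
  exact add_self_eq_zero.mp (DFunLike.congr_fun h v)

/-- `∂` and `∂̄` commute with pullback under holomorphic maps. -/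
theorem typeDeriv_pullback {c : ℂ} {η : CSpace n → (CSpace n) [⋀^Fin k]→L[ℝ] ℂ}
    {F : CSpace n → CSpace n} {y : CSpace n} (hη : DifferentiableAt ℝ η (F y))
    (hF : ContDiffAt ℂ ω F y) :
    typeDeriv c (fun z ↦ (η (F z)).compContinuousLinearMap (fderiv ℝ F z)) y =
      (typeDeriv c η (F y)).compContinuousLinearMap (fderiv ℝ F y) := by
  have hFR : ContDiffAt ℝ ω F y := hF.restrict_scalars ℝ
  have hdF : DifferentiableAt ℝ F y := hFR.differentiableAt (by simp)
  have hd2F : DifferentiableAt ℝ (fderiv ℝ F) y :=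
    (hFR.fderiv_right (m := 1) (by simp)).differentiableAt (by simp)
  have hI : ∀ v, fderiv ℝ F y (Complex.I • v) = Complex.I • fderiv ℝ F y v := fun v ↦
    fderiv_real_I (hF.differentiableAt (by simp)) v
  have hsymm : IsSymmSndFDerivAt ℝ F y := hFR.isSymmSndFDerivAt (by
    rw [minSmoothness_of_isRCLikeNormedField]; exact le_top)
  have hev : (fun z ↦ fderiv ℝ F z) =ᶠ[nhds y] fun z ↦ (fderiv ℂ F z).restrictScalars ℝ := by
    filter_upwards [hF.eventually (by simp)] with z hz
    exact ((hz.differentiableAt (by simp)).hasFDerivAt.restrictScalars ℝ).fderiv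
  -- Differentiating complex linearity of `DF` requires it on a neighbourhood of `y`, which `hev`
  -- supplies.
  have hI2 : ∀ u v, fderiv ℝ (fderiv ℝ F) y u (Complex.I • v) =
      Complex.I • fderiv ℝ (fderiv ℝ F) y u v := by
    intro u v
    have e1 : ∀ w, fderiv ℝ (fderiv ℝ F) y u w = fderiv ℝ (fun z ↦ fderiv ℝ F z w) y u := fun w ↦ by
      rw [fderiv_clm_apply hd2F (differentiableAt_const w)]
      simp
    have e2 : (fun z ↦ fderiv ℝ F z (Complex.I • v)) =ᶠ[nhds y]
        fun z ↦ Complex.I • fderiv ℝ F z v := by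
      filter_upwards [hev] with z hz
      rw [hz]; simp
    rw [e1, e1, e2.fderiv_eq, fderiv_fun_const_smul (hd2F.clm_apply (differentiableAt_const v))]
    rfl
  have hD : fderiv ℝ (fun z ↦ (η (F z)).compContinuousLinearMap (fderiv ℝ F z)) y =
      (compContinuousLinearMapCLM (fderiv ℝ F y)) ∘L ((fderiv ℝ η (F y)) ∘L (fderiv ℝ F y)) +
      (η (F y)).fderivCompContinuousLinearMap (fderiv ℝ F y) ∘L fderiv ℝ (fderiv ℝ F) y := by
    rw [fderiv_continuousAlternatingMapCompContinuousLinearMap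
      (f := fun z ↦ η (F z)) (hη.comp y hdF) hd2F, fderiv_fun_comp _ hη hdF]
  set D := fderiv ℝ (fderiv ℝ F) y with hDdef
  set B := (η (F y)).fderivCompContinuousLinearMap (fderiv ℝ F y) with hB
  -- The part of the derivative in which `D²F` occurs dies under alternation, by symmetry of `D²F`.
  have z1 : alternatizeUncurryFinCLM ℝ (CSpace n) ℂ (B ∘L D) = 0 :=
    alternatizeUncurryFin_fderivCompContinuousLinearMap_eq_zero _ _ fun u v ↦ hsymm u v
  -- The same holds with `√-1` inserted in one argument: `D²F` is complex linear in each slot, so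
  -- `D²F(√-1 u, v)` is again symmetric.
  have z2 : alternatizeUncurryFinCLM ℝ (CSpace n) ℂ (B ∘L
      (D ∘L (Complex.I • ContinuousLinearMap.id ℝ (CSpace n)))) = 0 := by
    refine alternatizeUncurryFin_fderivCompContinuousLinearMap_eq_zero _ _ fun u v ↦ ?_
    change D (Complex.I • u) v = D (Complex.I • v) u
    rw [hsymm (Complex.I • u) v, hsymm (Complex.I • v) u, hI2, hI2, hsymm u v]
  have z3 : alternatizeUncurryFinCLM ℝ (CSpace n) ℂ (typePart c (B ∘L D)) = 0 := by
    have : typePart c (B ∘L D) = (1 / 2 : ℂ) • (B ∘L D + (c * Complex.I) • (B ∘L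
        (D ∘L (Complex.I • ContinuousLinearMap.id ℝ (CSpace n))))) := rfl
    rw [this, alternatize_smul, map_add, alternatize_smul, z1, z2, smul_zero, add_zero, smul_zero]
  -- Here holomorphy enters once more: `DF` commutes with `√-1`, so pulling back preserves the type
  -- decomposition.
  have h1 : typePart c (compContinuousLinearMapCLM (fderiv ℝ F y) ∘L
      ((fderiv ℝ η (F y)) ∘L (fderiv ℝ F y))) = compContinuousLinearMapCLM (fderiv ℝ F y) ∘L
      (typePart c (fderiv ℝ η (F y)) ∘L (fderiv ℝ F y)) := by
    refine ContinuousLinearMap.ext fun v ↦ ?_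
    rw [typePart_apply]
    simp only [ContinuousLinearMap.comp_apply, hI, typePart_apply]
    rfl
  rw [typeDeriv, hD, map_add, map_add, z3, add_zero, h1]
  ext v
  simp +unfoldPartialApp [typeDeriv, alternatizeUncurryFin_apply, Fin.removeNth, Function.comp_def]

end Flat

end

/-! ### The operators `∂` and `∂̄` on `M`, and forms of degree one and two in coordinates -/

section

variable {n : ℕ} {M : Type*} [TopologicalSpace M] [ChartedSpace (CSpace n) M]
variable [IsManifold 𝓘(ℂ, CSpace n) ω M]
variable {φ ψ : OpenPartialHomeomorph M (CSpace n)} {U : Set M} {x : M} {f h : M → ℂ} {k : ℕ}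

/-! ### The operators `∂` and `∂̄` on the manifold -/

/-- The operators `∂` (for `c = -1`) and `∂̄` (for `c = 1`) on forms on `M`. -/
def typeD (c : ℂ) (η : CForm n M k) : CForm n M (k + 1) := fun x ↦
  (typeDeriv c (inChart (chartAt (CSpace n) x) η)
    (chartAt (CSpace n) x x)).compContinuousLinearMap (dcoord (chartAt (CSpace n) x) x)

theorem del_eq (η : CForm n M k) : del η = typeD (-1) η := by
  funext x
  rw [del, delLoc_eq]
  rfl

theorem delbar_eq (η : CForm n M k) : delbar η = typeD 1 η := by
  funext x
  rw [delbar, delbarLoc_eq]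
  rfl

theorem inChart_change (hφ : IsHolChart φ) (hψ : IsHolChart ψ) (η : CForm n M k) {z : CSpace n}
    (hz : z ∈ (φ.symm ≫ₕ ψ).source) :
    inChart φ η z = (inChart ψ η ((ψ ∘ φ.symm) z)).compContinuousLinearMap
      (fderiv ℝ (ψ ∘ φ.symm) z) := by
  have hz' : z ∈ φ.target ∧ φ.symm z ∈ ψ.source := by
    simpa [OpenPartialHomeomorph.trans_source] using hz
  have hp : φ.symm z ∈ φ.source := φ.map_target hz'.1
  have h1 := dcoord_eq_fderiv_comp hφ hψ hp hz'.2
  rw [φ.right_inv hz'.1] at h1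
  have h2 : (dsymm ψ (ψ (φ.symm z))).comp (fderiv ℝ (ψ ∘ φ.symm) z) = dsymm φ z := by
    have h3 := dsymm_dcoord hψ hz'.2
    rw [h1] at h3
    have h4 := congrArg (fun T ↦ T.comp (dsymm φ z)) h3
    simp only [ContinuousLinearMap.comp_assoc, dcoord_dsymm hφ hz'.1] at h4
    simpa using h4
  have h5 : ∀ v, dsymm φ z v = dsymm ψ (ψ (φ.symm z)) (fderiv ℝ (ψ ∘ φ.symm) z v) := fun v ↦ by
    rw [← h2]; rfl
  ext v
  change η (φ.symm z) (fun a ↦ dsymm φ z (v a)) = η (ψ.symm (ψ (φ.symm z)))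
    (fun a ↦ dsymm ψ (ψ (φ.symm z)) (fderiv ℝ (ψ ∘ φ.symm) z (v a)))
  rw [ψ.left_inv hz'.2]
  simp only [h5]

theorem SmoothForm.contDiffAt {η : CForm n M k} (hη : SmoothForm η) (hφ : IsHolChart φ)
    {y : CSpace n} (hy : y ∈ φ.target) : ContDiffAt ℝ ∞ (inChart φ η) y :=
  (hη φ hφ).contDiffAt (φ.open_target.mem_nhds hy)

/-- `∂` and `∂̄` may be computed in any holomorphic chart. -/
theorem typeD_eq {c : ℂ} {η : CForm n M k} (hη : SmoothForm η) (hφ : IsHolChart φ)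
    (hx : x ∈ φ.source) :
    typeD c η x = (typeDeriv c (inChart φ η) (φ x)).compContinuousLinearMap (dcoord φ x) := by
  set χ := chartAt (CSpace n) x with hχ
  have hχh : IsHolChart χ := isHolChart_chartAt x
  have hxχ : x ∈ χ.source := mem_chart_source _ x
  have h1 : inChart χ η =ᶠ[nhds (χ x)] fun z ↦ (inChart φ η ((φ ∘ χ.symm) z)).compContinuousLinearMap
      (fderiv ℝ (φ ∘ χ.symm) z) := by
    filter_upwards [trans_source_mem_nhds hxχ hx] with z hz using inChart_change hχh hφ η hz
  have e : (φ ∘ χ.symm) (χ x) = φ x := congrArg φ (χ.left_inv hxχ)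
  have hd : DifferentiableAt ℝ (inChart φ η) ((φ ∘ χ.symm) (χ x)) := by
    rw [e]
    exact (hη.contDiffAt hφ (φ.map_source hx)).differentiableAt (by simp)
  rw [typeD, ← hχ, typeDeriv_congr h1, typeDeriv_pullback hd (hχh.contDiffAt_comp hφ hxχ hx), e,
    dcoord_eq_fderiv_comp hχh hφ hxχ hx]
  rfl

/-- The differentials of a chart and of its inverse cancel, so a coordinate expression can be read
off from a pointwise formula on `M`. -/
theorem inChart_comp_dcoord (hφ : IsHolChart φ) {y : CSpace n} (hy : y ∈ φ.target)
    (η : CForm n M k) (ζ : (CSpace n) [⋀^Fin k]→L[ℝ] ℂ)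
    (h : η (φ.symm y) = ζ.compContinuousLinearMap (dcoord φ (φ.symm y))) :
    inChart φ η y = ζ := by
  ext v
  change η (φ.symm y) (fun a ↦ dsymm φ y (v a)) = ζ v
  rw [h]
  change ζ (fun a ↦ dcoord φ (φ.symm y) (dsymm φ y (v a))) = ζ v
  exact congrArg ζ (funext fun a ↦ DFunLike.congr_fun (dcoord_dsymm hφ hy) (v a))

/-- The definition of `typeD` uses a different preferred chart at each point. Smoothness of the
result and iteration both require its expression in one fixed chart on an open set. -/
theorem inChart_typeD {c : ℂ} {η : CForm n M k} (hη : SmoothForm η) (hφ : IsHolChart φ)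
    {y : CSpace n} (hy : y ∈ φ.target) :
    inChart φ (typeD c η) y = typeDeriv c (inChart φ η) y := by
  refine inChart_comp_dcoord hφ hy _ _ ?_
  rw [typeD_eq hη hφ (φ.map_target hy), φ.right_inv hy]

theorem SmoothForm.typeD {c : ℂ} {η : CForm n M k} (hη : SmoothForm η) :
    SmoothForm (typeD c η) := fun φ hφ ↦
  (contDiffOn_typeDeriv φ.open_target (hη φ hφ)).congr fun _ hy ↦ inChart_typeD hη hφ hy

theorem typeD_typeD {c c' : ℂ} {η : CForm n M k} (hη : SmoothForm η) (x : M) :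
    HermitianConn.typeD c' (HermitianConn.typeD c η) x =
      (typeDeriv c' (typeDeriv c (inChart (chartAt (CSpace n) x) η))
        (chartAt (CSpace n) x x)).compContinuousLinearMap (dcoord (chartAt (CSpace n) x) x) := by
  have h : inChart (chartAt (CSpace n) x) (HermitianConn.typeD c η) =ᶠ[nhds (chartAt (CSpace n) x x)]
      typeDeriv c (inChart (chartAt (CSpace n) x) η) := by
    filter_upwards [(chartAt (CSpace n) x).open_target.mem_nhds (mem_chart_target _ x)] with y hy
    exact inChart_typeD hη (isHolChart_chartAt x) hy
  rw [HermitianConn.typeD, typeDeriv_congr h]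

theorem typeD_anticomm {c c' : ℂ} {η : CForm n M k} (hη : SmoothForm η) :
    typeD c' (typeD c η) = -typeD c (typeD c' η) := by
  funext x
  have h := typeDeriv_anticomm (c := c) (c' := c')
    (hη.contDiffAt (isHolChart_chartAt x) (mem_chart_target _ x))
  rw [Pi.neg_apply, typeD_typeD hη, typeD_typeD hη, eq_neg_of_add_eq_zero_left h]
  rfl

theorem typeD_self {c : ℂ} {η : CForm n M k} (hη : SmoothForm η) : typeD c (typeD c η) = 0 := by
  funext x
  rw [typeD_typeD hη,
    typeDeriv_self_comp (hη.contDiffAt (isHolChart_chartAt x) (mem_chart_target _ x))]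
  rfl

theorem SmoothForm.smul {η : CForm n M k} (hη : SmoothForm η) (a : ℂ) : SmoothForm (a • η) :=
  fun φ hφ ↦ (hη φ hφ).const_smul a

theorem IsType.smul {p q : ℕ} {η : CForm n M k} (hη : IsType p q η) (a : ℂ) :
    IsType p q (a • η) := fun x c v ↦ by
  change a * η x _ = _ * (a * η x v)
  rw [hη x c v]
  ring

theorem typeDeriv_const_smul {c : ℂ} {η : CSpace n → (CSpace n) [⋀^Fin k]→L[ℝ] ℂ}
    {y : CSpace n} (hη : DifferentiableAt ℝ η y) (a : ℂ) :
    typeDeriv c (fun z ↦ a • η z) y = a • typeDeriv c η y := by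
  have e : typePart c (a • fderiv ℝ η y) = a • typePart c (fderiv ℝ η y) := by
    refine ContinuousLinearMap.ext fun v ↦ ?_
    rw [smul_apply, typePart_apply, typePart_apply, smul_apply, smul_apply]
    module
  rw [typeDeriv, fderiv_fun_const_smul hη, e, alternatize_smul]
  rfl

theorem typeD_smul {c : ℂ} {η : CForm n M k} (hη : SmoothForm η) (a : ℂ) :
    typeD c (a • η) = a • typeD c η := by
  funext x
  have h := typeDeriv_const_smul (c := c) ((hη.contDiffAt (isHolChart_chartAt x)
    (mem_chart_target _ x)).differentiableAt (by simp)) a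
  exact congrArg (fun ζ ↦ ζ.compContinuousLinearMap (dcoord (chartAt (CSpace n) x) x)) h

/-! ### Forms of degree one and two in coordinates -/

/-- A one-form, as an alternating map. -/
def oneForm (b : CSpace n →L[ℝ] ℂ) : (CSpace n) [⋀^Fin 1]→L[ℝ] ℂ :=
  ContinuousAlternatingMap.ofSubsingleton ℝ (CSpace n) ℂ (0 : Fin 1) b

theorem oneForm_apply (b : CSpace n →L[ℝ] ℂ) (v : Fin 1 → CSpace n) : oneForm b v = b (v 0) := rfl

/-- The coordinate `zⁱ` on `ℂⁿ`. -/
def projR (i : Fin n) : CSpace n →L[ℝ] ℂ :=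
  (EuclideanSpace.proj i : CSpace n →L[ℂ] ℂ).restrictScalars ℝ

/-- The conjugate of a complex-valued functional. -/
def conjL (b : CSpace n →L[ℝ] ℂ) : CSpace n →L[ℝ] ℂ := (Complex.conjCLE : ℂ →L[ℝ] ℂ).comp b

theorem conjL_apply (b : CSpace n →L[ℝ] ℂ) (v : CSpace n) : conjL b v = conj (b v) := rfl

theorem wedge_apply (a b : CSpace n →L[ℝ] ℂ) (v : Fin 2 → CSpace n) :
    wedge a b v = a (v 0) * b (v 1) - a (v 1) * b (v 0) := by
  rw [wedge, ContinuousAlternatingMap.alternatizeUncurryFin_apply, Fin.sum_univ_two]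
  simp [Fin.removeNth, sub_eq_add_neg]
  exact Or.inl rfl

theorem wedge_swap (a b : CSpace n →L[ℝ] ℂ) : wedge a b = -wedge b a := by
  ext v
  change wedge a b v = -wedge b a v
  rw [wedge_apply, wedge_apply]
  ring

theorem sum_smul_apply {ι : Type*} [Fintype ι] (A : ι → ℂ) (q : ι → CSpace n →L[ℝ] ℂ)
    (v : CSpace n) : (∑ i, A i • q i) v = ∑ i, A i * q i v := by simp

theorem sum_smul_alt_apply {ι : Type*} [Fintype ι] (A : ι → ℂ)
    (q : ι → (CSpace n) [⋀^Fin k]→L[ℝ] ℂ) (v : Fin k → CSpace n) :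
    (∑ i, A i • q i) v = ∑ i, A i * q i v := by simp

theorem wedge_sum_left {ι : Type*} [Fintype ι] (A : ι → ℂ) (q : ι → CSpace n →L[ℝ] ℂ)
    (b : CSpace n →L[ℝ] ℂ) : wedge (∑ i, A i • q i) b = ∑ i, A i • wedge (q i) b := by
  ext v
  simp only [wedge_apply, sum_smul_apply, sum_smul_alt_apply, Finset.sum_mul, mul_sub,
    Finset.sum_sub_distrib, mul_assoc]

theorem wedge_comp (a b : CSpace n →L[ℝ] ℂ) (T : CSpace n →L[ℝ] CSpace n) :
    wedge (a.comp T) (b.comp T) = (wedge a b).compContinuousLinearMap T := by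
  ext v
  change wedge (a.comp T) (b.comp T) v = wedge a b (fun i ↦ T (v i))
  rw [wedge_apply, wedge_apply]
  rfl

theorem typeDeriv_sum_oneForm {c : ℂ} {C : Fin n → CSpace n → ℂ} {y : CSpace n}
    (hC : ∀ i, DifferentiableAt ℝ (C i) y) (p : Fin n → CSpace n →L[ℝ] ℂ) :
    typeDeriv c (fun z ↦ ∑ i, C i z • oneForm (p i)) y =
      ∑ i, wedge (typePart c (fderiv ℝ (C i) y)) (p i) := by
  have h : fderiv ℝ (fun z ↦ ∑ i, C i z • oneForm (p i)) y =
      ∑ i, (fderiv ℝ (C i) y).smulRight (oneForm (p i)) :=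
    (HasFDerivAt.fun_sum fun i _ ↦ (hC i).hasFDerivAt.smul_const (oneForm (p i))).fderiv
  rw [typeDeriv, h, map_sum, map_sum]
  refine Finset.sum_congr rfl fun i _ ↦ ?_
  have e : typePart c ((fderiv ℝ (C i) y).smulRight (oneForm (p i))) =
      (typePart c (fderiv ℝ (C i) y)).smulRight (oneForm (p i)) := by
    refine ContinuousLinearMap.ext fun v ↦ ?_
    simp only [typePart_apply, ContinuousLinearMap.smulRight_apply, smul_eq_mul]
    module
  rw [e]
  rfl

theorem smul_eq_re_smul_add_im_smul {W : Type*} [AddCommGroup W] [Module ℂ W] [Module ℝ W]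
    [IsScalarTower ℝ ℂ W] (c : ℂ) (w : W) : c • w = c.re • w + c.im • (Complex.I • w) := by
  rw [← algebraMap_smul ℂ c.re, ← algebraMap_smul ℂ c.im, smul_smul, ← add_smul]
  exact congrArg (· • w) (Complex.re_add_im c).symm

theorem map_csmul_of_linear {V : Type*} [NormedAddCommGroup V] [NormedSpace ℝ V] [NormedSpace ℂ V]
    [IsScalarTower ℝ ℂ V] {L : CSpace n →L[ℝ] V}
    (hL : ∀ v, L (Complex.I • v) = Complex.I • L v) (c : ℂ) (v : CSpace n) :
    L (c • v) = c • L v := by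
  rw [smul_eq_re_smul_add_im_smul, smul_eq_re_smul_add_im_smul c (L v), map_add, map_smul,
    map_smul, hL]

theorem eq_sum_smul_stdVec (v : CSpace n) : v = ∑ i, v i • stdVec i := by
  ext j
  simp [stdVec, Finset.sum_apply, Pi.single_apply]

theorem eq_sum_projR {L : CSpace n →L[ℝ] ℂ} (hL : ∀ v, L (Complex.I • v) = Complex.I • L v) :
    L = ∑ i, L (stdVec i) • projR i := by
  ext v
  conv_lhs => rw [eq_sum_smul_stdVec v, map_sum]
  rw [sum_smul_apply]
  refine Finset.sum_congr rfl fun i _ ↦ ?_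
  rw [map_csmul_of_linear hL, smul_eq_mul, mul_comm]
  rfl

/-- The conjugate of an antilinear form is complex linear, so the previous expansion applies to it.
-/
theorem eq_sum_conj_projR {L : CSpace n →L[ℝ] ℂ}
    (hL : ∀ v, L (Complex.I • v) = -(Complex.I • L v)) :
    L = ∑ i, L (stdVec i) • conjL (projR i) := by
  have h := eq_sum_projR (L := conjL L) fun v ↦ by
    simp [conjL_apply, hL]
  ext v
  have h2 := congrArg conj (DFunLike.congr_fun h v)
  rw [sum_smul_apply, map_sum] at h2
  simp only [conjL_apply, map_mul, Complex.conj_conj] at h2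
  rw [h2, sum_smul_apply]
  rfl

/-- Both sides are `(L(e) - √-1 L(√-1 e)) / 2` for the real differential `L`. This links derivatives
along the frame with the operator `∂`. -/
theorem dirDeriv_dz_eq_typePart (hφ : IsHolChart φ) (hx : x ∈ φ.source)
    (hf : MDifferentiableAt 𝓘(ℝ, CSpace n) 𝓘(ℝ, ℂ) f x) (i : Fin n) :
    dirDeriv (dz φ i x) f = typePart (-1) (fderiv ℝ (f ∘ φ.symm) (φ x)) (stdVec i) := by
  rw [dz_eq_constField, dirDeriv_constField hφ hx hf, flatDeriv, typePart_apply, map_smul, map_smul]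
  simp only [Complex.real_smul, smul_eq_mul]
  push_cast
  ring

theorem dirDeriv_dzbar_eq_typePart (hφ : IsHolChart φ) (hx : x ∈ φ.source)
    (hf : MDifferentiableAt 𝓘(ℝ, CSpace n) 𝓘(ℝ, ℂ) f x) (i : Fin n) :
    dirDeriv (dzbar φ i x) f = typePart 1 (fderiv ℝ (f ∘ φ.symm) (φ x)) (stdVec i) := by
  rw [dzbar_eq_constField, dirDeriv_constField hφ hx hf, flatDeriv, typePart_apply, map_smul,
    map_smul]
  simp only [Complex.real_smul, smul_eq_mul]
  push_cast
  ring

theorem I_smul_I_smul (v : CSpace n) : Complex.I • Complex.I • v = -v := by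
  rw [smul_smul, Complex.I_mul_I, neg_one_smul]

theorem typePart_fderiv_neg_one (hφ : IsHolChart φ) (hx : x ∈ φ.source)
    (hf : MDifferentiableAt 𝓘(ℝ, CSpace n) 𝓘(ℝ, ℂ) f x) :
    typePart (-1) (fderiv ℝ (f ∘ φ.symm) (φ x)) = ∑ i, dirDeriv (dz φ i x) f • projR i := by
  simp only [dirDeriv_dz_eq_typePart hφ hx hf]
  refine eq_sum_projR fun v ↦ ?_
  simp only [typePart_apply, I_smul_I_smul, map_neg, smul_eq_mul]
  linear_combination (1 / 2 : ℂ) * fderiv ℝ (f ∘ φ.symm) (φ x) (Complex.I • v) * Complex.I_mul_I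

theorem typePart_fderiv_one (hφ : IsHolChart φ) (hx : x ∈ φ.source)
    (hf : MDifferentiableAt 𝓘(ℝ, CSpace n) 𝓘(ℝ, ℂ) f x) :
    typePart 1 (fderiv ℝ (f ∘ φ.symm) (φ x)) =
      ∑ i, dirDeriv (dzbar φ i x) f • conjL (projR i) := by
  simp only [dirDeriv_dzbar_eq_typePart hφ hx hf]
  refine eq_sum_conj_projR fun v ↦ ?_
  simp only [typePart_apply, I_smul_I_smul, map_neg, smul_eq_mul]
  linear_combination (1 / 2 : ℂ) * fderiv ℝ (f ∘ φ.symm) (φ x) (Complex.I • v) * Complex.I_mul_I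

theorem del_sum_oneForm (hφ : IsHolChart φ) (hx : x ∈ φ.source) {C : Fin n → M → ℂ}
    (hC : ∀ j, SmoothOn (n := n) φ.source (C j)) (p : Fin n → CSpace n →L[ℝ] ℂ) :
    typeDeriv (-1) (fun z ↦ ∑ j, C j (φ.symm z) • oneForm (p j)) (φ x) =
      ∑ i, ∑ j, dirDeriv (dz φ i x) (C j) • wedge (projR i) (p j) := by
  have hm := fun j ↦ (hC j).mdifferentiableAt φ.open_source hx
  rw [Finset.sum_comm]
  refine (typeDeriv_sum_oneForm (fun j ↦ differentiableAt_comp_symm hφ hx (hm j)) p).trans ?_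
  simp only [typePart_fderiv_neg_one hφ hx (hm _), wedge_sum_left]

theorem delbar_sum_oneForm (hφ : IsHolChart φ) (hx : x ∈ φ.source) {C : Fin n → M → ℂ}
    (hC : ∀ j, SmoothOn (n := n) φ.source (C j)) (p : Fin n → CSpace n →L[ℝ] ℂ) :
    typeDeriv 1 (fun z ↦ ∑ i, C i (φ.symm z) • oneForm (p i)) (φ x) =
      -∑ i, ∑ j, dirDeriv (dzbar φ j x) (C i) • wedge (p i) (conjL (projR j)) := by
  have hm := fun j ↦ (hC j).mdifferentiableAt φ.open_source hx
  refine (typeDeriv_sum_oneForm (fun j ↦ differentiableAt_comp_symm hφ hx (hm j)) p).trans ?_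
  simp only [typePart_fderiv_one hφ hx (hm _), wedge_sum_left, ← Finset.sum_neg_distrib]
  refine Finset.sum_congr rfl fun i _ ↦ Finset.sum_congr rfl fun j _ ↦ ?_
  -- The operator `∂̄` puts `dz̄ʲ` first. Moving it to second place is the origin of the relative
  -- sign in `∂θ̄₁ - ∂̄θ₁`.
  rw [wedge_swap, smul_neg]

theorem contDiffOn_sum_oneForm (hφ : IsHolChart φ) {C : Fin n → M → ℂ}
    (hC : ∀ j, SmoothOn (n := n) φ.source (C j)) (p : Fin n → CSpace n →L[ℝ] ℂ) :
    ContDiffOn ℝ ∞ (fun z ↦ ∑ j, C j (φ.symm z) • oneForm (p j)) φ.target := by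
  refine ContDiffOn.sum fun j _ ↦ ?_
  have h := (smoothOn_iff hφ subset_rfl).mp (hC j)
  exact (h.mono fun y hy ↦ ⟨hy, φ.map_target hy⟩).smul contDiffOn_const

end

/-! ### The trace form, the Ricci forms, and their Aeppli class -/

section

variable {n : ℕ} {M : Type*} [TopologicalSpace M] [ChartedSpace (CSpace n) M]
variable [IsManifold 𝓘(ℂ, CSpace n) ω M]
variable {φ ψ : OpenPartialHomeomorph M (CSpace n)} {U : Set M} {x : M} {f h : M → ℂ} {k : ℕ}

/-! ### The trace form `θ₁` -/

theorem dcoord_csmul (hφ : IsHolChart φ) (hx : x ∈ φ.source) (c : ℂ) (v : CSpace n) :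
    dcoord φ x (c • v) = c • dcoord φ x v := map_csmul_of_linear (dcoord_I hφ hx) c v

/-- The differential of holomorphic coordinates as a complex linear equivalence. -/
def dcoordLinearEquiv (hφ : IsHolChart φ) (hx : x ∈ φ.source) : CSpace n ≃ₗ[ℂ] CSpace n where
  toFun v := dcoord φ x v
  map_add' u v := map_add (dcoord φ x) u v
  map_smul' c v := dcoord_csmul hφ hx c v
  invFun v := dsymm φ (φ x) v
  left_inv v := DFunLike.congr_fun (dsymm_dcoord hφ hx) v
  right_inv v := (congrArg (dcoord φ x) (realCoordField_eq hφ hx v)).symm.trans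
    (dcoord_realCoordField hφ hx v)

theorem trace_eq_sum_conj (D : CSpace n ≃ₗ[ℂ] CSpace n) (T : CSpace n →ₗ[ℂ] CSpace n) :
    LinearMap.trace ℂ (CSpace n) T = ∑ k, D (T (D.symm (stdVec k))) k := by
  rw [← LinearMap.trace_conj' T D,
    LinearMap.trace_eq_matrix_trace ℂ (EuclideanSpace.basisFun (Fin n) ℂ).toBasis, Matrix.trace]
  refine Finset.sum_congr rfl fun k _ ↦ ?_
  simp [LinearMap.toMatrix_apply, LinearEquiv.conj_apply, stdVec]

/-- The complex trace does not depend on the basis and may be taken in the coordinate basis of any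
holomorphic chart; then the argument is expanded in the same basis. -/
theorem trForm_eq (θ : EndForm n M) (hφ : IsHolChart φ) (hx : x ∈ φ.source) :
    trForm θ x = ∑ i, traceComp θ φ i x • oneForm (dzAt φ i x) := by
  ext v
  rw [sum_smul_alt_apply]
  let A : CSpace n →L[ℂ] CSpace n →L[ℂ] CSpace n := θ.toFun x
  let tr : CSpace n →ₗ[ℂ] ℂ :=
    LinearMap.trace ℂ (CSpace n) ∘ₗ ContinuousLinearMap.coeLM ℂ ∘ₗ A.toLinearMap
  set D := dcoordLinearEquiv hφ hx with hD
  have h1 : trForm θ x v = tr (v 0) := rfl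
  have h2 : ∀ i, traceComp θ φ i x = tr (D.symm (stdVec i)) := by
    intro i
    have : tr (D.symm (stdVec i)) = LinearMap.trace ℂ (CSpace n) (A (D.symm (stdVec i))).toLinearMap :=
      rfl
    rw [this, trace_eq_sum_conj D]
    refine Finset.sum_congr rfl fun k _ ↦ ?_
    have e : ∀ i, realCoordField φ (EuclideanSpace.single i 1) x = D.symm (stdVec i) := fun i ↦
      realCoordField_eq hφ hx _
    change dcoord φ x (θ.toFun x (realCoordField φ (EuclideanSpace.single i 1) x)
      (realCoordField φ (EuclideanSpace.single k 1) x)) k = _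
    rw [e, e]
    rfl
  have h3 : v 0 = ∑ i, D (v 0) i • D.symm (stdVec i) := by
    apply D.injective
    simp only [map_sum, map_smul, LinearEquiv.apply_symm_apply]
    exact eq_sum_smul_stdVec _
  rw [h1]
  conv_lhs => rw [h3, map_sum]
  refine Finset.sum_congr rfl fun i _ ↦ ?_
  rw [map_smul, h2, smul_eq_mul, mul_comm]
  rfl

theorem inChart_trForm (θ : EndForm n M) (hφ : IsHolChart φ) {y : CSpace n} (hy : y ∈ φ.target) :
    inChart φ (trForm θ) y = ∑ i, traceComp θ φ i (φ.symm y) • oneForm (projR i) := by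
  refine inChart_comp_dcoord hφ hy _ _ ?_
  rw [trForm_eq θ hφ (φ.map_target hy)]
  ext v
  rw [sum_smul_alt_apply]
  exact (sum_smul_alt_apply (fun i ↦ traceComp θ φ i (φ.symm y)) (fun i ↦ oneForm (projR i))
    fun a ↦ dcoord φ (φ.symm y) (v a)).symm

theorem inChart_conjForm_trForm (θ : EndForm n M) (hφ : IsHolChart φ) {y : CSpace n}
    (hy : y ∈ φ.target) : inChart φ (conjForm (trForm θ)) y =
      ∑ i, conj (traceComp θ φ i (φ.symm y)) • oneForm (conjL (projR i)) := by
  ext v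
  have h := congrArg conj (DFunLike.congr_fun (inChart_trForm θ hφ hy) v)
  rw [sum_smul_alt_apply, map_sum] at h
  simp only [map_mul] at h
  rw [sum_smul_alt_apply]
  exact h

theorem smoothForm_trForm (θ : EndForm n M) : SmoothForm (trForm θ) := fun _ hφ ↦
  (contDiffOn_sum_oneForm hφ (smoothOn_traceComp θ hφ) projR).congr fun _ hy ↦
    inChart_trForm θ hφ hy

theorem smoothForm_conjForm_trForm (θ : EndForm n M) : SmoothForm (conjForm (trForm θ)) :=
  fun _ hφ ↦ (contDiffOn_sum_oneForm hφ (fun i ↦ (smoothOn_traceComp θ hφ i).conj)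
    fun i ↦ conjL (projR i)).congr fun _ hy ↦ inChart_conjForm_trForm θ hφ hy

theorem isType_trForm (θ : EndForm n M) : IsType 1 0 (trForm θ) := by
  intro x c v
  rw [trForm_eq θ (isHolChart_chartAt x) (mem_chart_source _ x), sum_smul_alt_apply,
    sum_smul_alt_apply, Finset.mul_sum]
  refine Finset.sum_congr rfl fun i _ ↦ ?_
  have : dzAt (chartAt (CSpace n) x) i x (c • v 0) = c * dzAt (chartAt (CSpace n) x) i x (v 0) :=
    congrArg (fun w : CSpace n ↦ w i)
      (dcoord_csmul (isHolChart_chartAt x) (mem_chart_source _ x) c (v 0))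
  rw [oneForm_apply, oneForm_apply, this]
  ring

theorem isType_conjForm_trForm (θ : EndForm n M) : IsType 0 1 (conjForm (trForm θ)) := by
  intro x c v
  have h := congrArg conj (isType_trForm θ x c v)
  simp only [map_mul, pow_zero, pow_one, mul_one] at h
  rw [pow_zero, pow_one, one_mul]
  exact h

/-! ### The Ricci forms -/

/-- `∑ C_{ij} dzⁱ ∧ dz̄ʲ` on `ℂⁿ`. -/
def formOfCoeff (C : Fin n → Fin n → ℂ) : (CSpace n) [⋀^Fin 2]→L[ℝ] ℂ :=
  ∑ i, ∑ j, C i j • wedge (projR i) (conjL (projR j))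

theorem sum_sum_smul_alt_apply (A : Fin n → Fin n → ℂ)
    (q : Fin n → Fin n → (CSpace n) [⋀^Fin k]→L[ℝ] ℂ) (v : Fin k → CSpace n) :
    (∑ i, ∑ j, A i j • q i j) v = ∑ i, ∑ j, A i j * q i j v := by simp

theorem formOfCoeff_apply (C : Fin n → Fin n → ℂ) (v : Fin 2 → CSpace n) :
    formOfCoeff C v = ∑ i, ∑ j, C i j * (v 0 i * conj (v 1 j) - v 1 i * conj (v 0 j)) := by
  rw [formOfCoeff, sum_sum_smul_alt_apply]
  simp only [wedge_apply]
  rfl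

theorem formOfCoeff_sub (C C' : Fin n → Fin n → ℂ) :
    formOfCoeff (fun i j ↦ C i j - C' i j) = formOfCoeff C - formOfCoeff C' := by
  ext v
  change formOfCoeff _ v = formOfCoeff C v - formOfCoeff C' v
  simp only [formOfCoeff_apply, sub_mul, Finset.sum_sub_distrib]

theorem formOfCoeff_add (C C' : Fin n → Fin n → ℂ) :
    formOfCoeff (fun i j ↦ C i j + C' i j) = formOfCoeff C + formOfCoeff C' := by
  ext v
  change formOfCoeff _ v = formOfCoeff C v + formOfCoeff C' v
  simp only [formOfCoeff_apply, add_mul, Finset.sum_add_distrib]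

theorem formOfCoeff_neg (C : Fin n → Fin n → ℂ) :
    formOfCoeff (fun i j ↦ -C i j) = -formOfCoeff C := by
  ext v
  change formOfCoeff _ v = -formOfCoeff C v
  simp only [formOfCoeff_apply, neg_mul, Finset.sum_neg_distrib]

theorem ricciLoc_eq (g : HermitianMetric n M) (φ : OpenPartialHomeomorph M (CSpace n))
    (K : Fin n → Fin n → Fin n → Fin n → M → ℂ) (x : M) :
    ricciLoc g φ K x = (Complex.I • formOfCoeff fun i j ↦
      ∑ k, ∑ l, hUp g φ x k l * K i j k l x).compContinuousLinearMap (dcoord φ x) := by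
  have e : ∀ i j, wedge (dzAt φ i x) ((Complex.conjCLE : ℂ →L[ℝ] ℂ).comp (dzAt φ j x)) =
      (wedge (projR i) (conjL (projR j))).compContinuousLinearMap (dcoord φ x) := fun i j ↦
    wedge_comp (projR i) (conjL (projR j)) (dcoord φ x)
  ext v
  have h1 : ricciLoc g φ K x v = Complex.I * (∑ i, ∑ j, (∑ k, ∑ l, hUp g φ x k l * K i j k l x) •
      (wedge (projR i) (conjL (projR j))).compContinuousLinearMap (dcoord φ x)) v := by
    simp only [ricciLoc, e]
    rfl
  rw [h1, sum_sum_smul_alt_apply]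
  exact congrArg (Complex.I * ·) (sum_sum_smul_alt_apply
    (fun i j ↦ ∑ k, ∑ l, hUp g φ x k l * K i j k l x)
    (fun i j ↦ wedge (projR i) (conjL (projR j))) fun a ↦ dcoord φ x (v a)).symm

theorem ricciLoc_apply (g : HermitianMetric n M) (φ : OpenPartialHomeomorph M (CSpace n))
    (K : Fin n → Fin n → Fin n → Fin n → M → ℂ) (x : M) (v : Fin 2 → CSpace n) :
    ricciLoc g φ K x v = Complex.I * ∑ i, ∑ j, (∑ k, ∑ l, hUp g φ x k l * K i j k l x) *
      (dzAt φ i x (v 0) * conj (dzAt φ j x (v 1)) - dzAt φ i x (v 1) * conj (dzAt φ j x (v 0))) := by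
  rw [ricciLoc_eq]
  exact congrArg (Complex.I * ·) (formOfCoeff_apply _ _)

theorem isType_ricciLoc (g : HermitianMetric n M) (hφ : IsHolChart φ) (hx : x ∈ φ.source)
    (K : Fin n → Fin n → Fin n → Fin n → M → ℂ) (c : ℂ) (v : Fin 2 → CSpace n) :
    ricciLoc g φ K x (fun a ↦ c • v a) = c ^ 1 * conj c ^ 1 * ricciLoc g φ K x v := by
  rw [ricciLoc_eq]
  change Complex.I * formOfCoeff _ (fun a ↦ dcoord φ x (c • v a)) =
    c ^ 1 * conj c ^ 1 * (Complex.I * formOfCoeff _ (fun a ↦ dcoord φ x (v a)))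
  simp only [dcoord_csmul hφ hx, formOfCoeff_apply, Finset.mul_sum]
  refine Finset.sum_congr rfl fun i _ ↦ Finset.sum_congr rfl fun j _ ↦ ?_
  simp only [PiLp.smul_apply, smul_eq_mul, map_mul]
  ring

/-- Conjugation sends `dzⁱ ∧ dz̄ʲ` to `-dzʲ ∧ dz̄ⁱ`. This sign is absorbed by the factor `√-1`, and
the exchange of indices by the Hermitian symmetry `hK`. -/
theorem conj_ricciLoc (g : HermitianMetric n M) {K : Fin n → Fin n → Fin n → Fin n → M → ℂ}
    (hK : ∀ i j, conj (∑ k, ∑ l, hUp g φ x k l * K i j k l x) =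
      ∑ k, ∑ l, hUp g φ x k l * K j i k l x) (v : Fin 2 → CSpace n) :
    conj (ricciLoc g φ K x v) = ricciLoc g φ K x v := by
  rw [ricciLoc_eq]
  change conj (Complex.I * formOfCoeff _ (fun a ↦ dcoord φ x (v a))) =
    Complex.I * formOfCoeff _ (fun a ↦ dcoord φ x (v a))
  rw [map_mul, formOfCoeff_apply, map_sum, Complex.conj_I, neg_mul, ← mul_neg]
  congr 1
  rw [Finset.sum_comm, ← Finset.sum_neg_distrib]
  simp only [map_sum (g := starRingEnd ℂ)]
  rw [Finset.sum_comm]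
  simp only [← Finset.sum_neg_distrib]
  rw [Finset.sum_comm]
  refine Finset.sum_congr rfl fun i _ ↦ Finset.sum_congr rfl fun j _ ↦ ?_
  rw [map_mul, hK]
  simp only [map_sub, map_mul, Complex.conj_conj]
  ring

theorem dfun_eq_sum (hφ : IsHolChart φ) (hx : x ∈ φ.source)
    (hf : MDifferentiableAt 𝓘(ℝ, CSpace n) 𝓘(ℝ, ℂ) f x) (v : CSpace n) :
    dfun f x v = ∑ i, dirDeriv (dz φ i x) f * dzAt φ i x v +
      ∑ i, dirDeriv (dzbar φ i x) f * conj (dzAt φ i x v) := by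
  have h1 := DFunLike.congr_fun (typePart_fderiv_neg_one hφ hx hf) (dcoord φ x v)
  have h2 := DFunLike.congr_fun (typePart_fderiv_one hφ hx hf) (dcoord φ x v)
  rw [sum_smul_apply, typePart_apply] at h1 h2
  have h3 : dfun f x v = fderiv ℝ (f ∘ φ.symm) (φ x) (dcoord φ x v) := by
    rw [dfun_eq hφ hx hf]; rfl
  have e : ∑ i, dirDeriv (dz φ i x) f * dzAt φ i x v =
    ∑ i, dirDeriv (dz φ i x) f * projR i (dcoord φ x v) := rfl
  have e' : ∑ i, dirDeriv (dzbar φ i x) f * conj (dzAt φ i x v) =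
    ∑ i, dirDeriv (dzbar φ i x) f * conjL (projR i) (dcoord φ x v) := rfl
  rw [h3, e, e', ← h1, ← h2]
  simp only [smul_eq_mul]
  ring

theorem dzAt_change (hφ : IsHolChart φ) (hψ : IsHolChart ψ) (hx : x ∈ φ.source)
    (hx' : x ∈ ψ.source) (a : Fin n) : dzAt ψ a x = ∑ i, jac φ ψ i a x • dzAt φ i x := by
  ext v
  rw [← dfun_coordFun hψ hx', dfun_eq_sum hφ hx
    ((smoothOn_coordFun hψ a).mdifferentiableAt ψ.open_source hx'), sum_smul_apply]
  simp only [dirDeriv_dzbar_coordFun hφ hψ hx hx', zero_mul, Finset.sum_const_zero, add_zero]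
  rfl

theorem sum_sesquilinear_change (J C : Fin n → Fin n → ℂ) (u w : Fin n → ℂ) :
    ∑ i, ∑ j, (∑ a, ∑ b, J i a * conj (J j b) * C a b) * (u i * conj (w j)) =
      ∑ a, ∑ b, C a b * ((∑ i, J i a * u i) * conj (∑ j, J j b * w j)) := by
  -- Grouping the four indices into two pairs reduces the reordering to one exchange of sums.
  calc _ = ∑ p : Fin n × Fin n, ∑ q : Fin n × Fin n,
        J p.1 q.1 * conj (J p.2 q.2) * C q.1 q.2 * (u p.1 * conj (w p.2)) := by
        simp only [Fintype.sum_prod_type, Finset.sum_mul]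
    _ = ∑ q : Fin n × Fin n, ∑ p : Fin n × Fin n,
        J p.1 q.1 * conj (J p.2 q.2) * C q.1 q.2 * (u p.1 * conj (w p.2)) := Finset.sum_comm
    _ = _ := by
        simp only [Fintype.sum_prod_type]
        refine Finset.sum_congr rfl fun a _ ↦ Finset.sum_congr rfl fun b _ ↦ ?_
        rw [map_sum, Finset.sum_mul_sum, Finset.mul_sum]
        simp only [Finset.mul_sum, map_mul]
        exact Finset.sum_congr rfl fun i _ ↦ Finset.sum_congr rfl fun j _ ↦ by ring

/-- The Chern-Ricci form does not depend on the coordinates. -/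
theorem ricciLoc_chernCurv_change (g : HermitianMetric n M) (hφ : IsHolChart φ)
    (hψ : IsHolChart ψ) (hx : x ∈ φ.source) (hx' : x ∈ ψ.source) :
    ricciLoc g φ (chernCurv g φ) x = ricciLoc g ψ (chernCurv g ψ) x := by
  ext v
  rw [ricciLoc_apply, ricciLoc_apply]
  have e : ∀ a (w : CSpace n), dzAt ψ a x w = ∑ i, jac φ ψ i a x * dzAt φ i x w := fun a w ↦ by
    rw [dzAt_change hφ hψ hx hx', sum_smul_apply]
  simp only [chernCurv_trace g hφ hx, chernCurv_trace g hψ hx',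
    dirDeriv_traceGam_change hφ hψ g hx hx', e, neg_mul, Finset.sum_neg_distrib, mul_sub,
    Finset.sum_sub_distrib]
  rw [sum_sesquilinear_change, sum_sesquilinear_change]

theorem chernRicci1_eq (g : HermitianMetric n M) (hφ : IsHolChart φ) (hx : x ∈ φ.source) :
    chernRicci1 g x = ricciLoc g φ (chernCurv g φ) x :=
  ricciLoc_chernCurv_change g (isHolChart_chartAt x) hφ (mem_chart_source _ x) hx

/-- The connection form `Γ_{ik}^k dzⁱ` of the Chern connection on the anticanonical bundle. -/
def chernTraceForm (g : HermitianMetric n M) (φ : OpenPartialHomeomorph M (CSpace n))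
    (y : CSpace n) : (CSpace n) [⋀^Fin 1]→L[ℝ] ℂ :=
  ∑ i, traceGam g φ i (φ.symm y) • oneForm (projR i)

theorem contDiffOn_chernTraceForm (g : HermitianMetric n M) (hφ : IsHolChart φ) :
    ContDiffOn ℝ ∞ (chernTraceForm g φ) φ.target :=
  contDiffOn_sum_oneForm hφ (smoothOn_traceGam g hφ) projR

theorem formOfCoeff_chern (g : HermitianMetric n M) (hφ : IsHolChart φ) (hx : x ∈ φ.source) :
    formOfCoeff (fun i j ↦ ∑ k, ∑ l, hUp g φ x k l * chernCurv g φ i j k l x) =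
      typeDeriv 1 (chernTraceForm g φ) (φ x) := by
  simp only [chernCurv_trace g hφ hx, formOfCoeff_neg]
  exact (delbar_sum_oneForm hφ hx (smoothOn_traceGam g hφ) projR).symm

theorem inChart_chernRicci1 (g : HermitianMetric n M) (hφ : IsHolChart φ) {y : CSpace n}
    (hy : y ∈ φ.target) :
    inChart φ (chernRicci1 g) y = Complex.I • typeDeriv 1 (chernTraceForm g φ) y := by
  refine inChart_comp_dcoord hφ hy _ _ ?_
  rw [chernRicci1_eq g hφ (φ.map_target hy), ricciLoc_eq,
    formOfCoeff_chern g hφ (φ.map_target hy), φ.right_inv hy]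

theorem smoothForm_chernRicci1 (g : HermitianMetric n M) : SmoothForm (chernRicci1 g) :=
  fun φ hφ ↦ ((contDiffOn_typeDeriv φ.open_target (contDiffOn_chernTraceForm g hφ)).const_smul
    Complex.I).congr fun _ hy ↦ inChart_chernRicci1 g hφ hy

/-- In every chart the form is `√-1 ∂̄` of the connection form `Γ_{ik}^k dzⁱ`, and `∂̄² = 0`. The
local primitive need not be global. -/
theorem delbar_chernRicci1 (g : HermitianMetric n M) : delbar (chernRicci1 g) = 0 := by
  rw [delbar_eq]
  funext x
  set φ := chartAt (CSpace n) x with hφd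
  have hφ : IsHolChart φ := isHolChart_chartAt x
  have hy : φ x ∈ φ.target := mem_chart_target _ x
  have hc := contDiffOn_chernTraceForm g hφ
  have h : inChart φ (chernRicci1 g) =ᶠ[nhds (φ x)]
      fun y ↦ Complex.I • typeDeriv 1 (chernTraceForm g φ) y := by
    filter_upwards [φ.open_target.mem_nhds hy] with y hy
    exact inChart_chernRicci1 g hφ hy
  rw [typeD, ← hφd, typeDeriv_congr h, typeDeriv_const_smul
    (((contDiffOn_typeDeriv φ.open_target hc).contDiffAt
      (φ.open_target.mem_nhds hy)).differentiableAt (by simp)),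
    typeDeriv_self_comp (hc.contDiffAt (φ.open_target.mem_nhds hy))]
  ext v
  exact mul_zero Complex.I

theorem isAeppliCocycle_chernRicci1 (g : HermitianMetric n M) :
    IsAeppliCocycle (chernRicci1 g) where
  smooth := smoothForm_chernRicci1 g
  type11 := fun x ↦ isType_ricciLoc g (isHolChart_chartAt x) (mem_chart_source _ x) _
  real := by
    funext x
    ext v
    exact conj_ricciLoc g (chernCurv_trace_conj g (isHolChart_chartAt x) (mem_chart_source _ x)) v
  closed := by rw [delbar_chernRicci1, del_zero]

variable {g : HermitianMetric n M} {cov : AffineConn n M} {θ : EndForm n M}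

/-- The traced curvature identity, with the coefficients of `∂θ̄₁` and `∂̄θ₁` recognised in the
chart `φ`. As the right side is free of `φ`, this gives both the formula for the Ricci form and its
independence of the coordinates. -/
theorem ricciLoc_RR_bar (hcov : MemAgJ g cov) (hθ : IsNabla g cov θ) (hφ : IsHolChart φ)
    (hx : x ∈ φ.source) : ricciLoc g φ (RR_bar g φ cov) x =
      chernRicci1 g x - Complex.I • (del (conjForm (trForm θ)) x - delbar (trForm θ) x) := by
  have hnhds := φ.open_target.mem_nhds (φ.map_source hx)
  have h1 : typeDeriv (-1) (inChart φ (conjForm (trForm θ))) (φ x) = formOfCoeff fun i j ↦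
      dirDeriv (dz φ i x) fun y ↦ conj (traceComp θ φ j y) := by
    rw [typeDeriv_congr (by
      filter_upwards [hnhds] with y hy using inChart_conjForm_trForm θ hφ hy)]
    exact del_sum_oneForm hφ hx (fun i ↦ (smoothOn_traceComp θ hφ i).conj) fun i ↦ conjL (projR i)
  have h2 : typeDeriv 1 (inChart φ (trForm θ)) (φ x) = -formOfCoeff fun i j ↦
      dirDeriv (dzbar φ j x) (traceComp θ φ i) := by
    rw [typeDeriv_congr (by filter_upwards [hnhds] with y hy using inChart_trForm θ hφ hy)]
    exact delbar_sum_oneForm hφ hx (smoothOn_traceComp θ hφ) projR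
  rw [del_eq, delbar_eq, typeD_eq (smoothForm_conjForm_trForm θ) hφ hx,
    typeD_eq (smoothForm_trForm θ) hφ hx, h1, h2, chernRicci1_eq g hφ hx, ricciLoc_eq, ricciLoc_eq]
  simp only [RR_bar_trace hcov hθ hφ hx]
  rw [formOfCoeff_sub, formOfCoeff_add]
  generalize formOfCoeff (fun i j ↦ ∑ k, ∑ l, hUp g φ x k l * chernCurv g φ i j k l x) = A
  generalize formOfCoeff (fun i j ↦ dirDeriv (dz φ i x) fun y ↦ conj (traceComp θ φ j y)) = B
  generalize formOfCoeff (fun i j ↦ dirDeriv (dzbar φ j x) (traceComp θ φ i)) = C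
  ext v
  have key : ∀ w : Fin 2 → CSpace n, Complex.I * (A w - (B w + C w)) =
      Complex.I * A w - Complex.I * (B w - -C w) := fun w ↦ by ring
  exact key fun a ↦ dcoord φ x (v a)

theorem ricci1_eq (hcov : MemAgJ g cov) (hθ : IsNabla g cov θ) :
    ricci1 g cov =
      chernRicci1 g - Complex.I • (del (conjForm (trForm θ)) - delbar (trForm θ)) :=
  funext fun x ↦ ricciLoc_RR_bar hcov hθ (isHolChart_chartAt x) (mem_chart_source _ x)

/-- Absorbing the factor `√-1` into the one-forms gives the shape `∂β + ∂̄α` demanded by Aeppli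
exactness. -/
theorem ricci1_eq_add (hcov : MemAgJ g cov) (hθ : IsNabla g cov θ) :
    ricci1 g cov = chernRicci1 g + (del (-Complex.I • conjForm (trForm θ)) +
      delbar (Complex.I • trForm θ)) := by
  rw [ricci1_eq hcov hθ, del_eq, del_eq, delbar_eq, delbar_eq,
    typeD_smul (smoothForm_conjForm_trForm θ), typeD_smul (smoothForm_trForm θ)]
  funext x
  ext v
  have key : ∀ a b c : ℂ, a - Complex.I * (b - c) = a + (-Complex.I * b + Complex.I * c) :=
    fun a b c ↦ by ring
  exact key _ _ _

/-- Conjugation exchanges the two derivative terms in `θ_{ik}^k` while swapping `i` and `j`; the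
Chern part is Hermitian already. -/
theorem conj_ricci1_trace (hcov : MemAgJ g cov) (hθ : IsNabla g cov θ) (hφ : IsHolChart φ)
    (hx : x ∈ φ.source) (i j : Fin n) :
    conj (∑ k, ∑ l, hUp g φ x k l * RR_bar g φ cov i j k l x) =
      ∑ k, ∑ l, hUp g φ x k l * RR_bar g φ cov j i k l x := by
  have hm := fun i ↦ (smoothOn_traceComp θ hφ i).mdifferentiableAt φ.open_source hx
  rw [RR_bar_trace hcov hθ hφ hx, RR_bar_trace hcov hθ hφ hx, map_sub, chernCurv_trace_conj g hφ hx,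
    map_add, dirDeriv_dz_conj (hm j), dirDeriv_dz_conj (hm i), Complex.conj_conj, add_comm]

theorem isAeppliCocycle_ricci1 (hcov : MemAgJ g cov) (hθ : IsNabla g cov θ) :
    IsAeppliCocycle (ricci1 g cov) where
  smooth := by
    rw [ricci1_eq_add hcov hθ, del_eq, delbar_eq]
    exact (smoothForm_chernRicci1 g).add
      (((smoothForm_conjForm_trForm θ).smul _).typeD.add ((smoothForm_trForm θ).smul _).typeD)
  type11 := fun x ↦ isType_ricciLoc g (isHolChart_chartAt x) (mem_chart_source _ x) _
  real := by
    funext x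
    ext v
    exact conj_ricciLoc g
      (conj_ricci1_trace hcov hθ (isHolChart_chartAt x) (mem_chart_source _ x)) v
  closed := by
    have h1 := (smoothForm_conjForm_trForm θ).smul (-Complex.I)
    have h2 := (smoothForm_trForm θ).smul Complex.I
    -- `∂∂̄∂β = -∂̄∂∂β = 0`. The other correction dies earlier, as `∂̄∂̄α = 0`.
    have h3 : del (delbar (del (-Complex.I • conjForm (trForm θ)))) = 0 := by
      rw [del_eq, delbar_eq, del_eq, typeD_anticomm h1.typeD, typeD_self h1, ← delbar_eq,
        delbar_zero, neg_zero]
    have h4 : delbar (delbar (Complex.I • trForm θ)) = 0 := by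
      rw [delbar_eq, delbar_eq, typeD_self h2]
    have s1 : SmoothForm (del (-Complex.I • conjForm (trForm θ))) := by
      rw [del_eq]; exact h1.typeD
    have s2 : SmoothForm (delbar (Complex.I • trForm θ)) := by
      rw [delbar_eq]; exact h2.typeD
    rw [ricci1_eq_add hcov hθ, delbar_add (smoothForm_chernRicci1 g) (s1.add s2),
      delbar_chernRicci1, zero_add, delbar_add s1 s2, h4, add_zero, h3]

theorem aeppliClass_ricci1 (hcov : MemAgJ g cov) (hθ : IsNabla g cov θ)
    (h : IsAeppliCocycle (ricci1 g cov)) (h' : IsAeppliCocycle (chernRicci1 g)) :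
    aeppliClass (ricci1 g cov) h = aeppliClass (chernRicci1 g) h' := by
  refine Quotient.sound ⟨-Complex.I • conjForm (trForm θ), Complex.I • trForm θ,
    (smoothForm_conjForm_trForm θ).smul _, (isType_conjForm_trForm θ).smul _,
    (smoothForm_trForm θ).smul _, (isType_trForm θ).smul _, ?_⟩
  exact (congrArg (· - chernRicci1 g) (ricci1_eq_add hcov hθ)).trans (add_sub_cancel_left _ _)

end

end HermitianConn

end

theorem theorem1p5 {n : ℕ} {M : Type*} [TopologicalSpace M] [T2Space M]
    [SecondCountableTopology M] [ChartedSpace (CSpace n) M] [IsManifold 𝓘(ℂ, CSpace n) ω M]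
    (g : HermitianMetric n M) (cov : AffineConn n M) (hcov : MemAgJ g cov)
    (θ : EndForm n M) (hθ : IsNabla g cov θ) :
    -- the curvature components, in arbitrary local holomorphic coordinates
    (∀ φ : OpenPartialHomeomorph M (CSpace n), IsHolChart φ → ∀ x ∈ φ.source,
      ∀ i j k l : Fin n,
        R_bar g φ cov i j k l x = RR_bar g φ cov i j k l x ∧
        RR_bar g φ cov i j k l x =
          chernCurv g φ i j k l x
          - ((∑ p, hLow g φ x k p * dirDeriv (dz φ i x) (fun y ↦ conj (θ.comp φ j l p y)))
            + ∑ p, hLow g φ x p l * dirDeriv (dzbar φ j x) (θ.comp φ i k p))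
          + ((∑ p, ∑ q, θ.comp φ i k p x * conj (θ.comp φ j l q x) * hLow g φ x p q)
            - ∑ m, ∑ r, ∑ p, ∑ q, hUp g φ x m r * θ.comp φ i m p x *
                conj (θ.comp φ j r q x) * hLow g φ x p l * hLow g φ x k q) ∧
        R_hol g φ cov i j k l x = RR_hol g φ cov i j k l x ∧
        RR_hol g φ cov i j k l x =
          (∑ m, (dirDeriv (dz φ i x) (θ.comp φ j k m) - dirDeriv (dz φ j x) (θ.comp φ i k m)
            + ∑ s, (Gam g φ j k s x * θ.comp φ i s m x - Gam g φ j s m x * θ.comp φ i k s x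
                + Gam g φ i s m x * θ.comp φ j k s x - Gam g φ i k s x * θ.comp φ j s m x))
              * hLow g φ x m l)
          + ∑ m, (∑ p, (θ.comp φ i p m x * θ.comp φ j k p x
              - θ.comp φ i k p x * θ.comp φ j p m x)) * hLow g φ x m l) ∧
    -- the two Ricci forms have the defining expression in all holomorphic coordinates
    (∀ φ : OpenPartialHomeomorph M (CSpace n), IsHolChart φ → ∀ x ∈ φ.source,
      ricci1 g cov x = ricciLoc g φ (RR_bar g φ cov) x ∧
      chernRicci1 g x = ricciLoc g φ (chernCurv g φ) x) ∧
    -- the first Ricci form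
    ricci1 g cov =
      chernRicci1 g - Complex.I • (del (conjForm (trForm θ)) - delbar (trForm θ)) ∧
    -- equality of Aeppli classes
    ∃ (h : IsAeppliCocycle (ricci1 g cov)) (h' : IsAeppliCocycle (chernRicci1 g)),
      aeppliClass (ricci1 g cov) h = aeppliClass (chernRicci1 g) h' := by 
  refine ⟨fun φ hφ x hx i j k l ↦ ⟨(curv_bar_eq hcov hθ hφ hx i j k l).1,
    RR_bar_formula hcov hθ hφ hx i j k l, (curv_hol_eq hθ hφ hx i j k l).1,
    RR_hol_formula hθ hφ hx i j k l⟩, fun φ hφ x hx ↦ ⟨?_, chernRicci1_eq g hφ hx⟩,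
    ricci1_eq hcov hθ, isAeppliCocycle_ricci1 hcov hθ, isAeppliCocycle_chernRicci1 g,
    aeppliClass_ricci1 hcov hθ _ _⟩
  -- The expression in `φ` and the one in the preferred chart equal the same chart-free form.
  rw [ricciLoc_RR_bar hcov hθ hφ hx, ricci1_eq hcov hθ]
  rfl
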